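/- Let $0<\nu\le 1$. Consider the fractional equation of vibrations of rods $$\frac{\partial^{2\nu}u}{\partial t^{2\nu}}=-\frac14\,\frac{\partial^4u}{\partial x^4},\qquad x\in\mathbb R,\ t>0,$$ with $u(x,0)=\delta(x)$ and, if $1/2<\nu\le 1$, also $u_t(x,0)=0$. Here $\partial^{\alpha}/\partial t^{\alpha}$ is the Dzhrbashyan–Caputo derivative $$\frac{d^{\alpha}f}{dt^{\alpha}}(t)=\frac1{\Gamma(m-\alpha)}\int_0^t\frac{f^{(m)}(s)}{(t-s)^{\alpha+1-m}}\,ds\quad(m-1<\alpha<m),\qquad \frac{d^{m}f}{dt^{m}}=f^{(m)},\qquad m\in\mathbb N.$$ The problem is understood in the sense of tempered distributions in $x$. A solution is a family $(u(\cdot,t))_{t>0}$ of tempered distributions on $\mathbb R$ such that, for every Schwartz function $\varphi$, the function $f_\varphi(t)=\langle u(\cdot,t),\varphi\rangle$ satisfies, with $m=\lceil 2\nu\rceil$: $f_\varphi\in C^m(0,\infty)$; when $2\nu\notin\mathbb N$, the integral defining its Caputo derivative of order $2\nu$ converges absolutely for every $t>0$; $\frac{d^{2\nu}f_\varphi}{dt^{2\nu}}(t)=-\frac14\langle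 \partial_x^4u(\cdot,t),\varphi\rangle$ for all $t>0$; $f_\varphi(t)\to\varphi(0)$ as $t\downarrow0$; and, if $\nu>1/2$, $f_\varphi'(t)\to0$ as $t\downarrow 0$. Then this problem has exactly one solution $u_{2\nu}$, the fundamental solution. It is given by a function, $\langle u_{2\nu}(\cdot,t),\varphi\rangle=\int_{\mathbb R}u_{2\nu}(x,t)\varphi(x)\,dx$ (with $u_{2\nu}(\cdot,t)\varphi$ integrable) for all $t>0$ and all Schwartz functions $\varphi$, and for all $x\in\mathbb R$, $t>0$ $$\begin{aligned}u_{2\nu}(x,t)&=\frac1{\pi\sqrt{2t^\nu}}\sum_{m=0}^\infty\frac1{m!}\left(-\sqrt2\,\frac{|x|}{\sqrt{t^\nu}}\right)^m\cos\left(\frac{m+1}4\pi\right)\sin\left(\frac{m+1}2\pi\nu\right)\Gamma\left(\frac{m+1}2\nu\right)\\&=\frac1{\sqrt{2t^\nu}}\sum_{m=0}^\infty\frac1{m!}\left(-\sqrt2\,\frac{|x|}{\sqrt{t^\nu}}\right)^m\frac{\cos\left(\frac{m+1}4\pi\right)}{\Gamma\left(1-\frac{m+1}2\nu\right)},\end{aligned}$$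 where both series converge absolutely and $1/\Gamma$ is taken to be $0$ at the poles of $\Gamma$. -/

import Mathlib

open Filter Topology MeasureTheory Set
open scoped SchwartzMap

noncomputable section

/-- The integrand `(t - s) ^ (m - 1 - α) * f⁽ᵐ⁾(s)`, `m = ⌈α⌉`, of the Caputo derivative of
order `α` at time `t`. -/
def caputoIntegrand (α : ℝ) (f : ℝ → ℂ) (t s : ℝ) : ℂ :=
  (((t - s) ^ ((⌈α⌉₊ : ℝ) - 1 - α) : ℝ) : ℂ) * iteratedDeriv ⌈α⌉₊ f s

/-- The (Dzhrbashyan--)Caputo derivative of order `α > 0` of `f : (0, ∞) → ℂ` at `t > 0`. With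
`m = ⌈α⌉` it is `f⁽ᵐ⁾(t)` if `α = m`, and
`Γ(m - α)⁻¹ ∫₀ᵗ f⁽ᵐ⁾(s) (t - s) ^ (m - 1 - α) ds` if `m - 1 < α < m`. -/
def caputoDeriv (α : ℝ) (f : ℝ → ℂ) (t : ℝ) : ℂ :=
  if α = (⌈α⌉₊ : ℝ) then iteratedDeriv ⌈α⌉₊ f t
  else ((Real.Gamma ((⌈α⌉₊ : ℝ) - α) : ℝ) : ℂ)⁻¹ * ∫ s in Ioo 0 t, caputoIntegrand α f t s

/-- `f : (0, ∞) → ℂ` has a Caputo derivative of order `α` at every positive time: it is `⌈α⌉`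
times continuously differentiable on `(0, ∞)` and, when `α` is not an integer, the integral
defining the derivative converges absolutely. The values of `f` outside `(0, ∞)` do not matter. -/
def CaputoDifferentiable (α : ℝ) (f : ℝ → ℂ) : Prop :=
  ContDiffOn ℝ (⌈α⌉₊ : ℕ) f (Ioi 0) ∧
    (α ≠ (⌈α⌉₊ : ℝ) → ∀ t : ℝ, 0 < t → IntegrableOn (caputoIntegrand α f t) (Ioo 0 t))

/-- A family `T t`, `t > 0`, of tempered distributions on `ℝ` (in the variable `x`) is a
fundamental solution of the fractional equation of vibrations of rods
`∂^{2ν} u / ∂t^{2ν} = -(1/4) ∂⁴u / ∂x⁴`, `u(x, 0) = δ(x)`, and `u_t(x, 0) = 0` when `1/2 < ν`.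
Time derivatives are taken after pairing with a Schwartz function of `x`, space derivatives in the
sense of distributions. The values `T t` with `t ≤ 0` do not matter. -/
structure IsRodFundamentalSolution (ν : ℝ) (T : ℝ → 𝓢'(ℝ, ℂ)) : Prop where
  caputoDifferentiable : ∀ φ : 𝓢(ℝ, ℂ), CaputoDifferentiable (2 * ν) (fun s => T s φ)
  equation : ∀ φ : 𝓢(ℝ, ℂ), ∀ t : ℝ, 0 < t →
    caputoDeriv (2 * ν) (fun s => T s φ) t =
      -(1 / 4) * ((TemperedDistribution.derivCLM ℂ)^[4] (T t)) φ
  initial_value : Tendsto T (𝓝[>] 0) (𝓝 (TemperedDistribution.delta (0 : ℝ)))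
  initial_velocity : 1 / 2 < ν → ∀ φ : 𝓢(ℝ, ℂ),
    Tendsto (fun t => deriv (fun s => T s φ) t) (𝓝[>] 0) (𝓝 0)

/-- The `m`-th term of the series for the solution, in the form with sine and Gamma function. -/
def rodTermSin (ν x t : ℝ) (m : ℕ) : ℝ :=
  1 / (m.factorial : ℝ) * (-√2 * (|x| / √(t ^ ν))) ^ m
    * Real.cos (((m : ℝ) + 1) / 4 * Real.pi)
    * Real.sin (((m : ℝ) + 1) / 2 * Real.pi * ν)
    * Real.Gamma (((m : ℝ) + 1) / 2 * ν)

/-- The `m`-th term of the series for the solution, in the form with the reciprocal Gamma function.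
At the poles of `Γ` the Mathlib value `Real.Gamma = 0` gives `1 / Γ = 0`, as it should be. -/
def rodTermInvGamma (ν x t : ℝ) (m : ℕ) : ℝ :=
  1 / (m.factorial : ℝ) * (-√2 * (|x| / √(t ^ ν))) ^ m
    * (Real.cos (((m : ℝ) + 1) / 4 * Real.pi) / Real.Gamma (1 - ((m : ℝ) + 1) / 2 * ν))

/-- The function `u_{2ν}(x, t)` given by the series with sine and Gamma function. -/
def rodSolution (ν x t : ℝ) : ℝ :=
  1 / (Real.pi * √(2 * t ^ ν)) * ∑' m : ℕ, rodTermSin ν x t m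

end

/-! For the Fourier transform with kernel e^{-2πikx}, ∂⁴/4 becomes multiplication by λ = 4π⁴k⁴. Each
frequency then obeys a scalar Caputo equation, equivalent to the Volterra equation y = 1 - λ I^{2ν}
y, whose solution is the Mittag-Leffler function E_{2ν}(-λ t^{2ν}) (`mittagLeffler_volterra`). Three
things remain: this multiplier must give a solution, it must be the only one, and its inverse
transform must be the series.

Existence. The multiplier is bounded, hence defines a tempered distribution. Pairing it with ψ, λψ,
λ²ψ, ... gives functions G₀, G₁, ... with Gₙ = cₙ - I^{2ν} Gₙ₊₁ (`VolterraSeq`). Iterating, G₀ is a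
finite sum of powers t^{2νj} plus a fractional integral of order as high as desired, so regularity,
the Caputo derivative -G₁ and the initial values can be read off termwise (`VolterraSeq.caputo`,
`VolterraSeq.tendsto_deriv`).

Uniqueness. Any solution yields the same hierarchy with the same constants (`volterra_of_caputo`),
so a difference of two has all cₙ = 0 and G₀ = ± I^{2νN} G_N. If ψ has compact support, λⁿψ grows
only geometrically in every Schwartz seminorm, and uniform boundedness transfers this growth to Gₙ;
the factor 1/Γ(2νN+1) then forces G₀ = 0. Such ψ are dense.

Series, ν < 1. Hankel's formula writes 1/Γ as a contour integral of e^s s^w. The contour is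
symmetric about the real axis, so the imaginary part of the integral over its upper ray suffices
(`hankelIm_eq`). Summing under the integral turns the series at t = 1 into an integral of e^s
s^{ν/2-1} `rodKernel` (s^{ν/2}) x. The ray can be tilted so that the kernel decays exponentially in
|x|; Fubini then shows that u is integrable and that its cosine transform is (1/π) Im ∫ e^s
s^{2ν-1}/(s^{2ν}+ξ⁴/4) ds, which a geometric expansion and Hankel's formula identify with
E_{2ν}(-ξ⁴/4). This also bounds the multiplier. Other times follow by scaling.

Series, ν = 1. The tilt is impossible and u is not integrable. The series sums to cos(x²/(2t) -
π/4)/√(2πt), the multiplier is cos(2π²k²t), and the two are matched by a Fresnel integral, a limit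
of Gaussians (`integral_fresnel`). -/

open scoped FourierTransform

/-! ### Riemann--Liouville integrals -/

lemma integral_Ioo_rpow_mul_rpow {a b : ℝ} (ha : 0 < a) (hb : 0 < b) {r t : ℝ} (hrt : r < t) :
    ∫ s in Ioo r t, (t - s) ^ (a - 1) * (s - r) ^ (b - 1) =
      Real.Gamma a * Real.Gamma b / Real.Gamma (a + b) * (t - r) ^ (a + b - 1) := by
  have h0 : 0 < t - r := sub_pos.2 hrt
  have h := Complex.betaIntegral_scaled (b : ℂ) (a : ℂ) h0
  rw [Complex.betaIntegral_eq_Gamma_mul_div _ _ (by simpa) (by simpa)] at h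
  have h2 : ∫ s in Ioo r t, (t - s) ^ (a - 1) * (s - r) ^ (b - 1)
      = ∫ x in (0 : ℝ)..(t - r), x ^ (b - 1) * ((t - r) - x) ^ (a - 1) := by
    have := intervalIntegral.integral_comp_sub_right
      (fun x : ℝ => x ^ (b - 1) * ((t - r) - x) ^ (a - 1)) (a := r) (b := t) r
    rw [sub_self] at this
    rw [← this, intervalIntegral.integral_of_le hrt.le, integral_Ioc_eq_integral_Ioo]
    refine setIntegral_congr_fun measurableSet_Ioo fun s _ => ?_
    simp only [sub_sub_sub_cancel_right]
    ring
  have h3 : ((∫ x in (0 : ℝ)..(t - r), x ^ (b - 1) * ((t - r) - x) ^ (a - 1) : ℝ) : ℂ)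
      = ∫ x in (0 : ℝ)..(t - r), (x : ℂ) ^ ((b : ℂ) - 1) * (((t - r : ℝ) : ℂ) - x) ^ ((a : ℂ) - 1) := by
    rw [← intervalIntegral.integral_ofReal]
    refine intervalIntegral.integral_congr fun x hx => ?_
    rw [uIcc_of_le h0.le] at hx
    simp only [Complex.ofReal_mul]
    rw [Complex.ofReal_cpow hx.1, Complex.ofReal_cpow (sub_nonneg.2 hx.2)]
    push_cast
    ring
  rw [← h3] at h
  rw [h2]
  apply Complex.ofReal_injective
  rw [h]
  rw [show (b : ℂ) + a - 1 = ((a + b - 1 : ℝ) : ℂ) by push_cast; ring, ← Complex.ofReal_cpow h0.le,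
    show (b : ℂ) + a = ((a + b : ℝ) : ℂ) by push_cast; ring]
  simp only [Complex.Gamma_ofReal]
  push_cast
  ring

/-- A non-integrable function has Bochner integral 0, whereas the Beta integral just computed is
positive. -/
lemma integrableOn_Ioo_rpow_mul_rpow {a b : ℝ} (ha : 0 < a) (hb : 0 < b) {r t : ℝ} (hrt : r < t) :
    IntegrableOn (fun s => (t - s) ^ (a - 1) * (s - r) ^ (b - 1)) (Ioo r t) := by
  by_contra h
  have h1 := integral_Ioo_rpow_mul_rpow ha hb hrt
  rw [integral_undef h] at h1
  have := Real.Gamma_pos_of_pos ha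
  have := Real.Gamma_pos_of_pos hb
  have := Real.Gamma_pos_of_pos (add_pos ha hb)
  have := Real.rpow_pos_of_pos (sub_pos.2 hrt) (a + b - 1)
  have : 0 < Real.Gamma a * Real.Gamma b / Real.Gamma (a + b) * (t - r) ^ (a + b - 1) := by
    positivity
  exact this.ne h1

noncomputable section

/-- The Riemann--Liouville integral of order `γ > 0` based at `0`. -/
def rlInt (γ : ℝ) (g : ℝ → ℂ) (t : ℝ) : ℂ :=
  ((Real.Gamma γ : ℝ) : ℂ)⁻¹ * ∫ s in Ioo 0 t, (((t - s) ^ (γ - 1) : ℝ) : ℂ) * g s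

end

lemma rlInt_congr {γ : ℝ} {g h : ℝ → ℂ} {t : ℝ} (hgh : ∀ s ∈ Ioo 0 t, g s = h s) :
    rlInt γ g t = rlInt γ h t := by
  unfold rlInt
  congr 1
  exact setIntegral_congr_fun measurableSet_Ioo fun s hs => by simp only [hgh s hs]

lemma rlInt_const_mul (γ : ℝ) (g : ℝ → ℂ) (t : ℝ) (c : ℂ) :
    rlInt γ (fun s => c * g s) t = c * rlInt γ g t := by
  unfold rlInt
  rw [mul_left_comm c, ← integral_const_mul c]
  congr 1
  refine integral_congr_ae (.of_forall fun s => ?_)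
  simp only
  ring

lemma rlInt_one (g : ℝ → ℂ) (t : ℝ) : rlInt 1 g t = ∫ s in Ioo 0 t, g s := by
  simp [rlInt]

lemma rlInt_rpow {a b : ℝ} (ha : 0 < a) (hb : -1 < b) {t : ℝ} (ht : 0 < t) :
    rlInt a (fun s => ((s ^ b / Real.Gamma (b + 1) : ℝ) : ℂ)) t =
      ((t ^ (a + b) / Real.Gamma (a + b + 1) : ℝ) : ℂ) := by
  have h := integral_Ioo_rpow_mul_rpow ha (by linarith : 0 < b + 1) ht
  simp only [sub_zero, add_sub_cancel_right] at h
  unfold rlInt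
  have h2 : (∫ s in Ioo 0 t, (((t - s) ^ (a - 1) : ℝ) : ℂ) * ((s ^ b / Real.Gamma (b + 1) : ℝ) : ℂ))
      = (((∫ s in Ioo 0 t, (t - s) ^ (a - 1) * s ^ b) / Real.Gamma (b + 1) : ℝ) : ℂ) := by
    rw [← integral_div, ← integral_complex_ofReal]
    refine integral_congr_ae (.of_forall fun s => ?_)
    simp only
    push_cast
    ring
  rw [h2, h]
  have h3 := (Real.Gamma_pos_of_pos ha).ne'
  have h4 := (Real.Gamma_pos_of_pos (by linarith : 0 < b + 1)).ne'
  rw [← Complex.ofReal_inv, ← Complex.ofReal_mul, show a + (b + 1) = a + b + 1 by ring,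
    show a + b + 1 - 1 = a + b by ring]
  congr 1
  field_simp

lemma integrableOn_kernel {γ : ℝ} (hγ : 0 < γ) {t : ℝ} (ht : 0 < t) :
    IntegrableOn (fun s => (t - s) ^ (γ - 1)) (Ioo 0 t) := by
  simpa using integrableOn_Ioo_rpow_mul_rpow hγ one_pos ht

lemma integrableOn_kernel_mul_of_bounded {γ : ℝ} (hγ : 0 < γ) {t : ℝ} {g : ℝ → ℂ}
    (hg : AEStronglyMeasurable g (volume.restrict (Ioo 0 t))) {C : ℝ}
    (hC : ∀ s ∈ Ioo 0 t, ‖g s‖ ≤ C) :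
    IntegrableOn (fun s => (((t - s) ^ (γ - 1) : ℝ) : ℂ) * g s) (Ioo 0 t) := by
  rcases le_or_gt t 0 with ht | ht
  · simp [Ioo_eq_empty (not_lt.2 ht)]
  exact (integrableOn_kernel hγ ht).ofReal.mul_bdd hg
    (ae_restrict_of_forall_mem measurableSet_Ioo hC)

lemma integrableOn_kernel_mul_of_one_le {γ : ℝ} (hγ : 1 ≤ γ) {t : ℝ} {g : ℝ → ℂ}
    (hg : IntegrableOn g (Ioo 0 t)) :
    IntegrableOn (fun s => (((t - s) ^ (γ - 1) : ℝ) : ℂ) * g s) (Ioo 0 t) := by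
  refine Integrable.bdd_mul (c := t ^ (γ - 1)) hg ?_ ?_
  · exact (by fun_prop : Measurable fun s : ℝ => (((t - s) ^ (γ - 1) : ℝ) : ℂ)).aestronglyMeasurable
  · refine ae_restrict_of_forall_mem measurableSet_Ioo fun s hs => ?_
    rw [Complex.norm_real, Real.norm_of_nonneg (Real.rpow_nonneg (by linarith [hs.2]) _)]
    exact Real.rpow_le_rpow (by linarith [hs.2]) (by linarith [hs.1]) (by linarith)

lemma rlInt_add {γ : ℝ} {g h : ℝ → ℂ} {t : ℝ}
    (hg : IntegrableOn (fun s => (((t - s) ^ (γ - 1) : ℝ) : ℂ) * g s) (Ioo 0 t))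
    (hh : IntegrableOn (fun s => (((t - s) ^ (γ - 1) : ℝ) : ℂ) * h s) (Ioo 0 t)) :
    rlInt γ (fun s => g s + h s) t = rlInt γ g t + rlInt γ h t := by
  unfold rlInt
  rw [← mul_add, ← integral_add hg hh]
  simp only [mul_add]

lemma rlInt_sub {γ : ℝ} {g h : ℝ → ℂ} {t : ℝ}
    (hg : IntegrableOn (fun s => (((t - s) ^ (γ - 1) : ℝ) : ℂ) * g s) (Ioo 0 t))
    (hh : IntegrableOn (fun s => (((t - s) ^ (γ - 1) : ℝ) : ℂ) * h s) (Ioo 0 t)) :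
    rlInt γ (fun s => g s - h s) t = rlInt γ g t - rlInt γ h t := by
  unfold rlInt
  rw [← mul_sub, ← integral_sub hg hh]
  simp only [mul_sub]

lemma rlInt_sum {ι : Type*} {γ : ℝ} {g : ι → ℝ → ℂ} {t : ℝ} (S : Finset ι)
    (hg : ∀ i ∈ S, IntegrableOn (fun s => (((t - s) ^ (γ - 1) : ℝ) : ℂ) * g i s) (Ioo 0 t)) :
    rlInt γ (fun s => ∑ i ∈ S, g i s) t = ∑ i ∈ S, rlInt γ (g i) t := by
  unfold rlInt
  rw [← Finset.mul_sum, ← integral_finsetSum S hg]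
  simp only [Finset.mul_sum]

lemma norm_rlInt_le {γ : ℝ} (hγ : 0 < γ) {t : ℝ} (ht : 0 < t) {g : ℝ → ℂ} {C : ℝ}
    (hC : ∀ s ∈ Ioo 0 t, ‖g s‖ ≤ C) : ‖rlInt γ g t‖ ≤ C * (t ^ γ / Real.Gamma (γ + 1)) := by
  have h1 : ‖∫ s in Ioo 0 t, (((t - s) ^ (γ - 1) : ℝ) : ℂ) * g s‖
      ≤ ∫ s in Ioo 0 t, (t - s) ^ (γ - 1) * C := by
    refine norm_integral_le_of_norm_le ((integrableOn_kernel hγ ht).mul_const C) ?_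
    refine ae_restrict_of_forall_mem measurableSet_Ioo fun s hs => ?_
    have : 0 ≤ (t - s) ^ (γ - 1) := Real.rpow_nonneg (by linarith [hs.2]) _
    rw [norm_mul, Complex.norm_real, Real.norm_of_nonneg this]
    exact mul_le_mul_of_nonneg_left (hC s hs) this
  have h2 := integral_Ioo_rpow_mul_rpow hγ one_pos ht
  simp only [sub_self, Real.rpow_zero, mul_one, Real.Gamma_one, add_sub_cancel_right, sub_zero] at h2
  rw [integral_mul_const, h2] at h1
  have h3 := Real.Gamma_pos_of_pos hγ
  unfold rlInt
  rw [norm_mul, norm_inv, Complex.norm_real, Real.norm_of_nonneg h3.le]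
  calc (Real.Gamma γ)⁻¹ * _ ≤ (Real.Gamma γ)⁻¹ * _ := mul_le_mul_of_nonneg_left h1 (by positivity)
    _ = _ := by field_simp

/-- Semigroup property of Riemann--Liouville integrals. -/
lemma rlInt_rlInt {a b : ℝ} (ha : 0 < a) (hb : 0 < b) {t : ℝ} {g : ℝ → ℂ}
    (hgm : AEStronglyMeasurable g (volume.restrict (Ioo 0 t)))
    (hg : IntegrableOn (fun s => (((t - s) ^ (a + b - 1) : ℝ) : ℂ) * g s) (Ioo 0 t)) :
    rlInt a (rlInt b g) t = rlInt (a + b) g t := by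
  set μ := volume.restrict (Ioo 0 t)
  set B := Real.Gamma a * Real.Gamma b / Real.Gamma (a + b) with hB
  let k : ℝ → ℝ → ℝ := fun r s => (Ioi r).indicator
    (fun s => (t - s) ^ (a - 1) * (s - r) ^ (b - 1)) s
  have hk : ∀ r ∈ Ioo 0 t, IntegrableOn (k r) (Ioo 0 t) ∧
      ∫ s in Ioo 0 t, k r s = B * (t - r) ^ (a + b - 1) := by
    intro r hr
    have e : Ioo 0 t ∩ Ioi r = Ioo r t := by
      ext s; simp only [mem_inter_iff, mem_Ioo, mem_Ioi]; constructor
      · rintro ⟨⟨_, h⟩, h'⟩; exact ⟨h', h⟩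
      · rintro ⟨h, h'⟩; exact ⟨⟨hr.1.trans h, h'⟩, h⟩
    constructor
    · rw [integrableOn_indicator_iff measurableSet_Ioi, inter_comm, e]
      exact integrableOn_Ioo_rpow_mul_rpow ha hb hr.2
    · rw [setIntegral_indicator measurableSet_Ioi, e]
      exact integral_Ioo_rpow_mul_rpow ha hb hr.2
  have hk0 : ∀ r s, s ∈ Ioo 0 t → 0 ≤ k r s := by
    intro r s hs
    refine indicator_apply_nonneg (fun h => ?_)
    exact mul_nonneg (Real.rpow_nonneg (by linarith [hs.2]) _)
      (Real.rpow_nonneg (by linarith [mem_Ioi.1 h]) _)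
  have hkm : Measurable (Function.uncurry k) := by
    have : Function.uncurry k = {p : ℝ × ℝ | p.1 < p.2}.indicator
        (fun p => (t - p.2) ^ (a - 1) * (p.2 - p.1) ^ (b - 1)) := by
      ext ⟨r, s⟩
      simp only [Function.uncurry, k, indicator, mem_Ioi, mem_ofPred_eq]
    rw [this]
    exact Measurable.indicator (by fun_prop) (measurableSet_lt measurable_fst measurable_snd)
  -- With s integrated first, the inner integral is a Beta integral, so absolute integrability on
  -- the triangle r < s reduces to the hypothesis on the kernel of order a + b.
  have hint : Integrable (Function.uncurry fun r s => ((k r s : ℝ) : ℂ) * g r) (μ.prod μ) := by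
    have hm : AEStronglyMeasurable (Function.uncurry fun r s => ((k r s : ℝ) : ℂ) * g r)
        (μ.prod μ) := by
      refine AEStronglyMeasurable.mul ?_ hgm.comp_fst
      exact (Complex.measurable_ofReal.comp hkm).aestronglyMeasurable
    rw [integrable_prod_iff hm]
    constructor
    · refine ae_restrict_of_forall_mem measurableSet_Ioo fun r hr => ?_
      exact Integrable.mul_const (hk r hr).1.ofReal (g r)
    · have : Integrable (fun r => B * ‖(((t - r) ^ (a + b - 1) : ℝ) : ℂ) * g r‖) μ :=
        hg.norm.const_mul B
      refine this.congr (ae_restrict_of_forall_mem measurableSet_Ioo fun r hr => ?_)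
      have h1 : ∫ s, ‖Function.uncurry (fun r s => ((k r s : ℝ) : ℂ) * g r) (r, s)‖ ∂μ
          = ∫ s, k r s * ‖g r‖ ∂μ := by
        refine setIntegral_congr_fun measurableSet_Ioo fun s hs => ?_
        simp only [Function.uncurry, norm_mul, Complex.norm_real, Real.norm_of_nonneg (hk0 r s hs)]
      refine Eq.trans ?_ h1.symm
      change B * ‖(((t - r) ^ (a + b - 1) : ℝ) : ℂ) * g r‖ = _
      rw [integral_mul_const, (hk r hr).2, norm_mul, Complex.norm_real,
        Real.norm_of_nonneg (Real.rpow_nonneg (by linarith [hr.2]) _), mul_assoc]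
  have hswap := integral_integral_swap hint
  have hl : ∫ r, ∫ s, ((k r s : ℝ) : ℂ) * g r ∂μ ∂μ
      = (B : ℂ) * ∫ r in Ioo 0 t, (((t - r) ^ (a + b - 1) : ℝ) : ℂ) * g r := by
    rw [← integral_const_mul]
    refine setIntegral_congr_fun measurableSet_Ioo fun r hr => ?_
    rw [integral_mul_const, integral_complex_ofReal, (hk r hr).2]
    push_cast
    ring
  have hr : ∫ s, ∫ r, ((k r s : ℝ) : ℂ) * g r ∂μ ∂μ
      = ∫ s in Ioo 0 t, (((t - s) ^ (a - 1) : ℝ) : ℂ) *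
        ∫ r in Ioo 0 s, (((s - r) ^ (b - 1) : ℝ) : ℂ) * g r := by
    refine setIntegral_congr_fun measurableSet_Ioo fun s hs => ?_
    have e : Ioo 0 t ∩ Iio s = Ioo 0 s := by
      ext r; simp only [mem_inter_iff, mem_Ioo, mem_Iio]; constructor
      · rintro ⟨⟨h, _⟩, h'⟩; exact ⟨h, h'⟩
      · rintro ⟨h, h'⟩; exact ⟨⟨h, h'.trans hs.2⟩, h'⟩
    rw [← integral_const_mul, ← e, ← setIntegral_indicator measurableSet_Iio]
    congr 1
    ext r
    by_cases h : r < s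
    · simp [k, h, mul_assoc]
    · simp [k, h]
  rw [hl, hr] at hswap
  have h3 : ((Real.Gamma a : ℝ) : ℂ) ≠ 0 := by exact_mod_cast (Real.Gamma_pos_of_pos ha).ne'
  have h4 : ((Real.Gamma b : ℝ) : ℂ) ≠ 0 := by exact_mod_cast (Real.Gamma_pos_of_pos hb).ne'
  have h5 : ((Real.Gamma (a + b) : ℝ) : ℂ) ≠ 0 := by
    exact_mod_cast (Real.Gamma_pos_of_pos (add_pos ha hb)).ne'
  have e1 : rlInt a (rlInt b g) t = ((Real.Gamma a : ℝ) : ℂ)⁻¹ * (((Real.Gamma b : ℝ) : ℂ)⁻¹ *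
      ∫ s in Ioo 0 t, (((t - s) ^ (a - 1) : ℝ) : ℂ) *
        ∫ r in Ioo 0 s, (((s - r) ^ (b - 1) : ℝ) : ℂ) * g r) := by
    rw [rlInt, ← integral_const_mul ((Real.Gamma b : ℝ) : ℂ)⁻¹]
    congr 1
    refine integral_congr_ae (.of_forall fun s => ?_)
    simp only [rlInt]
    ring
  rw [e1, ← hswap, rlInt, hB]
  push_cast
  field_simp

lemma rlInt_continuousOn_of_one {g : ℝ → ℂ} (hg : ∀ t, 0 < t → IntegrableOn g (Ioo 0 t)) :
    ContinuousOn (rlInt 1 g) (Ioi 0) := by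
  intro t ht
  have ht : 0 < t := ht
  have h1 : IntegrableOn g (Icc 0 (t + 1)) := by
    rw [integrableOn_Icc_iff_integrableOn_Ioo]; exact hg _ (by linarith)
  have h2 := (intervalIntegral.continuousOn_primitive (a := 0) (b := t + 1) (f := g) (μ := volume) h1)
  have h3 : ContinuousAt (fun x => ∫ s in Ioc 0 x, g s) t :=
    h2.continuousAt (Icc_mem_nhds ht (by linarith))
  have h4 : (rlInt 1 g) = (fun x => ∫ s in Ioc 0 x, g s) := by
    ext x; rw [rlInt_one, integral_Ioc_eq_integral_Ioo]
  rw [h4]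
  exact h3.continuousWithinAt

lemma hasDerivAt_rlInt_one {g : ℝ → ℂ} {t : ℝ} (ht : 0 < t) (hg : IntegrableOn g (Ioo 0 t))
    (hc : ContinuousOn g (Ioi 0)) : HasDerivAt (rlInt 1 g) (g t) t := by
  have h0 : IntervalIntegrable g volume 0 t := by
    rw [intervalIntegrable_iff_integrableOn_Ioo_of_le ht.le]; exact hg
  have h := intervalIntegral.integral_hasDerivAt_right h0
    (hc.stronglyMeasurableAtFilter isOpen_Ioi t ht) (hc.continuousAt (Ioi_mem_nhds ht))
  refine h.congr_of_eventuallyEq ?_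
  filter_upwards [Ioi_mem_nhds ht] with x hx
  rw [rlInt_one, intervalIntegral.integral_of_le (le_of_lt hx), integral_Ioc_eq_integral_Ioo]

/-! ### The Mittag-Leffler function -/

/-- Only the part x > K of the Gamma integral is kept. As K is free, Γ outgrows every geometric
sequence, which is all that convergence of the Mittag-Leffler series needs. -/
lemma rpow_mul_exp_neg_le_Gamma {s K : ℝ} (hs : 0 ≤ s) (hK : 0 < K) :
    K ^ s * Real.exp (-K) ≤ Real.Gamma (s + 1) := by
  have hi := Real.GammaIntegral_convergent (by linarith : 0 < s + 1)
  rw [Real.Gamma_eq_integral (by linarith)]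
  have h1 : ∫ x in Ioi K, Real.exp (-x) * K ^ s = K ^ s * Real.exp (-K) := by
    rw [integral_mul_const, integral_exp_neg_Ioi, mul_comm]
  rw [← h1]
  calc ∫ x in Ioi K, Real.exp (-x) * K ^ s
      ≤ ∫ x in Ioi K, Real.exp (-x) * x ^ (s + 1 - 1) := by
        refine setIntegral_mono_on ?_ (hi.mono_set (Ioi_subset_Ioi hK.le)) measurableSet_Ioi ?_
        · exact (integrableOn_exp_neg_Ioi K).mul_const _
        · intro x hx
          rw [add_sub_cancel_right]
          exact mul_le_mul_of_nonneg_left (Real.rpow_le_rpow hK.le (le_of_lt hx) hs)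
            (Real.exp_pos _).le
    _ ≤ _ := by
        refine setIntegral_mono_set hi ?_ (Ioi_subset_Ioi hK.le).eventuallyLE
        refine ae_restrict_of_forall_mem measurableSet_Ioi fun x hx => ?_
        exact mul_nonneg (Real.exp_pos _).le (Real.rpow_nonneg (le_of_lt hx) _)

noncomputable section

/-- The Mittag-Leffler function `E_α`. -/
def mittagLeffler (α x : ℝ) : ℝ := ∑' n : ℕ, x ^ n / Real.Gamma (α * n + 1)

end

lemma summable_mittagLeffler {α : ℝ} (hα : 0 < α) (x : ℝ) :
    Summable fun n : ℕ => x ^ n / Real.Gamma (α * n + 1) := by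
  -- With K^α = 2|x| + 1 the lower bound for Γ gives a geometric majorant of ratio |x|/(2|x| + 1) <
  -- 1.
  set K : ℝ := (2 * |x| + 1) ^ (α⁻¹)
  have hK : 0 < K := by positivity
  have hKα : K ^ α = 2 * |x| + 1 := Real.rpow_inv_rpow (by positivity) hα.ne'
  have hg : Summable fun n : ℕ => Real.exp K * (|x| / (2 * |x| + 1)) ^ n := by
    refine (summable_geometric_of_lt_one (by positivity) ?_).mul_left _
    rw [div_lt_one (by positivity)]
    linarith [abs_nonneg x]
  refine Summable.of_norm_bounded hg fun n => ?_
  have h1 := rpow_mul_exp_neg_le_Gamma (s := α * n) (by positivity) hK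
  rw [Real.rpow_mul hK.le, hKα, Real.rpow_natCast] at h1
  have h2 : 0 < (2 * |x| + 1) ^ n * Real.exp (-K) := by positivity
  rw [norm_div, norm_pow, Real.norm_eq_abs, Real.norm_of_nonneg (h2.le.trans h1)]
  calc |x| ^ n / Real.Gamma (α * n + 1) ≤ |x| ^ n / ((2 * |x| + 1) ^ n * Real.exp (-K)) := by
        gcongr
    _ = _ := by rw [Real.exp_neg, div_pow]; field_simp

lemma continuous_mittagLeffler {α : ℝ} (hα : 0 < α) : Continuous (mittagLeffler α) := by
  rw [continuous_iff_continuousAt]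
  intro x
  have h : ContinuousOn (mittagLeffler α) (Metric.ball 0 (|x| + 1)) := by
    refine continuousOn_tsum (fun n => by fun_prop) (summable_mittagLeffler hα (|x| + 1)) ?_
    intro n y hy
    have hy : |y| ≤ |x| + 1 := by simpa using (Metric.mem_ball.1 hy).le
    have hG : 0 < Real.Gamma (α * n + 1) := Real.Gamma_pos_of_pos (by positivity)
    rw [norm_div, norm_pow, Real.norm_eq_abs, Real.norm_of_nonneg hG.le]
    gcongr
  exact h.continuousAt (Metric.isOpen_ball.mem_nhds (by simp))

/-- The function `t ↦ E_α(-λ t ^ α)` solves the Volterra equation `y = 1 - λ I^α y`. -/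
lemma mittagLeffler_volterra {α : ℝ} (hα : 0 < α) (l : ℝ) {t : ℝ} (ht : 0 < t) :
    ((mittagLeffler α (-(l * t ^ α)) : ℝ) : ℂ) =
      1 - l * rlInt α (fun s => ((mittagLeffler α (-(l * s ^ α)) : ℝ) : ℂ)) t := by
  have hpow : ∀ s : ℝ, 0 < s → ∀ n : ℕ, (-(l * s ^ α)) ^ n / Real.Gamma (α * n + 1)
      = (-l) ^ n * (s ^ (α * n) / Real.Gamma (α * n + 1)) := by
    intro s hs n
    rw [← neg_mul, mul_pow, ← Real.rpow_mul_natCast hs.le]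
    ring
  have hS : HasSum (fun n : ℕ => (((-l) ^ n : ℝ) : ℂ) * ((t ^ (α + α * n) /
      Real.Gamma (α + α * n + 1) : ℝ) : ℂ))
      (rlInt α (fun s => ((mittagLeffler α (-(l * s ^ α)) : ℝ) : ℂ)) t) := by
    have key : HasSum (fun n : ℕ => ∫ s in Ioo 0 t, (((t - s) ^ (α - 1) : ℝ) : ℂ) *
        ((((-l) ^ n : ℝ) : ℂ) * ((s ^ (α * n) / Real.Gamma (α * n + 1) : ℝ) : ℂ)))
        (∫ s in Ioo 0 t, (((t - s) ^ (α - 1) : ℝ) : ℂ) *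
          ((mittagLeffler α (-(l * s ^ α)) : ℝ) : ℂ)) := by
      have hsum := (summable_mittagLeffler hα (|l| * t ^ α))
      refine hasSum_integral_of_dominated_convergence
        (fun n s => (t - s) ^ (α - 1) * ((|l| * t ^ α) ^ n / Real.Gamma (α * n + 1)))
        ?_ ?_ ?_ ?_ ?_
      · intro n
        refine Measurable.aestronglyMeasurable ?_
        fun_prop
      · intro n
        refine ae_restrict_of_forall_mem measurableSet_Ioo fun s hs => ?_
        have hG : 0 < Real.Gamma (α * n + 1) := Real.Gamma_pos_of_pos (by positivity)
        have h1 : 0 ≤ (t - s) ^ (α - 1) := Real.rpow_nonneg (by linarith [hs.2]) _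
        have h2 : 0 ≤ s ^ α := Real.rpow_nonneg hs.1.le _
        rw [← Complex.ofReal_mul, ← Complex.ofReal_mul, Complex.norm_real, norm_mul,
          Real.norm_of_nonneg h1, ← hpow s hs.1, norm_div, norm_pow, norm_neg, norm_mul,
          Real.norm_of_nonneg hG.le, Real.norm_eq_abs, Real.norm_of_nonneg h2]
        have h3 : s ^ α ≤ t ^ α := Real.rpow_le_rpow hs.1.le hs.2.le hα.le
        gcongr
      · exact .of_forall fun s => hsum.mul_left _
      · refine Integrable.congr ?_ (.of_forall fun s => tsum_mul_left.symm)
        exact (integrableOn_kernel hα ht).mul_const _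
      · refine ae_restrict_of_forall_mem measurableSet_Ioo fun s hs => ?_
        refine HasSum.mul_left _ ?_
        refine (Complex.hasSum_ofReal.2 (summable_mittagLeffler hα (-(l * s ^ α))).hasSum).congr_fun
          fun n => ?_
        rw [hpow s hs.1, Complex.ofReal_mul]
    have k2 := key.mul_left (((Real.Gamma α : ℝ) : ℂ)⁻¹)
    refine k2.congr_fun ?_
    intro n
    have h1 := rlInt_rpow hα (b := α * n) (by have : 0 ≤ α * n := by positivity
                                              linarith) ht
    have h2 := rlInt_const_mul α (fun s => ((s ^ (α * n) / Real.Gamma (α * n + 1) : ℝ) : ℂ)) t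
      (((-l) ^ n : ℝ) : ℂ)
    rw [h1] at h2
    rw [← h2]
    rfl
  have hS2 := hS.mul_left (-(l : ℂ))
  have hE := Complex.hasSum_ofReal.2 (summable_mittagLeffler hα (-(l * t ^ α))).hasSum
  -- The term n = 0 is the constant 1 of the Volterra equation; term n + 1 is -l times the
  -- fractional integral of term n.
  rw [← hasSum_nat_add_iff' 1] at hE
  simp only [Finset.range_one, Finset.sum_singleton, pow_zero, Nat.cast_zero, mul_zero, zero_add,
    Real.Gamma_one, div_one, Complex.ofReal_one] at hE
  have := hE.unique (hS2.congr_fun fun n => ?_)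
  · rw [mittagLeffler, sub_eq_iff_eq_add.1 this]; ring
  · rw [hpow t ht]
    have : α * ((n + 1 : ℕ) : ℝ) = α + α * n := by push_cast; ring
    rw [this]
    push_cast
    ring

/-! ### Convergence of the series -/

/-- Inserting the integral for Γ turns partial sums into integrals of e^{-r} r^{c-1} times partial
sums of exp(y r^c). Since c ≤ 1/2, r^c is at most 1 or √r, and y√r ≤ y²/2 + r/2 leaves a factor
e^{-r/2}. This is where ν ≤ 1 enters, with c = ν/2. -/
lemma summable_pow_div_factorial_mul_Gamma {c : ℝ} (hc : 0 < c) (hc2 : c ≤ 1 / 2) {y : ℝ}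
    (hy : 0 ≤ y) :
    Summable fun m : ℕ => y ^ m / (m.factorial : ℝ) * Real.Gamma (((m : ℝ) + 1) * c) := by
  have hbi : IntegrableOn (fun r : ℝ => Real.exp (y + y ^ 2 / 2) *
      (r ^ (c - 1) * Real.exp (-(1 / 2) * r))) (Ioi 0) := by
    have := (integrableOn_rpow_mul_exp_neg_mul_rpow (p := 1) (s := c - 1) (b := 1 / 2)
      (by linarith) one_pos (by norm_num))
    simp only [Real.rpow_one] at this
    exact this.const_mul _
  refine summable_of_sum_le (c := ∫ r in Ioi (0 : ℝ), Real.exp (y + y ^ 2 / 2) *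
      (r ^ (c - 1) * Real.exp (-(1 / 2) * r))) ?_ ?_
  · intro m
    have := Real.Gamma_pos_of_pos (by positivity : 0 < ((m : ℝ) + 1) * c)
    simp only [Pi.zero_apply]
    positivity
  · intro S
    have hpos : ∀ m : ℕ, 0 < ((m : ℝ) + 1) * c := fun m => by positivity
    have hi : ∀ m ∈ S, IntegrableOn (fun r : ℝ => y ^ m / (m.factorial : ℝ) *
        (Real.exp (-r) * r ^ (((m : ℝ) + 1) * c - 1))) (Ioi 0) := fun m _ =>
      (Real.GammaIntegral_convergent (hpos m)).const_mul _
    have h1 : ∑ m ∈ S, y ^ m / (m.factorial : ℝ) * Real.Gamma (((m : ℝ) + 1) * c)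
        = ∫ r in Ioi (0 : ℝ), ∑ m ∈ S, y ^ m / (m.factorial : ℝ) *
        (Real.exp (-r) * r ^ (((m : ℝ) + 1) * c - 1)) := by
      rw [integral_finsetSum S hi]
      refine Finset.sum_congr rfl fun m _ => ?_
      rw [integral_const_mul, Real.Gamma_eq_integral (hpos m)]
    rw [h1]
    refine setIntegral_mono_on (integrable_finsetSum S hi) hbi measurableSet_Ioi fun r hr => ?_
    have hr : 0 < r := hr
    have hrc : 0 < r ^ c := Real.rpow_pos_of_pos hr c
    have h2 : ∑ m ∈ S, y ^ m / (m.factorial : ℝ) * (Real.exp (-r) * r ^ (((m : ℝ) + 1) * c - 1))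
        = Real.exp (-r) * r ^ (c - 1) * ∑ m ∈ S, (y * r ^ c) ^ m / (m.factorial : ℝ) := by
      rw [Finset.mul_sum]
      refine Finset.sum_congr rfl fun m _ => ?_
      rw [show ((m : ℝ) + 1) * c - 1 = (c - 1) + c * m by ring, Real.rpow_add hr,
        Real.rpow_mul_natCast hr.le, mul_pow]
      ring
    have h3 : ∑ m ∈ S, (y * r ^ c) ^ m / (m.factorial : ℝ) ≤ Real.exp (y * r ^ c) := by
      rw [Real.exp_eq_exp_ℝ, NormedSpace.exp_eq_tsum_div]
      exact (Real.summable_pow_div_factorial _).sum_le_tsum S fun m _ => by positivity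
    have h4 : y * r ^ c ≤ y + y ^ 2 / 2 + r / 2 := by
      rcases le_or_gt r 1 with h | h
      · have : r ^ c ≤ 1 := Real.rpow_le_one hr.le h hc.le
        nlinarith [sq_nonneg y]
      · have h5 : r ^ c ≤ √r := by
          rw [Real.sqrt_eq_rpow]; exact Real.rpow_le_rpow_of_exponent_le h.le hc2
        nlinarith [sq_nonneg (y - √r), Real.sq_sqrt hr.le, Real.sqrt_nonneg r]
    rw [h2]
    calc _ ≤ Real.exp (-r) * r ^ (c - 1) * Real.exp (y + y ^ 2 / 2 + r / 2) := by
          have := Real.rpow_pos_of_pos hr (c - 1)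
          gcongr
          exact h3.trans (Real.exp_le_exp.2 h4)
      _ = _ := by
          rw [Real.exp_add (y + y ^ 2 / 2), show -r = -(1 / 2) * r + -(r / 2) by ring, Real.exp_add,
            Real.exp_neg (r / 2)]
          field_simp

lemma inv_Gamma_one_sub {z : ℝ} (hz : 0 < z) :
    (Real.Gamma (1 - z))⁻¹ = Real.sin (Real.pi * z) * Real.Gamma z / Real.pi := by
  have h := Real.Gamma_mul_Gamma_one_sub z
  have hz' := (Real.Gamma_pos_of_pos hz).ne'
  by_cases hs : Real.sin (Real.pi * z) = 0
  -- At a pole the reflection formula reads Γ(z)Γ(1 - z) = π/0 = 0, and Γ(z) > 0 forces the value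
  -- Γ(1 - z) = 0; both sides are then 0.
  · rw [hs, div_zero] at h
    have : Real.Gamma (1 - z) = 0 := by simpa [hz'] using h
    rw [this, hs]; simp
  · have hp := Real.pi_ne_zero
    have : Real.Gamma (1 - z) = Real.pi / (Real.sin (Real.pi * z) * Real.Gamma z) := by
      field_simp at h ⊢
      linarith
    rw [this, inv_div]

lemma rodTermInvGamma_eq {ν : ℝ} (hν : 0 < ν) (x t : ℝ) (m : ℕ) :
    rodTermInvGamma ν x t m = Real.pi⁻¹ * rodTermSin ν x t m := by
  unfold rodTermInvGamma rodTermSin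
  rw [div_eq_mul_inv (Real.cos _), inv_Gamma_one_sub (by positivity)]
  rw [show Real.pi * (((m : ℝ) + 1) / 2 * ν) = ((m : ℝ) + 1) / 2 * Real.pi * ν by ring]
  field_simp

lemma summable_rodTermSin {ν : ℝ} (hν0 : 0 < ν) (hν1 : ν ≤ 1) (x t : ℝ) :
    Summable (rodTermSin ν x t) := by
  have h := summable_pow_div_factorial_mul_Gamma (c := ν / 2) (by positivity) (by linarith)
    (y := √2 * (|x| / √(t ^ ν))) (by positivity)
  refine Summable.of_norm_bounded h fun m => ?_
  have hG := Real.Gamma_pos_of_pos (by positivity : 0 < ((m : ℝ) + 1) / 2 * ν)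
  unfold rodTermSin
  rw [norm_mul, norm_mul, norm_mul, norm_mul, Real.norm_of_nonneg hG.le,
    show ((m : ℝ) + 1) / 2 * ν = ((m : ℝ) + 1) * (ν / 2) by ring] at *
  have h1 : ‖Real.cos (((m : ℝ) + 1) / 4 * Real.pi)‖ ≤ 1 := Real.abs_cos_le_one _
  have h2 : ‖Real.sin (((m : ℝ) + 1) / 2 * Real.pi * ν)‖ ≤ 1 := Real.abs_sin_le_one _
  have h3 : ‖1 / (m.factorial : ℝ)‖ * ‖(-√2 * (|x| / √(t ^ ν))) ^ m‖
      = (√2 * (|x| / √(t ^ ν))) ^ m / (m.factorial : ℝ) := by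
    rw [neg_mul, norm_pow, norm_neg, Real.norm_of_nonneg (by positivity),
      Real.norm_of_nonneg (by positivity)]
    ring
  rw [h3]
  have h4 : 0 ≤ (√2 * (|x| / √(t ^ ν))) ^ m / (m.factorial : ℝ) := by positivity
  refine mul_le_mul_of_nonneg_right ?_ hG.le
  calc _ ≤ (√2 * (|x| / √(t ^ ν))) ^ m / (m.factorial : ℝ) * 1 * 1 := by gcongr
    _ = _ := by ring

lemma summable_rodTermInvGamma {ν : ℝ} (hν0 : 0 < ν) (hν1 : ν ≤ 1) (x t : ℝ) :
    Summable (rodTermInvGamma ν x t) := by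
  simp only [funext (rodTermInvGamma_eq hν0 x t)]
  exact (summable_rodTermSin hν0 hν1 x t).mul_left _

lemma rodSolution_eq {ν : ℝ} (hν : 0 < ν) (x t : ℝ) :
    rodSolution ν x t = 1 / √(2 * t ^ ν) * ∑' m : ℕ, rodTermInvGamma ν x t m := by
  simp only [rodTermInvGamma_eq hν, tsum_mul_left, rodSolution]
  field_simp

/-! ### A Hankel-type integral for the reciprocal Gamma function -/

noncomputable section

/-- The ray that leaves the real point `R` in the direction `e ^ (iβ)`. -/
def ray (β R r : ℝ) : ℂ := R + r * Complex.exp (β * Complex.I)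

end

lemma ray_re (β R r : ℝ) : (ray β R r).re = R + r * Real.cos β := by
  simp [ray, Complex.exp_ofReal_mul_I_re]

lemma ray_im (β R r : ℝ) : (ray β R r).im = r * Real.sin β := by
  simp [ray, Complex.exp_ofReal_mul_I_im]

lemma ray_zero (β R : ℝ) : ray β R 0 = R := by simp [ray]

lemma continuous_ray (β R : ℝ) : Continuous (ray β R) := by unfold ray; fun_prop

lemma hasDerivAt_ray (β R r : ℝ) :
    HasDerivAt (ray β R) (Complex.exp (β * Complex.I)) r := by
  unfold ray
  simpa using ((Complex.ofRealCLM.hasDerivAt (x := r)).mul_const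
    (Complex.exp (β * Complex.I))).const_add (R : ℂ)

lemma norm_cexp_ray (β R r : ℝ) :
    ‖Complex.exp (ray β R r)‖ = Real.exp R * Real.exp (Real.cos β * r) := by
  rw [Complex.norm_exp, ray_re, Real.exp_add, mul_comm r]

lemma hasDerivAt_cpow_const_comp {f : ℝ → ℂ} {f' : ℂ} {x : ℝ} (hf : HasDerivAt f f' x)
    (hx : f x ∈ Complex.slitPlane) (w : ℂ) :
    HasDerivAt (fun x => f x ^ w) (w * f x ^ (w - 1) * f') x := by
  have h := ((hasDerivAt_id (f x)).cpow_const (c := w) hx).comp x hf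
  simp only [id_eq, mul_one] at h
  exact h

lemma norm_ray_le {β R r : ℝ} (hR : 0 ≤ R) (hr : 0 ≤ r) : ‖ray β R r‖ ≤ R + r := by
  unfold ray
  refine (norm_add_le _ _).trans ?_
  rw [norm_mul, Complex.norm_exp_ofReal_mul_I, Complex.norm_real, Complex.norm_real,
    Real.norm_of_nonneg hR, Real.norm_of_nonneg hr, mul_one]

section
variable {β : ℝ} (hβ : 0 < Real.sin β)
include hβ

lemma ray_mem_slitPlane {R r : ℝ} (hR : 0 < R) (hr : 0 ≤ r) : ray β R r ∈ Complex.slitPlane := by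
  rcases hr.eq_or_lt with rfl | hr
  · rw [ray_zero]; exact Complex.ofReal_mem_slitPlane.2 hR
  · refine Complex.mem_slitPlane_iff.2 (Or.inr ?_)
    rw [ray_im]
    positivity

/-- R sin β is the distance from the origin to the line carrying the ray; the defect of the squares
is (r + R cos β)². A large R thus pushes the whole ray away from 0. -/
lemma le_norm_ray {R r : ℝ} (hR : 0 ≤ R) : R * Real.sin β ≤ ‖ray β R r‖ := by
  refine (sq_le_sq₀ (by positivity) (norm_nonneg _)).1 ?_
  rw [← Complex.normSq_eq_norm_sq, Complex.normSq_apply, ray_re, ray_im]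
  have h1 := Real.sin_sq_add_cos_sq β
  have h2 : (R + r * Real.cos β) * (R + r * Real.cos β) + r * Real.sin β * (r * Real.sin β)
      - (R * Real.sin β) ^ 2 = (r + R * Real.cos β) ^ 2 := by
    linear_combination (r ^ 2 - R ^ 2) * h1
  nlinarith [sq_nonneg (r + R * Real.cos β)]

lemma continuousOn_ray_cpow {R : ℝ} (hR : 0 < R) (w : ℂ) :
    ContinuousOn (fun r => ray β R r ^ w) (Ici 0) := fun _ hr =>
  ((continuousAt_cpow_const (ray_mem_slitPlane hβ hR hr)).comp
    (continuous_ray β R).continuousAt).continuousWithinAt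

lemma hasDerivAt_ray_cpow {R r : ℝ} (hR : 0 < R) (hr : 0 ≤ r) (w : ℂ) :
    HasDerivAt (fun r => ray β R r ^ w)
      (w * ray β R r ^ (w - 1) * Complex.exp (β * Complex.I)) r :=
  hasDerivAt_cpow_const_comp (hasDerivAt_ray β R r) (ray_mem_slitPlane hβ hR hr) w
end

lemma rpow_add_le_mul_exp {w ε : ℝ} (hw : 0 < w) (hε : 0 < ε) {R r : ℝ} (hRr : 0 ≤ R + r) :
    (R + r) ^ w ≤ (w / ε) ^ w * Real.exp (ε * R) * Real.exp (ε * r) := by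
  have h1 : R + r ≤ w / ε * Real.exp (ε / w * (R + r)) := by
    have := Real.add_one_le_exp (ε / w * (R + r))
    calc R + r = w / ε * (ε / w * (R + r)) := by field_simp
      _ ≤ _ := by gcongr; linarith
  calc (R + r) ^ w ≤ (w / ε * Real.exp (ε / w * (R + r))) ^ w := by gcongr
    _ = _ := by
      rw [Real.mul_rpow (by positivity) (by positivity), ← Real.exp_mul,
        mul_assoc _ (Real.exp _), ← Real.exp_add]
      congr 2
      field_simp

/-- Powers grow at most exponentially, with an arbitrarily small rate, along the rays starting in
`[R₀, R₁]`. -/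
lemma exists_norm_ray_rpow_le {β : ℝ} (hβ : 0 < Real.sin β) {R₀ R₁ ε : ℝ} (hR₀ : 0 < R₀)
    (hε : 0 < ε) (w : ℝ) :
    ∃ C : ℝ, 0 < C ∧ ∀ R ∈ Icc R₀ R₁, ∀ r : ℝ, 0 ≤ r → ‖ray β R r‖ ^ w ≤ C * Real.exp (ε * r) := by
  rcases le_or_gt w 0 with hw | hw
  · refine ⟨(R₀ * Real.sin β) ^ w, by positivity, fun R hR r hr => ?_⟩
    have h1 : ‖ray β R r‖ ^ w ≤ (R₀ * Real.sin β) ^ w := by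
      refine Real.rpow_le_rpow_of_nonpos (by positivity) ?_ hw
      refine le_trans ?_ (le_norm_ray hβ (hR₀.le.trans hR.1))
      gcongr
      exact hR.1
    refine h1.trans (le_mul_of_one_le_right (by positivity) (Real.one_le_exp (by positivity)))
  · refine ⟨(w / ε) ^ w * Real.exp (ε * R₁), by positivity, fun R hR r hr => ?_⟩
    have hR' : 0 ≤ R := hR₀.le.trans hR.1
    calc ‖ray β R r‖ ^ w ≤ (R₁ + r) ^ w := by
          refine Real.rpow_le_rpow (norm_nonneg _) ?_ hw.le
          exact (norm_ray_le hR' hr).trans (by linarith [hR.2])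
      _ ≤ _ := rpow_add_le_mul_exp hw hε (by linarith [hR.2])

section
variable {β : ℝ} (hs : 0 < Real.sin β) (hc : Real.cos β < 0)
include hs hc

lemma exists_norm_cexp_ray_mul_cpow_le {R₀ R₁ : ℝ} (hR₀ : 0 < R₀) (w : ℝ) :
    ∃ C : ℝ, 0 < C ∧ ∀ R ∈ Icc R₀ R₁, ∀ r : ℝ, 0 ≤ r →
      ‖Complex.exp (ray β R r) * ray β R r ^ (w : ℂ)‖ ≤ C * Real.exp (Real.cos β / 2 * r) := by
  obtain ⟨C, hC0, hC⟩ := exists_norm_ray_rpow_le hs (R₁ := R₁) hR₀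
    (by linarith : 0 < -(Real.cos β / 2)) w
  refine ⟨Real.exp R₁ * C, by positivity, fun R hR r hr => ?_⟩
  rw [norm_mul, norm_cexp_ray, Complex.norm_cpow_real]
  calc _ ≤ Real.exp R₁ * Real.exp (Real.cos β * r) * (C * Real.exp (-(Real.cos β / 2) * r)) := by
        gcongr
        · exact hR.2
        · exact hC R hR r hr
    _ = _ := by
        rw [show Real.cos β / 2 * r = Real.cos β * r + -(Real.cos β / 2) * r by ring, Real.exp_add]
        ring

lemma integrableOn_cexp_ray_mul_cpow {R : ℝ} (hR : 0 < R) (w : ℝ) :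
    IntegrableOn (fun r => Complex.exp (ray β R r) * ray β R r ^ (w : ℂ)) (Ioi 0) := by
  obtain ⟨C, hC0, hC⟩ := exists_norm_cexp_ray_mul_cpow_le hs hc (R₁ := R) hR w
  refine Integrable.mono' ((integrableOn_exp_mul_Ioi (by linarith : Real.cos β / 2 < 0) 0).const_mul C)
    ?_ (ae_restrict_of_forall_mem measurableSet_Ioi fun r hr => ?_)
  · refine ContinuousOn.aestronglyMeasurable ?_ measurableSet_Ioi
    refine ContinuousOn.mul (Complex.continuous_exp.comp (continuous_ray β R)).continuousOn ?_
    exact (continuousOn_ray_cpow hs hR w).mono Ioi_subset_Ici_self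
  · exact hC R ⟨le_rfl, le_rfl⟩ r (le_of_lt hr)

/-- The integrand is the derivative of e^s s^w along the ray. What matters later is that the
boundary term at s = R is real, so it disappears from imaginary parts. -/
lemma integral_deriv_ray {R : ℝ} (hR : 0 < R) (w : ℝ) :
    ∫ r in Ioi 0, (Complex.exp (ray β R r) * ray β R r ^ (w : ℂ) +
      w * (Complex.exp (ray β R r) * ray β R r ^ ((w - 1 : ℝ) : ℂ))) * Complex.exp (β * Complex.I)
      = -((Real.exp R * R ^ w : ℝ) : ℂ) := by
  have hd : ∀ r : ℝ, 0 ≤ r → HasDerivAt (fun r => Complex.exp (ray β R r) * ray β R r ^ (w : ℂ))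
      ((Complex.exp (ray β R r) * ray β R r ^ (w : ℂ) +
      w * (Complex.exp (ray β R r) * ray β R r ^ ((w - 1 : ℝ) : ℂ))) *
        Complex.exp (β * Complex.I)) r := by
    intro r hr
    refine ((hasDerivAt_ray β R r).cexp.mul (hasDerivAt_ray_cpow hs hR hr w)).congr_deriv ?_
    push_cast
    ring
  have h := integral_Ioi_of_hasDerivAt_of_tendsto (a := 0) (m := 0)
    (hd 0 le_rfl).continuousAt.continuousWithinAt (fun r hr => hd r (le_of_lt hr)) ?_ ?_
  · rw [h, ray_zero, zero_sub, ← Complex.ofReal_cpow hR.le, ← Complex.ofReal_exp,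
      ← Complex.ofReal_mul]
  · exact ((integrableOn_cexp_ray_mul_cpow hs hc hR w).add
      ((integrableOn_cexp_ray_mul_cpow hs hc hR (w - 1)).const_mul _)).mul_const _
  · obtain ⟨C, hC0, hC⟩ := exists_norm_cexp_ray_mul_cpow_le hs hc (R₁ := R) hR w
    refine squeeze_zero_norm' (a := fun r => C * Real.exp (Real.cos β / 2 * r)) ?_ ?_
    · filter_upwards [eventually_ge_atTop 0] with r hr using hC R ⟨le_rfl, le_rfl⟩ r hr
    · have : Tendsto (fun r : ℝ => Real.cos β / 2 * r) atTop atBot :=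
        tendsto_id.const_mul_atTop_of_neg (by linarith)
      simpa using (Real.tendsto_exp_atBot.comp this).const_mul C

end

noncomputable section

/-- The imaginary part of the integral of `e ^ s * s ^ w` along a ray. -/
def hankelIm (β R w : ℝ) : ℝ :=
  (∫ r in Ioi 0, Complex.exp (ray β R r) * ray β R r ^ (w : ℂ) * Complex.exp (β * Complex.I)).im

end

section
variable {β : ℝ} (hs : 0 < Real.sin β) (hc : Real.cos β < 0)
include hs hc

lemma hankelIm_recurrence {R : ℝ} (hR : 0 < R) (w : ℝ) :
    hankelIm β R w + w * hankelIm β R (w - 1) = 0 := by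
  have h := congrArg Complex.im (integral_deriv_ray hs hc hR w)
  simp only [add_mul] at h
  rw [integral_add ((integrableOn_cexp_ray_mul_cpow hs hc hR w).mul_const _)] at h
  · simp only [mul_assoc (w : ℂ)] at h
    rw [integral_const_mul, Complex.add_im, Complex.im_ofReal_mul] at h
    rw [hankelIm, hankelIm, h, Complex.neg_im, Complex.ofReal_im, neg_zero]
  · exact ((integrableOn_cexp_ray_mul_cpow hs hc hR (w - 1)).const_mul _).mul_const _

/-- Changing R translates the ray, so differentiation under the integral produces the integral of
(e^s s^w)', whose value is real. -/
lemma hasDerivAt_hankelIm {R : ℝ} (hR : 0 < R) (w : ℝ) :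
    HasDerivAt (fun R => hankelIm β R w) 0 R := by
  obtain ⟨C₁, hC₁0, hC₁⟩ := exists_norm_cexp_ray_mul_cpow_le hs hc (R₀ := R / 2) (R₁ := 2 * R)
    (by positivity) w
  obtain ⟨C₂, hC₂0, hC₂⟩ := exists_norm_cexp_ray_mul_cpow_le hs hc (R₀ := R / 2) (R₁ := 2 * R)
    (by positivity) (w - 1)
  have hint : ∀ R : ℝ, 0 < R → ∀ w : ℝ, IntegrableOn (fun r => Complex.exp (ray β R r) *
      ray β R r ^ (w : ℂ) * Complex.exp (β * Complex.I)) (Ioi 0) := fun R hR w =>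
    (integrableOn_cexp_ray_mul_cpow hs hc hR w).mul_const _
  have hint2 : ∀ R : ℝ, 0 < R → IntegrableOn (fun r => (Complex.exp (ray β R r) * ray β R r ^ (w : ℂ)
      + w * (Complex.exp (ray β R r) * ray β R r ^ ((w - 1 : ℝ) : ℂ))) *
        Complex.exp (β * Complex.I)) (Ioi 0) := fun R hR =>
    ((integrableOn_cexp_ray_mul_cpow hs hc hR w).add
      ((integrableOn_cexp_ray_mul_cpow hs hc hR (w - 1)).const_mul _)).mul_const _
  have key := hasDerivAt_integral_of_dominated_loc_of_deriv_le (𝕜 := ℝ)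
    (μ := volume.restrict (Ioi 0)) (x₀ := R) (s := Ioo (R / 2) (2 * R))
    (F := fun R r => Complex.exp (ray β R r) * ray β R r ^ (w : ℂ) * Complex.exp (β * Complex.I))
    (F' := fun R r => (Complex.exp (ray β R r) * ray β R r ^ (w : ℂ) +
      w * (Complex.exp (ray β R r) * ray β R r ^ ((w - 1 : ℝ) : ℂ))) * Complex.exp (β * Complex.I))
    (bound := fun r => (C₁ + |w| * C₂) * Real.exp (Real.cos β / 2 * r))
    (Ioo_mem_nhds (by linarith) (by linarith)) ?_ (hint R hR w)
    (hint2 R hR).aestronglyMeasurable ?_ ?_ ?_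
  · have h2 := key.2
    rw [integral_deriv_ray hs hc hR w] at h2
    have h3 := Complex.imCLM.hasFDerivAt.comp_hasDerivAt R h2
    rw [← Complex.ofReal_neg] at h3
    exact h3
  · filter_upwards [Ioi_mem_nhds hR] with x hx using (hint x hx w).aestronglyMeasurable
  · refine ae_restrict_of_forall_mem measurableSet_Ioi fun r hr x hx => ?_
    have hx' : x ∈ Icc (R / 2) (2 * R) := ⟨hx.1.le, hx.2.le⟩
    rw [norm_mul, Complex.norm_exp_ofReal_mul_I, mul_one]
    refine (norm_add_le _ _).trans ?_
    rw [norm_mul (w : ℂ), Complex.norm_real, Real.norm_eq_abs]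
    have a1 := hC₁ x hx' r (le_of_lt hr)
    have a2 := mul_le_mul_of_nonneg_left (hC₂ x hx' r (le_of_lt hr)) (abs_nonneg w)
    linarith
  · exact (integrableOn_exp_mul_Ioi (by linarith) 0).const_mul _
  · refine ae_restrict_of_forall_mem measurableSet_Ioi fun r hr x hx => ?_
    have hx0 : 0 < x := by linarith [hx.1]
    have h1 : HasDerivAt (fun R : ℝ => ray β R r) 1 x := by
      unfold ray
      exact (Complex.ofRealCLM.hasDerivAt (x := x)).add_const _
    have h3 := hasDerivAt_cpow_const_comp h1 (ray_mem_slitPlane hs hx0 (le_of_lt hr)) w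
    have h2 := (h1.cexp.mul h3).mul_const (Complex.exp (β * Complex.I))
    refine h2.congr_deriv ?_
    push_cast
    ring

lemma hankelIm_eq_of_pos {R R' : ℝ} (hR : 0 < R) (hR' : 0 < R') (w : ℝ) :
    hankelIm β R w = hankelIm β R' w := by
  refine isOpen_Ioi.is_const_of_deriv_eq_zero isPreconnected_Ioi (s := Ioi 0)
    (f := fun R => hankelIm β R w) ?_ ?_ hR hR'
  · exact fun x hx => (hasDerivAt_hankelIm hs hc hx w).differentiableAt.differentiableWithinAt
  · exact fun x hx => (hasDerivAt_hankelIm hs hc hx w).deriv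

end

/-! The Gamma integral with a complex rate. -/

lemma integrableOn_rpow_mul_cexp {w : ℝ} (hw : -1 < w) {c : ℂ} (hc : 0 < c.re) :
    IntegrableOn (fun r : ℝ => ((r ^ w : ℝ) : ℂ) * Complex.exp (-(c * r))) (Ioi 0) := by
  have h := integrableOn_rpow_mul_exp_neg_mul_rpow hw one_pos hc
  refine Integrable.mono' h (Measurable.aestronglyMeasurable (by fun_prop))
    (ae_restrict_of_forall_mem measurableSet_Ioi fun r hr => ?_)
  rw [norm_mul, Complex.norm_real, Real.norm_of_nonneg (Real.rpow_nonneg (le_of_lt hr) _),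
    Complex.norm_exp]
  simp

/-- Integration by parts; combined with the derivative in c it makes c^{w+1} times the integral
locally constant. -/
lemma mul_integral_rpow_mul_cexp {w : ℝ} (hw : -1 < w) {c : ℂ} (hc : 0 < c.re) :
    c * ∫ r in Ioi (0 : ℝ), ((r ^ (w + 1) : ℝ) : ℂ) * Complex.exp (-(c * r)) =
      (w + 1) * ∫ r in Ioi (0 : ℝ), ((r ^ w : ℝ) : ℂ) * Complex.exp (-(c * r)) := by
  have h0 := (integrableOn_rpow_mul_cexp hw hc).const_mul ((w : ℂ) + 1)
  have h1 := (integrableOn_rpow_mul_cexp (w := w + 1) (by linarith) hc).const_mul c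
  have h := integral_Ioi_of_hasDerivAt_of_tendsto (a := 0) (m := 0)
    (f := fun r : ℝ => ((r ^ (w + 1) : ℝ) : ℂ) * Complex.exp (-(c * r)))
    (f' := fun r : ℝ => (w + 1) * (((r ^ w : ℝ) : ℂ) * Complex.exp (-(c * r))) -
      c * (((r ^ (w + 1) : ℝ) : ℂ) * Complex.exp (-(c * r)))) ?_ ?_ (h0.sub h1) ?_
  · rw [integral_sub h0 h1, integral_const_mul, integral_const_mul,
      Real.zero_rpow (by linarith)] at h
    simp only [Complex.ofReal_zero, zero_mul, sub_zero] at h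
    exact (sub_eq_zero.1 h).symm
  · refine Continuous.continuousWithinAt ?_
    have : Continuous fun r : ℝ => r ^ (w + 1) := Real.continuous_rpow_const (by linarith)
    fun_prop
  · intro r hr
    have h2 : HasDerivAt (fun r : ℝ => ((r ^ (w + 1) : ℝ) : ℂ)) (((w + 1) * r ^ w : ℝ) : ℂ) r := by
      have := (Real.hasDerivAt_rpow_const (p := w + 1) (Or.inl (ne_of_gt hr))).ofReal_comp
      simpa using this
    have h3 : HasDerivAt (fun r : ℝ => -(c * r)) (-c) r := by
      simpa using ((Complex.ofRealCLM.hasDerivAt (x := r)).const_mul c).fun_neg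
    refine (h2.mul h3.cexp).congr_deriv ?_
    push_cast
    ring
  · have := tendsto_rpow_mul_exp_neg_mul_atTop_nhds_zero (w + 1) c.re hc
    refine squeeze_zero_norm' (a := fun r => r ^ (w + 1) * Real.exp (-c.re * r)) ?_ this
    filter_upwards [eventually_ge_atTop 0] with r hr
    rw [norm_mul, Complex.norm_real, Real.norm_of_nonneg (Real.rpow_nonneg hr _), Complex.norm_exp]
    simp

lemma hasDerivAt_integral_rpow_mul_cexp {w : ℝ} (hw : -1 < w) {c : ℂ} (hc : 0 < c.re) :
    HasDerivAt (fun c : ℂ => ∫ r in Ioi (0 : ℝ), ((r ^ w : ℝ) : ℂ) * Complex.exp (-(c * r)))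
      (-∫ r in Ioi (0 : ℝ), ((r ^ (w + 1) : ℝ) : ℂ) * Complex.exp (-(c * r))) c := by
  have hopen : IsOpen {z : ℂ | c.re / 2 < z.re} := isOpen_lt continuous_const Complex.continuous_re
  have key := hasDerivAt_integral_of_dominated_loc_of_deriv_le (𝕜 := ℂ)
    (μ := volume.restrict (Ioi (0 : ℝ))) (x₀ := c) (s := {z : ℂ | c.re / 2 < z.re})
    (F := fun c r => ((r ^ w : ℝ) : ℂ) * Complex.exp (-(c * r)))
    (F' := fun c r => -(((r ^ (w + 1) : ℝ) : ℂ) * Complex.exp (-(c * r))))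
    (bound := fun r => r ^ (w + 1) * Real.exp (-(c.re / 2) * r))
    (hopen.mem_nhds (by simp only [mem_ofPred_eq]; linarith)) ?_ (integrableOn_rpow_mul_cexp hw hc)
    (integrableOn_rpow_mul_cexp (by linarith) hc).neg.aestronglyMeasurable ?_ ?_ ?_
  · simpa only [integral_neg] using key.2
  · refine .of_forall fun z => Measurable.aestronglyMeasurable (by fun_prop)
  · refine ae_restrict_of_forall_mem measurableSet_Ioi fun r hr z hz => ?_
    have hr : 0 < r := hr
    have hz : c.re / 2 < z.re := hz
    rw [norm_neg, norm_mul, Complex.norm_real, Real.norm_of_nonneg (Real.rpow_nonneg hr.le _),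
      Complex.norm_exp]
    have : (-(z * r)).re ≤ -(c.re / 2) * r := by
      simp only [Complex.neg_re, Complex.re_mul_ofReal]; nlinarith
    gcongr
  · have := integrableOn_rpow_mul_exp_neg_mul_rpow (s := w + 1) (by linarith) one_pos
      (by linarith : 0 < c.re / 2)
    simp only [Real.rpow_one] at this
    exact this
  · refine ae_restrict_of_forall_mem measurableSet_Ioi fun r hr z hz => ?_
    have h3 : HasDerivAt (fun z : ℂ => -(z * (r : ℂ))) (-(r : ℂ)) z := by
      simpa using ((hasDerivAt_id z).mul_const (r : ℂ)).fun_neg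
    refine (h3.cexp.const_mul ((r ^ w : ℝ) : ℂ)).congr_deriv ?_
    rw [Real.rpow_add_one (ne_of_gt hr)]
    push_cast
    ring

/-- The left side has zero derivative on the right half-plane, and at c = 1 it is Euler's integral.
-/
lemma integral_rpow_mul_cexp {w : ℝ} (hw : -1 < w) {c : ℂ} (hc : 0 < c.re) :
    c ^ ((w + 1 : ℝ) : ℂ) * ∫ r in Ioi (0 : ℝ), ((r ^ w : ℝ) : ℂ) * Complex.exp (-(c * r)) =
      Real.Gamma (w + 1) := by
  have hopen : IsOpen {z : ℂ | 0 < z.re} := isOpen_lt continuous_const Complex.continuous_re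
  have hconn : IsPreconnected {z : ℂ | 0 < z.re} := (convex_halfSpace_re_gt 0).isPreconnected
  have hd : ∀ z : ℂ, 0 < z.re → HasDerivAt (fun c : ℂ => c ^ ((w + 1 : ℝ) : ℂ) *
      ∫ r in Ioi (0 : ℝ), ((r ^ w : ℝ) : ℂ) * Complex.exp (-(c * r))) 0 z := by
    intro z hz
    have hz0 : z ≠ 0 := fun h => by simp [h] at hz
    have h1 := (hasDerivAt_id z).cpow_const (c := ((w + 1 : ℝ) : ℂ))
      (Complex.mem_slitPlane_iff.2 (Or.inl hz))
    refine (h1.mul (hasDerivAt_integral_rpow_mul_cexp hw hz)).congr_deriv ?_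
    have h2 := mul_integral_rpow_mul_cexp hw hz
    simp only [id_eq]
    rw [Complex.cpow_sub _ _ hz0, Complex.cpow_one]
    field_simp
    push_cast at h2 ⊢
    linear_combination -z ^ ((w : ℂ) + 1) * h2
  have h := hopen.is_const_of_deriv_eq_zero hconn
    (fun z hz => (hd z hz).differentiableAt.differentiableWithinAt)
    (fun z hz => (hd z hz).deriv) (x := c) (y := 1) hc (by simp)
  rw [h, Complex.one_cpow, one_mul, Real.Gamma_eq_integral (by linarith), ← integral_complex_ofReal]
  refine integral_congr_ae (.of_forall fun r => ?_)
  simp only [add_sub_cancel_right, one_mul]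
  push_cast
  ring

lemma ray_zero_left (β r : ℝ) : ray β 0 r = r * Complex.exp (β * Complex.I) := by simp [ray]

lemma ofReal_mul_cpow {r : ℝ} (hr : 0 < r) {z : ℂ} (hz : z ≠ 0) (w : ℂ) :
    ((r : ℂ) * z) ^ w = (r : ℂ) ^ w * z ^ w := by
  have hr' : (r : ℂ) ≠ 0 := by exact_mod_cast hr.ne'
  rw [Complex.cpow_def_of_ne_zero (mul_ne_zero hr' hz), Complex.cpow_def_of_ne_zero hr',
    Complex.cpow_def_of_ne_zero hz, Complex.log_ofReal_mul hr hz, Complex.ofReal_log hr.le, add_mul,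
    Complex.exp_add]

/-- From the origin, the ray integral is a Gamma integral with rate c = -e^{iβ} = e^{i(β-π)}, of
positive real part. The phases combine to e^{iπ(w+1)}, so the imaginary part is sin(π(w+1)) Γ(w+1),
and the reflection formula applies. -/
lemma hankelIm_zero {β : ℝ} (hβ1 : Real.pi / 2 < β) (hβ2 : β < Real.pi) {w : ℝ} (hw : -1 < w) :
    hankelIm β 0 w = Real.pi * (Real.Gamma (-w))⁻¹ := by
  have hc : Real.cos β < 0 := Real.cos_neg_of_pi_div_two_lt_of_lt hβ1 (by linarith [Real.pi_pos])
  set e := Complex.exp (β * Complex.I) with he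
  have hre : 0 < (-e).re := by
    rw [he, Complex.neg_re, Complex.exp_ofReal_mul_I_re]; linarith
  have h1 := integral_rpow_mul_cexp hw hre
  have hne : -e = Complex.exp (((β - Real.pi : ℝ) : ℂ) * Complex.I) := by
    push_cast
    rw [sub_mul, Complex.exp_sub, Complex.exp_pi_mul_I, div_neg, div_one]
  have hlog1 : Complex.log e = β * Complex.I := by
    rw [he, Complex.log_exp] <;> simp <;> linarith [Real.pi_pos]
  have hlog2 : Complex.log (-e) = ((β - Real.pi : ℝ) : ℂ) * Complex.I := by
    rw [hne, Complex.log_exp] <;> simp <;> linarith [Real.pi_pos]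
  have hpow : (-e) ^ ((w + 1 : ℝ) : ℂ)
      = Complex.exp (((β - Real.pi : ℝ) : ℂ) * Complex.I * ((w + 1 : ℝ) : ℂ)) := by
    rw [Complex.cpow_def_of_ne_zero (by rw [hne]; exact Complex.exp_ne_zero _), hlog2]
  have h2 : ∫ r in Ioi 0, Complex.exp (ray β 0 r) * ray β 0 r ^ (w : ℂ) * e
      = e ^ (w : ℂ) * e * ∫ r in Ioi (0 : ℝ), ((r ^ w : ℝ) : ℂ) * Complex.exp (-(-e * r)) := by
    rw [← integral_const_mul]
    refine setIntegral_congr_fun measurableSet_Ioi fun r hr => ?_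
    have hr : 0 < r := hr
    rw [ray_zero_left, ofReal_mul_cpow hr (Complex.exp_ne_zero _), ← Complex.ofReal_cpow hr.le,
      neg_mul, neg_neg, mul_comm (r : ℂ) e]
    ring
  have h3 : ∫ r in Ioi (0 : ℝ), ((r ^ w : ℝ) : ℂ) * Complex.exp (-(-e * r))
      = Complex.exp (-(((β - Real.pi : ℝ) : ℂ) * Complex.I * ((w + 1 : ℝ) : ℂ))) *
        Real.Gamma (w + 1) := by
    rw [← h1, hpow, Complex.exp_neg, inv_mul_cancel_left₀ (Complex.exp_ne_zero _)]
  have h4 : e ^ (w : ℂ) * e = Complex.exp (β * Complex.I * ((w + 1 : ℝ) : ℂ)) := by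
    rw [Complex.cpow_def_of_ne_zero (Complex.exp_ne_zero _), hlog1]
    rw [he, ← Complex.exp_add]
    congr 1
    push_cast
    ring
  rw [hankelIm, h2, h3, h4, ← mul_assoc, ← Complex.exp_add]
  rw [show (β : ℂ) * Complex.I * ((w + 1 : ℝ) : ℂ) +
    -(((β - Real.pi : ℝ) : ℂ) * Complex.I * ((w + 1 : ℝ) : ℂ)) =
      ((Real.pi * (w + 1) : ℝ) : ℂ) * Complex.I by push_cast; ring, Complex.im_mul_ofReal,
    Complex.exp_ofReal_mul_I_im]
  have h5 := inv_Gamma_one_sub (z := w + 1) (by linarith)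
  rw [show 1 - (w + 1) = -w by ring] at h5
  rw [h5]
  field_simp

lemma tendsto_hankelIm {β : ℝ} (hs : 0 < Real.sin β) (hc : Real.cos β < 0) {w : ℝ} (hw : -1 < w) :
    Tendsto (fun R => hankelIm β R w) (𝓝[>] 0) (𝓝 (hankelIm β 0 w)) := by
  have hbound : ∃ b : ℝ → ℝ, IntegrableOn b (Ioi 0) ∧ ∀ R ∈ Ioo (0 : ℝ) 1, ∀ r ∈ Ioi (0 : ℝ),
      ‖Complex.exp (ray β R r) * ray β R r ^ (w : ℂ) * Complex.exp (β * Complex.I)‖ ≤ b r := by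
    have hnorm : ∀ R ∈ Ioo (0 : ℝ) 1, ∀ r ∈ Ioi (0 : ℝ),
        ‖Complex.exp (ray β R r) * ray β R r ^ (w : ℂ) * Complex.exp (β * Complex.I)‖ ≤
          Real.exp 1 * (Real.exp (Real.cos β * r) * ‖ray β R r‖ ^ w) := by
      intro R hR r hr
      rw [norm_mul, norm_mul, Complex.norm_exp_ofReal_mul_I, mul_one, norm_cexp_ray,
        Complex.norm_cpow_real, mul_assoc]
      have := hR.2.le
      gcongr
    rcases le_or_gt 0 w with h | h
    · set ε := -(Real.cos β / 2) with hε
      have hε0 : 0 < ε := by linarith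
      -- The exponent w is raised to w + 1, harmless as 1 + r ≥ 1, because `rpow_add_le_mul_exp`
      -- needs a strictly positive exponent.
      refine ⟨fun r => Real.exp 1 * (((w + 1) / ε) ^ (w + 1) * Real.exp (ε * 1) *
        Real.exp (Real.cos β / 2 * r)), ?_, fun R hR r hr => (hnorm R hR r hr).trans ?_⟩
      · exact ((integrableOn_exp_mul_Ioi (by linarith) 0).const_mul _).const_mul _
      · have hr : 0 < r := hr
        have h1 : ‖ray β R r‖ ^ w ≤ (1 + r) ^ (w + 1) := by
          calc ‖ray β R r‖ ^ w ≤ (1 + r) ^ w :=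
                Real.rpow_le_rpow (norm_nonneg _)
                  ((norm_ray_le hR.1.le hr.le).trans (by linarith [hR.2])) h
            _ ≤ _ := Real.rpow_le_rpow_of_exponent_le (by linarith) (by linarith)
        have h2 := h1.trans (rpow_add_le_mul_exp (w := w + 1) (by linarith) hε0
          (by linarith : 0 ≤ 1 + r))
        have h3 : Real.exp (Real.cos β / 2 * r) = Real.exp (Real.cos β * r) * Real.exp (ε * r) := by
          rw [← Real.exp_add]; congr 1; rw [hε]; ring
        simp only [h3]
        calc _ ≤ Real.exp 1 * (Real.exp (Real.cos β * r) * (((w + 1) / ε) ^ (w + 1) *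
              Real.exp (ε * 1) * Real.exp (ε * r))) := by gcongr
          _ = _ := by ring
    · refine ⟨fun r => Real.exp 1 * (Real.sin β ^ w * (r ^ w * Real.exp (Real.cos β * r))), ?_,
        fun R hR r hr => (hnorm R hR r hr).trans ?_⟩
      · have := integrableOn_rpow_mul_exp_neg_mul_rpow hw one_pos (by linarith : 0 < -Real.cos β)
        simp only [Real.rpow_one, neg_neg] at this
        exact (this.const_mul _).const_mul _
      · have hr : 0 < r := hr
        have h1 : ‖ray β R r‖ ^ w ≤ (Real.sin β * r) ^ w := by
          refine Real.rpow_le_rpow_of_nonpos (by positivity) ?_ h.le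
          refine le_trans (le_of_eq ?_) (Complex.abs_im_le_norm _)
          rw [ray_im, abs_of_nonneg (by positivity), mul_comm]
        rw [Real.mul_rpow hs.le hr.le] at h1
        calc _ ≤ Real.exp 1 * (Real.exp (Real.cos β * r) * (Real.sin β ^ w * r ^ w)) := by gcongr
          _ = _ := by ring
  obtain ⟨b, hb, hle⟩ := hbound
  have hev : ∀ᶠ R : ℝ in 𝓝[>] 0, R ∈ Ioo (0 : ℝ) 1 := Ioo_mem_nhdsGT one_pos
  refine (Complex.continuous_im.tendsto _).comp ?_
  refine tendsto_integral_filter_of_dominated_convergence b ?_ ?_ hb ?_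
  · filter_upwards [hev] with R hR
    exact ((integrableOn_cexp_ray_mul_cpow hs hc hR.1 w).mul_const _).aestronglyMeasurable
  · filter_upwards [hev] with R hR
    exact ae_restrict_of_forall_mem measurableSet_Ioi fun r hr => hle R hR r hr
  · refine ae_restrict_of_forall_mem measurableSet_Ioi fun r hr => ?_
    have hr : 0 < r := hr
    refine Tendsto.mono_left ?_ nhdsWithin_le_nhds
    have h1 : ContinuousAt (fun R : ℝ => ray β R r) 0 := by
      unfold ray; fun_prop
    have h2 : ray β 0 r ∈ Complex.slitPlane := by
      refine Complex.mem_slitPlane_iff.2 (Or.inr ?_)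
      rw [ray_im]; positivity
    have h3 : ContinuousAt (fun R : ℝ => ray β R r ^ (w : ℂ)) 0 :=
      ContinuousAt.comp (f := fun R : ℝ => ray β R r) (continuousAt_cpow_const h2) h1
    exact ((Complex.continuous_exp.continuousAt.comp h1).mul h3).mul continuousAt_const

/-- For w between -2 and 0 the power |s|^w is at most |s|^0 + |s|^{-2}, whatever the size of |s|;
this dominates. -/
lemma continuousAt_hankelIm {β : ℝ} (hs : 0 < Real.sin β) (hc : Real.cos β < 0) {R : ℝ}
    (hR : 0 < R) : ContinuousAt (fun w => hankelIm β R w) (-1) := by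
  refine Complex.continuous_im.continuousAt.comp ?_
  have hi : ∀ w : ℝ, IntegrableOn (fun r => Complex.exp (ray β R r) * ray β R r ^ (w : ℂ)) (Ioi 0) :=
    integrableOn_cexp_ray_mul_cpow hs hc hR
  refine continuousAt_of_dominated (bound := fun r =>
    ‖Complex.exp (ray β R r) * ray β R r ^ ((0 : ℝ) : ℂ)‖ +
      ‖Complex.exp (ray β R r) * ray β R r ^ ((-2 : ℝ) : ℂ)‖) ?_ ?_ ?_ ?_
  · exact .of_forall fun w => ((hi w).mul_const _).aestronglyMeasurable
  · filter_upwards [Ioo_mem_nhds (by norm_num : (-2 : ℝ) < -1) (by norm_num : (-1 : ℝ) < 0)] with w hw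
    refine .of_forall fun r => ?_
    rw [norm_mul, norm_mul, norm_mul, norm_mul, Complex.norm_exp_ofReal_mul_I, mul_one,
      Complex.norm_cpow_real, Complex.norm_cpow_real, Complex.norm_cpow_real, ← mul_add]
    refine mul_le_mul_of_nonneg_left ?_ (norm_nonneg _)
    rcases (norm_nonneg (ray β R r)).eq_or_lt with h0 | h0
    · rw [← h0, Real.zero_rpow hw.2.ne]
      positivity
    rcases le_or_gt 1 ‖ray β R r‖ with h | h
    · exact (Real.rpow_le_rpow_of_exponent_le h hw.2.le).trans
        (le_add_of_nonneg_right (by positivity))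
    · exact (Real.rpow_le_rpow_of_exponent_ge h0 h.le hw.1.le).trans
        (le_add_of_nonneg_left (by positivity))
  · exact (hi 0).norm.add (hi (-2)).norm
  · refine ae_restrict_of_forall_mem measurableSet_Ioi fun r hr => ?_
    have h0 : ray β R r ≠ 0 := Complex.slitPlane_ne_zero (ray_mem_slitPlane hs hR (le_of_lt hr))
    have : Continuous fun w : ℝ => ray β R r ^ (w : ℂ) :=
      (Complex.continuous_ofReal).const_cpow (Or.inl h0)
    exact ((continuous_const.mul this).mul continuous_const).continuousAt

/-- **Hankel's formula**, along a ray starting at a positive real number. -/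
theorem hankelIm_eq {β : ℝ} (hβ1 : Real.pi / 2 < β) (hβ2 : β < Real.pi) {R : ℝ} (hR : 0 < R)
    (w : ℝ) : hankelIm β R w = Real.pi * (Real.Gamma (-w))⁻¹ := by
  have hs : 0 < Real.sin β := Real.sin_pos_of_pos_of_lt_pi (by linarith [Real.pi_pos]) hβ2
  have hc : Real.cos β < 0 := Real.cos_neg_of_pi_div_two_lt_of_lt hβ1 (by linarith [Real.pi_pos])
  have h1 : ∀ w : ℝ, -1 < w → hankelIm β R w = Real.pi * (Real.Gamma (-w))⁻¹ := by
    intro w hw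
    rw [← hankelIm_zero hβ1 hβ2 hw]
    refine tendsto_nhds_unique ?_ (tendsto_hankelIm hs hc hw)
    refine (tendsto_congr' ?_).2 tendsto_const_nhds
    filter_upwards [self_mem_nhdsWithin] with x hx using hankelIm_eq_of_pos hs hc hx hR w
  -- The recurrence used below to descend from w + 1 to w has the factor w + 1, which vanishes at w
  -- = -1; that value is reached by continuity from the right instead.
  have h2 : hankelIm β R (-1) = Real.pi * (Real.Gamma (-(-1)))⁻¹ := by
    have hcont : ContinuousAt (fun w : ℝ => Real.pi * (Real.Gamma (-w))⁻¹) (-1) := by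
      have hG : ContinuousAt Real.Gamma 1 := by
        refine (Real.differentiableAt_Gamma fun m => ?_).continuousAt
        have : (0 : ℝ) ≤ m := m.cast_nonneg
        linarith
      refine continuousAt_const.mul (ContinuousAt.inv₀ ?_ (by simp))
      exact ContinuousAt.comp (f := fun w : ℝ => -w) (by rw [neg_neg]; exact hG) continuousAt_neg
    refine tendsto_nhds_unique (f := fun w => hankelIm β R w) (l := 𝓝[>] (-1))
      ((continuousAt_hankelIm hs hc hR).tendsto.mono_left nhdsWithin_le_nhds) ?_
    refine (tendsto_congr' ?_).2 (hcont.tendsto.mono_left nhdsWithin_le_nhds)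
    filter_upwards [self_mem_nhdsWithin] with x hx using h1 x hx
  have h3 : ∀ n : ℕ, ∀ w : ℝ, -(n : ℝ) - 1 ≤ w → hankelIm β R w = Real.pi * (Real.Gamma (-w))⁻¹ := by
    intro n
    induction n with
    | zero =>
      intro w hw
      rcases hw.eq_or_lt with h | h
      · have : w = -1 := by simp at h; linarith
        rw [this, h2]
      · exact h1 w (by simpa using h)
    | succ n ih =>
      intro w hw
      rcases le_or_gt (-1) w with h | h
      · exact ih w (by have : (0 : ℝ) ≤ n := n.cast_nonneg
                       linarith)
      have hr := hankelIm_recurrence hs hc hR (w + 1)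
      rw [add_sub_cancel_right, ih (w + 1) (by push_cast at hw; linarith)] at hr
      have hG := Real.Gamma_add_one (s := -(w + 1)) (by linarith)
      rw [show -(w + 1) + 1 = -w by ring] at hG
      have hw1 : w + 1 ≠ 0 := by linarith
      have hG0 := (Real.Gamma_pos_of_pos (by linarith : 0 < -(w + 1))).ne'
      rw [hG]
      rw [eq_comm, ← sub_eq_zero]
      field_simp at hr ⊢
      linarith
  obtain ⟨n, hn⟩ := exists_nat_ge (-w - 1)
  exact h3 n w (by linarith)

/-! ### The case `ν < 1`: representation along a ray and the Fourier transform -/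

/-- Points of the ray never turn past its direction: |s| ≥ r - R and -1 ≤ cos β < 0 give |s| cos β ≤
R + r cos β = Re s, that is cos(arg s) ≥ cos β. -/
lemma arg_ray_mem {β : ℝ} (hβ1 : Real.pi / 2 < β) (hβ2 : β < Real.pi) {R r : ℝ} (hR : 0 < R)
    (hr : 0 ≤ r) : (ray β R r).arg ∈ Icc 0 β := by
  have hs : 0 < Real.sin β := Real.sin_pos_of_pos_of_lt_pi (by linarith [Real.pi_pos]) hβ2
  have hc : Real.cos β < 0 := Real.cos_neg_of_pi_div_two_lt_of_lt hβ1 (by linarith [Real.pi_pos])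
  have him : 0 ≤ (ray β R r).im := by rw [ray_im]; positivity
  have h0 : ray β R r ≠ 0 := Complex.slitPlane_ne_zero (ray_mem_slitPlane hs hR hr)
  have hn : 0 < ‖ray β R r‖ := norm_pos_iff.2 h0
  refine ⟨Complex.arg_nonneg_iff.2 him, ?_⟩
  rw [Complex.arg_of_im_nonneg_of_ne_zero him h0]
  refine le_of_le_of_eq ?_ (Real.arccos_cos (by linarith [Real.pi_pos]) hβ2.le)
  refine Real.arccos_le_arccos ?_
  rw [le_div_iff₀ hn, ray_re]
  have h1 : r - R ≤ ‖ray β R r‖ := by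
    have h2 : ‖(r : ℂ) * Complex.exp (β * Complex.I)‖ = r := by
      rw [norm_mul, Complex.norm_exp_ofReal_mul_I, mul_one, Complex.norm_real, Real.norm_of_nonneg hr]
    have h3 : ‖(R : ℂ)‖ = R := by rw [Complex.norm_real, Real.norm_of_nonneg hR.le]
    have h4 := norm_sub_le (ray β R r) (R : ℂ)
    rw [h3, ray, add_sub_cancel_left, h2] at h4
    rw [ray]; linarith
  nlinarith [Real.neg_one_le_cos β]

/-- The argument of s^{ν/2} lies in [0, βν/2], inside [0, π/4), so rotation by ±π/4 keeps it in the
open right half-plane; |s| ≥ R sin β makes the bound uniform. δ becomes the decay rate of the kernel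
in |x|. -/
lemma exists_le_re_ray_cpow {ν β : ℝ} (hν : 0 < ν) (hβ1 : Real.pi / 2 < β) (hβ2 : β < Real.pi)
    (hβν : β * ν < Real.pi / 2) {R : ℝ} (hR : 0 < R) :
    ∃ δ : ℝ, 0 < δ ∧ ∀ r : ℝ, 0 ≤ r →
      δ ≤ ((1 + Complex.I) * ray β R r ^ ((ν / 2 : ℝ) : ℂ)).re ∧
      δ ≤ ((1 - Complex.I) * ray β R r ^ ((ν / 2 : ℝ) : ℂ)).re := by
  have hs : 0 < Real.sin β := Real.sin_pos_of_pos_of_lt_pi (by linarith [Real.pi_pos]) hβ2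
  have hβ0 : 0 < β := by linarith [Real.pi_pos]
  set φ₀ := β * (ν / 2)
  have hφ0 : 0 < φ₀ := by positivity
  have hφ1 : φ₀ < Real.pi / 4 := by simp only [φ₀]; linarith
  have hd : 0 < Real.cos φ₀ - Real.sin φ₀ := by
    have h1 : Real.sin φ₀ < Real.sin (Real.pi / 4) :=
      Real.sin_lt_sin_of_lt_of_le_pi_div_two (by linarith) (by linarith [Real.pi_pos]) hφ1
    have h2 : Real.cos (Real.pi / 4) < Real.cos φ₀ :=
      Real.cos_lt_cos_of_nonneg_of_le_pi_div_two hφ0.le (by linarith [Real.pi_pos]) hφ1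
    rw [Real.sin_pi_div_four] at h1
    rw [Real.cos_pi_div_four] at h2
    linarith
  refine ⟨(R * Real.sin β) ^ (ν / 2) * (Real.cos φ₀ - Real.sin φ₀), by positivity, fun r hr => ?_⟩
  obtain ⟨ha0, ha1⟩ := arg_ray_mem hβ1 hβ2 hR hr
  set φ := (ray β R r).arg * (ν / 2) with hφ
  have hφa : 0 ≤ φ := by positivity
  have hφb : φ ≤ φ₀ := mul_le_mul_of_nonneg_right ha1 (by positivity)
  have hsin : Real.sin φ ≤ Real.sin φ₀ :=
    Real.sin_le_sin_of_le_of_le_pi_div_two (by linarith) (by linarith [Real.pi_pos]) hφb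
  have hcos : Real.cos φ₀ ≤ Real.cos φ :=
    Real.cos_le_cos_of_nonneg_of_le_pi hφa (by linarith [Real.pi_pos]) hφb
  have hsin0 : 0 ≤ Real.sin φ := Real.sin_nonneg_of_nonneg_of_le_pi hφa (by linarith [Real.pi_pos])
  have hn : (R * Real.sin β) ^ (ν / 2) ≤ ‖ray β R r‖ ^ (ν / 2) :=
    Real.rpow_le_rpow (by positivity) (le_norm_ray hs hR.le) (by positivity)
  have hre := Complex.cpow_ofReal_re (ray β R r) (ν / 2)
  have him := Complex.cpow_ofReal_im (ray β R r) (ν / 2)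
  rw [← hφ] at hre him
  simp only [Complex.mul_re, Complex.add_re, Complex.sub_re, Complex.one_re, Complex.I_re,
    Complex.add_im, Complex.sub_im, Complex.one_im, Complex.I_im, hre, him]
  have hn0 : 0 < (R * Real.sin β) ^ (ν / 2) := by positivity
  constructor
  · have : (R * Real.sin β) ^ (ν / 2) * (Real.cos φ₀ - Real.sin φ₀) ≤
        ‖ray β R r‖ ^ (ν / 2) * (Real.cos φ - Real.sin φ) := by
      gcongr
    linarith
  · have : (R * Real.sin β) ^ (ν / 2) * (Real.cos φ₀ - Real.sin φ₀) ≤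
        ‖ray β R r‖ ^ (ν / 2) * (Real.cos φ + Real.sin φ) := by
      gcongr
      linarith
    linarith

/-! ### Power series of the kernel and summation of the solution under the ray integral -/

noncomputable section

/-- The Laplace transform in `t` of the solution, as a function of `x` and of the fourth root `p`
of the fractional power of the Laplace variable. -/
def rodKernel (p : ℂ) (x : ℝ) : ℂ :=
  ((1 + Complex.I) * Complex.exp (-((1 + Complex.I) * p * (|x| : ℝ))) +
    (1 - Complex.I) * Complex.exp (-((1 - Complex.I) * p * (|x| : ℝ)))) / 4

/-- The coefficient of `p ^ m` in `rodKernel p x`. -/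
def rodCoeff (x : ℝ) (m : ℕ) : ℝ :=
  1 / √2 * ((-√2 * |x|) ^ m / (m.factorial : ℝ) * Real.cos (((m : ℝ) + 1) / 4 * Real.pi))

end

lemma one_add_I_eq : 1 + Complex.I = √2 * Complex.exp (Real.pi / 4 * Complex.I) := by
  have h1 : (Real.pi / 4 : ℂ) = ((Real.pi / 4 : ℝ) : ℂ) := by push_cast; ring
  have h2 : ((√2 : ℝ) : ℂ) * ((√2 : ℝ) : ℂ) = 2 := by
    rw [← Complex.ofReal_mul, Real.mul_self_sqrt (by norm_num)]; norm_num
  rw [h1, Complex.exp_mul_I, ← Complex.ofReal_cos, ← Complex.ofReal_sin, Real.cos_pi_div_four,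
    Real.sin_pi_div_four]
  push_cast
  linear_combination -(1 + Complex.I) / 2 * h2

lemma one_sub_I_eq : 1 - Complex.I = √2 * Complex.exp (-(Real.pi / 4 * Complex.I)) := by
  have h := congrArg (starRingEnd ℂ) one_add_I_eq
  rw [map_add, map_one, Complex.conj_I, map_mul, Complex.conj_ofReal, ← Complex.exp_conj] at h
  rw [sub_eq_add_neg, h]
  congr 2
  rw [map_mul, Complex.conj_I, map_div₀, Complex.conj_ofReal, Complex.conj_ofNat]
  ring

/-- Expanding both exponentials produces (1+i)^{m+1} + (1-i)^{m+1} = 2 (√2)^{m+1} cos((m+1)π/4), the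
source of the cosine in the series. -/
lemma hasSum_rodKernel (p : ℂ) (x : ℝ) :
    HasSum (fun m : ℕ => (rodCoeff x m : ℂ) * p ^ m) (rodKernel p x) := by
  have h : ∀ c : ℂ, HasSum (fun m : ℕ => c * ((-(c * p * (|x| : ℝ))) ^ m / (m.factorial : ℂ)))
      (c * Complex.exp (-(c * p * (|x| : ℝ)))) := fun c => by
    rw [Complex.exp_eq_exp_ℂ]
    exact (NormedSpace.expSeries_div_hasSum_exp _).mul_left c
  have h2 := ((h (1 + Complex.I)).add (h (1 - Complex.I))).div_const 4
  refine h2.congr_fun fun m => ?_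
  have h3 : (1 + Complex.I) ^ (m + 1) + (1 - Complex.I) ^ (m + 1)
      = 2 * (√2 : ℝ) ^ (m + 1) * (Real.cos (((m : ℝ) + 1) / 4 * Real.pi) : ℝ) := by
    rw [one_add_I_eq, one_sub_I_eq, mul_pow, mul_pow, ← Complex.exp_nat_mul, ← Complex.exp_nat_mul,
      Complex.ofReal_cos, Complex.cos]
    push_cast
    rw [show ((m : ℂ) + 1) * (Real.pi / 4 * Complex.I) = (m + 1) / 4 * Real.pi * Complex.I by ring,
      show ((m : ℂ) + 1) * -(Real.pi / 4 * Complex.I) = -((m + 1) / 4 * Real.pi) * Complex.I by ring]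
    ring
  have h4 : ((√2 : ℝ) : ℂ) * ((√2 : ℝ) : ℂ) = 2 := by
    rw [← Complex.ofReal_mul, Real.mul_self_sqrt (by norm_num)]; norm_num
  have h5 : ((√2 : ℝ) : ℂ) ≠ 0 := by
    intro h; rw [h] at h4; simp at h4
  rw [rodCoeff]
  have h6 : ∀ c : ℂ, c * ((-(c * p * (|x| : ℝ))) ^ m / (m.factorial : ℂ)) =
      c ^ (m + 1) * ((-(p * (|x| : ℝ))) ^ m / (m.factorial : ℂ)) := by
    intro c
    rw [show -(c * p * (|x| : ℝ)) = c * -(p * (|x| : ℝ)) by ring, mul_pow, pow_succ]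
    ring
  rw [h6, h6, ← add_mul, h3]
  push_cast
  rw [neg_pow (p * _), neg_mul, neg_pow (_ * _), mul_pow, mul_pow, pow_succ]
  field_simp
  linear_combination -2 * ((|x| : ℝ) : ℂ) ^ m * Complex.cos (((m : ℂ) + 1) * Real.pi / 4) * p ^ m *
    (m.factorial : ℂ)⁻¹ * h4

lemma abs_rodCoeff_le (x : ℝ) (m : ℕ) :
    |rodCoeff x m| ≤ (√2 * |x|) ^ m / (m.factorial : ℝ) := by
  have h1 : (1 : ℝ) ≤ √2 := by rw [Real.one_le_sqrt]; norm_num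
  rw [rodCoeff, abs_mul, abs_of_pos (by positivity : 0 < 1 / √2), abs_mul, abs_div, abs_pow, abs_mul,
    abs_neg, abs_abs, abs_of_pos (by positivity : 0 < √2), Nat.abs_cast]
  calc _ ≤ 1 * ((√2 * |x|) ^ m / (m.factorial : ℝ) * 1) := by
        gcongr
        · rw [div_le_one (by positivity)]; exact h1
        · exact Real.abs_cos_le_one _
    _ = _ := by ring

lemma rodSolution_one {ν : ℝ} (hν0 : 0 < ν) (hν1 : ν ≤ 1) (x : ℝ) :
    HasSum (fun m : ℕ => rodCoeff x m * (Real.Gamma (1 - ((m : ℝ) + 1) / 2 * ν))⁻¹)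
      (rodSolution ν x 1) := by
  rw [rodSolution_eq hν0]
  refine ((summable_rodTermInvGamma hν0 hν1 x 1).hasSum.mul_left _).congr_fun fun m => ?_
  rw [rodTermInvGamma, rodCoeff]
  simp only [Real.one_rpow, Real.sqrt_one, div_one, mul_one]
  ring

section
variable {ν β : ℝ} (hν0 : 0 < ν) (hν1 : ν ≤ 1) (hβ1 : Real.pi / 2 < β) (hβ2 : β < Real.pi)
  {R : ℝ} (hR : 0 < R)
include hν0 hν1 hβ1 hβ2 hR

/-- The solution at time `1` as an integral along a ray. -/
lemma rodSolution_one_eq_ray (x : ℝ) :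
    rodSolution ν x 1 = Real.pi⁻¹ * (∫ r in Ioi 0, Complex.exp (ray β R r) *
      ray β R r ^ ((ν / 2 - 1 : ℝ) : ℂ) * rodKernel (ray β R r ^ ((ν / 2 : ℝ) : ℂ)) x *
        Complex.exp (β * Complex.I)).im := by
  have hs : 0 < Real.sin β := Real.sin_pos_of_pos_of_lt_pi (by linarith [Real.pi_pos]) hβ2
  have hc : Real.cos β < 0 := Real.cos_neg_of_pi_div_two_lt_of_lt hβ1 (by linarith [Real.pi_pos])
  set g : ℝ → ℂ := fun r => Complex.exp (ray β R r) * ray β R r ^ ((ν / 2 - 1 : ℝ) : ℂ) with hg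
  set y := √2 * |x| with hy
  have hy0 : 0 ≤ y := by positivity
  have hexp : ∀ r : ℝ, HasSum (fun m : ℕ => ‖g r‖ * (y * ‖ray β R r‖ ^ (ν / 2)) ^ m /
      (m.factorial : ℝ)) (‖g r‖ * Real.exp (y * ‖ray β R r‖ ^ (ν / 2))) := fun r => by
    have := (NormedSpace.expSeries_div_hasSum_exp (y * ‖ray β R r‖ ^ (ν / 2))).mul_left ‖g r‖
    rw [← Real.exp_eq_exp_ℝ] at this
    simpa only [mul_div_assoc] using this
  have hpow : ∀ r : ℝ, 0 < r → ∀ m : ℕ, g r * (ray β R r ^ ((ν / 2 : ℝ) : ℂ)) ^ m =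
      Complex.exp (ray β R r) * ray β R r ^ ((((m : ℝ) + 1) / 2 * ν - 1 : ℝ) : ℂ) := by
    intro r hr m
    have h0 : ray β R r ≠ 0 := Complex.slitPlane_ne_zero (ray_mem_slitPlane hs hR hr.le)
    rw [hg, mul_assoc, ← Complex.cpow_nat_mul, ← Complex.cpow_add _ _ h0]
    congr 2
    push_cast
    ring
  have key : HasSum (fun m : ℕ => ∫ r in Ioi 0, g r * ((rodCoeff x m : ℂ) *
      (ray β R r ^ ((ν / 2 : ℝ) : ℂ)) ^ m) * Complex.exp (β * Complex.I))
      (∫ r in Ioi 0, g r * rodKernel (ray β R r ^ ((ν / 2 : ℝ) : ℂ)) x *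
        Complex.exp (β * Complex.I)) := by
    refine hasSum_integral_of_dominated_convergence
      (fun m r => ‖g r‖ * (y * ‖ray β R r‖ ^ (ν / 2)) ^ m / (m.factorial : ℝ)) ?_ ?_ ?_ ?_ ?_
    · intro m
      refine Measurable.aestronglyMeasurable ?_
      simp only [hg, ray]
      fun_prop
    · refine fun m => .of_forall fun r => ?_
      rw [norm_mul, norm_mul (g r), norm_mul (rodCoeff x m : ℂ), norm_pow,
        Complex.norm_exp_ofReal_mul_I, mul_one, Complex.norm_real, Complex.norm_cpow_real,
        mul_div_assoc, mul_pow]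
      calc _ ≤ ‖g r‖ * ((√2 * |x|) ^ m / (m.factorial : ℝ) * (‖ray β R r‖ ^ (ν / 2)) ^ m) := by
            gcongr
            exact abs_rodCoeff_le x m
        _ = _ := by rw [hy]; ring
    · exact .of_forall fun r => (hexp r).summable
    · simp only [(hexp _).tsum_eq]
      obtain ⟨C, hC0, hC⟩ := exists_norm_cexp_ray_mul_cpow_le hs hc (R₀ := R) (R₁ := R) hR (ν / 2 - 1)
      -- The factor e^s s^{ν/2-1} decays at rate cos β/2. The exponential series contributes growth
      -- exp(y|s|^{ν/2}) with |s|^{ν/2} ≤ 1 + √(R + r), and completing the square bounds y√(R + r)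
      -- by ε(R + r) plus a constant; this ε leaves the rate cos β/4.
      set ε := -(Real.cos β / 4) with hε
      have hε0 : 0 < ε := by linarith
      have hdom : IntegrableOn (fun r => C * Real.exp (y + ε * R + y ^ 2 / (4 * ε)) *
          Real.exp (Real.cos β / 4 * r)) (Ioi 0) :=
        (integrableOn_exp_mul_Ioi (by linarith) 0).const_mul _
      refine Integrable.mono' hdom ?_ (ae_restrict_of_forall_mem measurableSet_Ioi fun r hr => ?_)
      · refine Measurable.aestronglyMeasurable ?_
        simp only [hg, ray]
        fun_prop
      have hr : 0 < r := hr
      rw [norm_mul, norm_norm, Real.norm_of_nonneg (Real.exp_pos _).le]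
      have h1 : ‖ray β R r‖ ^ (ν / 2) ≤ 1 + √(R + r) := by
        have hle := norm_ray_le (β := β) hR.le hr.le
        rcases le_or_gt ‖ray β R r‖ 1 with h | h
        · have := Real.rpow_le_one (norm_nonneg _) h (by positivity : 0 ≤ ν / 2)
          linarith [Real.sqrt_nonneg (R + r)]
        · have h2 : ‖ray β R r‖ ^ (ν / 2) ≤ √‖ray β R r‖ := by
            rw [Real.sqrt_eq_rpow]
            exact Real.rpow_le_rpow_of_exponent_le h.le (by linarith)
          linarith [Real.sqrt_le_sqrt hle]
      have h2 : y * √(R + r) ≤ ε * (R + r) + y ^ 2 / (4 * ε) := by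
        have h3 : ε * (R + r) + y ^ 2 / (4 * ε) - y * √(R + r)
            = (2 * ε * √(R + r) - y) ^ 2 / (4 * ε) := by
          have h4 : √(R + r) ^ 2 = R + r := Real.sq_sqrt (by positivity)
          have h5 : ε * (R + r) = 4 * ε ^ 2 * √(R + r) ^ 2 / (4 * ε) := by
            rw [h4]; field_simp
          rw [h5]
          field_simp
          ring
        have : 0 ≤ (2 * ε * √(R + r) - y) ^ 2 / (4 * ε) := by positivity
        linarith
      have h3 : y * ‖ray β R r‖ ^ (ν / 2) ≤ (y + ε * R + y ^ 2 / (4 * ε)) + ε * r := by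
        have := mul_le_mul_of_nonneg_left h1 hy0
        linarith
      calc ‖g r‖ * Real.exp (y * ‖ray β R r‖ ^ (ν / 2))
          ≤ (C * Real.exp (Real.cos β / 2 * r)) *
            Real.exp ((y + ε * R + y ^ 2 / (4 * ε)) + ε * r) := by
            gcongr
            exact hC R ⟨le_rfl, le_rfl⟩ r hr.le
        _ = _ := by
            rw [Real.exp_add _ (ε * r), show Real.cos β / 2 * r = Real.cos β / 4 * r + -(ε * r) by
              rw [hε]; ring, Real.exp_add, Real.exp_neg]
            field_simp
    · refine .of_forall fun r => ?_
      exact ((hasSum_rodKernel _ x).mul_left _).mul_right _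
  have him := (Complex.hasSum_im key).mul_left Real.pi⁻¹
  refine (rodSolution_one hν0 hν1 x).unique (him.congr_fun fun m => ?_)
  have h1 : ∫ r in Ioi 0, g r * ((rodCoeff x m : ℂ) *
      (ray β R r ^ ((ν / 2 : ℝ) : ℂ)) ^ m) * Complex.exp (β * Complex.I)
      = (rodCoeff x m : ℂ) * ∫ r in Ioi 0, Complex.exp (ray β R r) *
        ray β R r ^ ((((m : ℝ) + 1) / 2 * ν - 1 : ℝ) : ℂ) * Complex.exp (β * Complex.I) := by
    rw [← integral_const_mul]
    refine setIntegral_congr_fun measurableSet_Ioi fun r hr => ?_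
    rw [← hpow r hr m]
    ring
  -- The exponent w is such that -w = 1 - (m+1)ν/2, the Gamma argument of the m-th term.
  have h2 := hankelIm_eq hβ1 hβ2 hR (((m : ℝ) + 1) / 2 * ν - 1)
  rw [hankelIm] at h2
  rw [h1, Complex.im_ofReal_mul, h2, neg_sub]
  field_simp

end

/-! ### Fourier transform in x of the kernel and of the solution at time 1 -/

lemma integrable_comp_abs {f : ℝ → ℂ} (hf : IntegrableOn f (Ioi 0)) :
    Integrable (fun x => f |x|) ∧ ∫ x, f |x| = 2 * ∫ x in Ioi (0 : ℝ), f x := by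
  have hpos : IntegrableOn (fun x => f |x|) (Ioi 0) :=
    hf.congr_fun (fun x hx => by simp only [abs_of_pos (mem_Ioi.1 hx)]) measurableSet_Ioi
  have hneg : IntegrableOn (fun x => f |x|) (Iic 0) := by
    have := (integrableOn_Ici_iff_integrableOn_Ioi (b := (0 : ℝ))).2 hpos
    rw [← neg_zero] at this
    simpa using this.comp_neg_Iic
  refine ⟨?_, ?_⟩
  · rw [← integrableOn_univ, ← Iic_union_Ioi (a := (0 : ℝ))]
    exact hneg.union hpos
  · have e1 : ∫ x in Ioi (0 : ℝ), f |x| = ∫ x in Ioi (0 : ℝ), f x :=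
      setIntegral_congr_fun measurableSet_Ioi fun x hx => by
        simp only [abs_of_pos (mem_Ioi.1 hx)]
    have e2 : ∫ x in Iic (0 : ℝ), f |x| = ∫ x in Ioi (0 : ℝ), f |x| := by
      have := integral_comp_neg_Iic 0 fun x => f |x|
      simpa using this
    rw [← setIntegral_univ, ← Iic_union_Ioi (a := (0 : ℝ)),
      setIntegral_union (Iic_disjoint_Ioi le_rfl) measurableSet_Ioi hneg hpos, e2, e1, two_mul]

lemma integrable_exp_neg_mul_abs {δ : ℝ} (hδ : 0 < δ) :
    Integrable fun x : ℝ => Real.exp (-δ * |x|) := by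
  have h := (integrable_comp_abs (f := fun x => ((Real.exp (-δ * x) : ℝ) : ℂ))
    (integrableOn_exp_mul_Ioi (by linarith) 0).ofReal).1
  exact h.re

/-- The Fourier transform of `exp (-c |x|)`. -/
lemma integral_cexp_neg_mul_abs_mul_cos {c : ℂ} (hc : 0 < c.re) (ξ : ℝ) :
    Integrable (fun x : ℝ => Complex.exp (-(c * (|x| : ℝ))) * (Real.cos (ξ * x) : ℝ)) ∧
    ∫ x : ℝ, Complex.exp (-(c * (|x| : ℝ))) * (Real.cos (ξ * x) : ℝ) = 2 * c / (c ^ 2 + ξ ^ 2) := by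
  have hint : Integrable (fun x : ℝ => Complex.exp (-(c * (|x| : ℝ))) * (Real.cos (ξ * x) : ℝ)) := by
    refine (integrable_exp_neg_mul_abs hc).mono' (Continuous.aestronglyMeasurable (by fun_prop))
      (.of_forall fun x => ?_)
    rw [norm_mul, Complex.norm_exp, Complex.norm_real]
    have h1 : ‖Real.cos (ξ * x)‖ ≤ 1 := Real.abs_cos_le_one _
    have h2 : (-(c * (|x| : ℝ))).re = -c.re * |x| := by simp
    rw [h2]
    exact mul_le_of_le_one_right (Real.exp_pos _).le h1
  refine ⟨hint, ?_⟩
  have h1 : ∀ x : ℝ, Complex.exp (-(c * (|x| : ℝ))) * (Real.cos (ξ * x) : ℝ) =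
      (fun y : ℝ => Complex.exp (-(c * y)) * (Real.cos (ξ * y) : ℝ)) |x| := by
    intro x
    simp only
    congr 2
    rcases abs_cases x with h | h
    · rw [h.1]
    · rw [h.1, mul_neg, Real.cos_neg]
  simp only [h1]
  have h2 : ∀ y : ℝ, Complex.exp (-(c * y)) * (Real.cos (ξ * y) : ℝ) =
      (Complex.exp ((-c + ξ * Complex.I) * y) + Complex.exp ((-c - ξ * Complex.I) * y)) / 2 := by
    intro y
    rw [Complex.ofReal_cos, Complex.cos, show (-c + ξ * Complex.I) * y = -(c * y) + ξ * y * Complex.I by ring,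
      show (-c - ξ * Complex.I) * y = -(c * y) + -(ξ * y) * Complex.I by ring, Complex.exp_add,
      Complex.exp_add]
    push_cast
    ring
  have hr1 : (-c + ξ * Complex.I).re < 0 := by simpa using hc
  have hr2 : (-c - ξ * Complex.I).re < 0 := by simpa using hc
  have hadd := ((integrableOn_exp_mul_complex_Ioi hr1 0).add
    (integrableOn_exp_mul_complex_Ioi hr2 0)).div_const 2
  rw [(integrable_comp_abs (f := fun y : ℝ => Complex.exp (-(c * y)) * (Real.cos (ξ * y) : ℝ))
    (hadd.congr (.of_forall fun y => (h2 y).symm))).2]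
  simp only [h2]
  rw [integral_div, integral_add (integrableOn_exp_mul_complex_Ioi hr1 0)
    (integrableOn_exp_mul_complex_Ioi hr2 0), integral_exp_mul_complex_Ioi hr1,
    integral_exp_mul_complex_Ioi hr2]
  have n1 : -c + ξ * Complex.I ≠ 0 := fun h => by rw [h] at hr1; simp at hr1
  have n2 : -c - ξ * Complex.I ≠ 0 := fun h => by rw [h] at hr2; simp at hr2
  have n3 : c ^ 2 + (ξ : ℂ) ^ 2 = (-c + ξ * Complex.I) * (-c - ξ * Complex.I) := by
    linear_combination (ξ : ℂ) ^ 2 * Complex.I_sq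
  rw [n3]
  simp only [Complex.ofReal_zero, mul_zero, Complex.exp_zero]
  field_simp
  ring

/-- Each exponential has transform 2c/(c² + ξ²) with c = (1 ± i)p, and since c² = ±2ip² the two
denominators multiply to 4p⁴ + ξ⁴. -/
lemma integral_rodKernel_mul_cos {p : ℂ} (h1 : 0 < ((1 + Complex.I) * p).re)
    (h2 : 0 < ((1 - Complex.I) * p).re) (ξ : ℝ) :
    ∫ x : ℝ, rodKernel p x * (Real.cos (ξ * x) : ℝ) = p ^ 3 / (p ^ 4 + (ξ ^ 4 / 4 : ℝ)) := by
  obtain ⟨i1, e1⟩ := integral_cexp_neg_mul_abs_mul_cos h1 ξ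
  obtain ⟨i2, e2⟩ := integral_cexp_neg_mul_abs_mul_cos h2 ξ
  have hk : ∀ x : ℝ, rodKernel p x * (Real.cos (ξ * x) : ℝ) =
      (1 + Complex.I) / 4 * (Complex.exp (-((1 + Complex.I) * p * (|x| : ℝ))) * (Real.cos (ξ * x) : ℝ)) +
      (1 - Complex.I) / 4 * (Complex.exp (-((1 - Complex.I) * p * (|x| : ℝ))) * (Real.cos (ξ * x) : ℝ)) := by
    intro x; rw [rodKernel]; ring
  have factor : ∀ c : ℂ, 0 < c.re → c ^ 2 + (ξ : ℂ) ^ 2 ≠ 0 := by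
    intro c hc h
    have h3 : (c + ξ * Complex.I) * (c - ξ * Complex.I) = 0 := by
      linear_combination h - (ξ : ℂ) ^ 2 * Complex.I_sq
    rcases mul_eq_zero.1 h3 with h4 | h4
    · have := congrArg Complex.re h4; simp at this; linarith
    · have := congrArg Complex.re h4; simp at this; linarith
  have f1 := factor _ h1
  have f2 := factor _ h2
  have hprod : (((1 + Complex.I) * p) ^ 2 + (ξ : ℂ) ^ 2) * (((1 - Complex.I) * p) ^ 2 + (ξ : ℂ) ^ 2)
      = 4 * (p ^ 4 + (ξ ^ 4 / 4 : ℝ)) := by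
    push_cast
    linear_combination (2 * p ^ 2 * ξ ^ 2 - 2 * p ^ 4 + p ^ 4 * (Complex.I ^ 2 - 1) + 2 * p ^ 4 - 2 * p ^ 4) * Complex.I_sq
  have f3 : p ^ 4 + ((ξ ^ 4 / 4 : ℝ) : ℂ) ≠ 0 := by
    intro h; rw [h, mul_zero] at hprod
    exact mul_ne_zero f1 f2 hprod
  simp only [hk]
  rw [integral_add (i1.const_mul _) (i2.const_mul _), integral_const_mul, integral_const_mul, e1, e2]
  rw [eq_div_iff f3]
  have : p ^ 4 + ((ξ ^ 4 / 4 : ℝ) : ℂ) = (((1 + Complex.I) * p) ^ 2 + (ξ : ℂ) ^ 2) *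
    (((1 - Complex.I) * p) ^ 2 + (ξ : ℂ) ^ 2) / 4 := by rw [hprod]; ring
  rw [this]
  have hd : ((1 - Complex.I) * p) ^ 2 + (ξ : ℂ) ^ 2 =
      ((1 + Complex.I) * p) ^ 2 + (ξ : ℂ) ^ 2 - 4 * Complex.I * p ^ 2 := by ring
  clear hprod this
  generalize ((1 + Complex.I) * p) ^ 2 + (ξ : ℂ) ^ 2 = D₁ at *
  generalize ((1 - Complex.I) * p) ^ 2 + (ξ : ℂ) ^ 2 = D₂ at *
  have : ((1 + Complex.I) / 4 * (2 * ((1 + Complex.I) * p) / D₁) +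
      (1 - Complex.I) / 4 * (2 * ((1 - Complex.I) * p) / D₂)) * (D₁ * D₂ / 4) =
      p / 8 * ((1 + Complex.I) ^ 2 * D₂ + (1 - Complex.I) ^ 2 * D₁) := by
    field_simp
    ring
  rw [this, hd]
  linear_combination (p * D₁ / 4 - p ^ 3 * Complex.I / 2 - p ^ 3) * Complex.I_sq

section
variable {ν β : ℝ} (hν0 : 0 < ν) (hβ1 : Real.pi / 2 < β) (hβ2 : β < Real.pi)
  (hβν : β * ν < Real.pi / 2) {R : ℝ} (hR : 0 < R)
include hν0 hβ1 hβ2 hβν hR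

/-- The majorant is the product of e^{-δ|x|} and |e^s s^{ν/2-1}|. This single Fubini statement gives
both integrability of the solution and its transform. -/
lemma integrable_prod_rodKernel :
    Integrable (fun q : ℝ × ℝ => Complex.exp (ray β R q.2) * ray β R q.2 ^ ((ν / 2 - 1 : ℝ) : ℂ) *
      rodKernel (ray β R q.2 ^ ((ν / 2 : ℝ) : ℂ)) q.1 * Complex.exp (β * Complex.I))
      (volume.prod (volume.restrict (Ioi 0))) := by
  have hs : 0 < Real.sin β := Real.sin_pos_of_pos_of_lt_pi (by linarith [Real.pi_pos]) hβ2
  have hc : Real.cos β < 0 := Real.cos_neg_of_pi_div_two_lt_of_lt hβ1 (by linarith [Real.pi_pos])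
  obtain ⟨δ, hδ0, hδ⟩ := exists_le_re_ray_cpow hν0 hβ1 hβ2 hβν hR
  have hb := (integrable_exp_neg_mul_abs hδ0).mul_prod
    (integrableOn_cexp_ray_mul_cpow hs hc hR (ν / 2 - 1)).norm
  refine hb.mono' ?_ ?_
  · refine Measurable.aestronglyMeasurable ?_
    simp only [ray, rodKernel]
    fun_prop
  · have hae : ∀ᵐ q : ℝ × ℝ ∂(volume.prod (volume.restrict (Ioi 0))), 0 < q.2 :=
      Measure.quasiMeasurePreserving_snd.ae (ae_restrict_mem measurableSet_Ioi)
    filter_upwards [hae] with q hq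
    obtain ⟨d1, d2⟩ := hδ q.2 hq.le
    rw [norm_mul, norm_mul (_ * _), Complex.norm_exp_ofReal_mul_I, mul_one, mul_comm]
    refine mul_le_mul_of_nonneg_right ?_ (norm_nonneg _)
    have hexp : ∀ c : ℂ, δ ≤ c.re → ‖Complex.exp (-(c * (|q.1| : ℝ)))‖ ≤ Real.exp (-δ * |q.1|) := by
      intro c hcr
      rw [Complex.norm_exp]
      have : (-(c * (|q.1| : ℝ))).re = -c.re * |q.1| := by simp
      rw [this]
      gcongr
    have n1 : ‖1 + Complex.I‖ ≤ 2 := (norm_add_le _ _).trans (by simp; norm_num)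
    have n2 : ‖1 - Complex.I‖ ≤ 2 := (norm_sub_le _ _).trans (by simp; norm_num)
    rw [rodKernel, norm_div]
    have h3 := hexp _ d1
    have h4 := hexp _ d2
    have h5 : ‖(4 : ℂ)‖ = 4 := by simp
    rw [h5, div_le_iff₀ (by norm_num)]
    refine (norm_add_le _ _).trans ?_
    rw [norm_mul, norm_mul (1 - Complex.I)]
    calc _ ≤ 2 * Real.exp (-δ * |q.1|) + 2 * Real.exp (-δ * |q.1|) := by gcongr
      _ = _ := by ring

end

/-- β > π/2 makes e^s decay along the ray, βν < π/2 makes the kernel decay in x. The two are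
compatible only because ν < 1. -/
lemma exists_ray_angle {ν : ℝ} (hν0 : 0 < ν) (hν1 : ν < 1) :
    ∃ β : ℝ, Real.pi / 2 < β ∧ β < Real.pi ∧ β * ν < Real.pi / 2 := by
  have hp := Real.pi_pos
  have h : Real.pi / 2 < min Real.pi (Real.pi / 2 / ν) := by
    refine lt_min (by linarith) ?_
    rw [lt_div_iff₀ hν0]
    nlinarith
  obtain ⟨β, h1, h2⟩ := exists_between h
  refine ⟨β, h1, h2.trans_le (min_le_left _ _), ?_⟩
  have := h2.trans_le (min_le_right _ _)
  rwa [lt_div_iff₀ hν0] at this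

lemma integrable_rodSolution_one {ν : ℝ} (hν0 : 0 < ν) (hν1 : ν < 1) :
    Integrable fun x => rodSolution ν x 1 := by
  obtain ⟨β, hβ1, hβ2, hβν⟩ := exists_ray_angle hν0 hν1
  have h := (integrable_prod_rodKernel hν0 hβ1 hβ2 hβν one_pos).integral_prod_left
  simp only [fun x => rodSolution_one_eq_ray hν0 hν1.le hβ1 hβ2 one_pos x]
  exact (h.im).const_mul _

/-- The Fourier transform of the solution at time `1`. -/
lemma integral_rodSolution_one_mul_cos {ν : ℝ} (hν0 : 0 < ν) (hν1 : ν < 1) (ξ : ℝ) :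
    ∫ x, rodSolution ν x 1 * Real.cos (ξ * x) = mittagLeffler (2 * ν) (-(ξ ^ 4 / 4)) := by
  obtain ⟨β, hβ1, hβ2, hβν⟩ := exists_ray_angle hν0 hν1
  have hs : 0 < Real.sin β := Real.sin_pos_of_pos_of_lt_pi (by linarith [Real.pi_pos]) hβ2
  have hc : Real.cos β < 0 := Real.cos_neg_of_pi_div_two_lt_of_lt hβ1 (by linarith [Real.pi_pos])
  set l := ξ ^ 4 / 4 with hl
  have hl0 : 0 ≤ l := by positivity
  -- The starting point R of the ray is free. It is taken so large that |s| ≥ R sin β = ρ and hence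
  -- |s|^{2ν} ≥ l + 1 on the whole ray, so that s^{2ν-1}/(s^{2ν} + l) expands in a geometric series
  -- of ratio at most l/(l + 1).
  set ρ : ℝ := (l + 1) ^ ((2 * ν)⁻¹) with hρ
  have hρ0 : 0 < ρ := by positivity
  have hρl : ρ ^ (2 * ν) = l + 1 := Real.rpow_inv_rpow (by positivity) (by positivity)
  set R := ρ / Real.sin β with hRdef
  have hR : 0 < R := by positivity
  have hRs : R * Real.sin β = ρ := by rw [hRdef]; field_simp
  have hFub := integrable_prod_rodKernel hν0 hβ1 hβ2 hβν hR
  obtain ⟨δ, hδ0, hδ⟩ := exists_le_re_ray_cpow hν0 hβ1 hβ2 hβν hR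
  have hFub2 : Integrable (fun q : ℝ × ℝ => (Complex.exp (ray β R q.2) *
      ray β R q.2 ^ ((ν / 2 - 1 : ℝ) : ℂ) *
      rodKernel (ray β R q.2 ^ ((ν / 2 : ℝ) : ℂ)) q.1 * Complex.exp (β * Complex.I)) *
      (Real.cos (ξ * q.1) : ℝ)) (volume.prod (volume.restrict (Ioi 0))) := by
    refine hFub.mul_bdd (c := 1) ?_ (.of_forall fun q => ?_)
    · exact Continuous.aestronglyMeasurable (by fun_prop)
    · rw [Complex.norm_real]; exact Real.abs_cos_le_one _
  have h1 : ∫ x, rodSolution ν x 1 * Real.cos (ξ * x) = Real.pi⁻¹ * (∫ x : ℝ, ∫ r in Ioi 0,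
      (Complex.exp (ray β R r) * ray β R r ^ ((ν / 2 - 1 : ℝ) : ℂ) *
      rodKernel (ray β R r ^ ((ν / 2 : ℝ) : ℂ)) x * Complex.exp (β * Complex.I)) *
      (Real.cos (ξ * x) : ℝ)).im := by
    have h2 := hFub2.integral_prod_left
    have h3 := (Complex.imCLM.integral_comp_comm h2).symm
    simp only [Complex.imCLM_apply] at h3
    rw [h3, ← integral_const_mul]
    refine integral_congr_ae (.of_forall fun x => ?_)
    simp only
    rw [rodSolution_one_eq_ray hν0 hν1.le hβ1 hβ2 hR x, integral_mul_const ((Real.cos (ξ * x) : ℝ) : ℂ), Complex.im_mul_ofReal]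
    ring
  have h4 : ∫ x : ℝ, ∫ r in Ioi 0,
      (Complex.exp (ray β R r) * ray β R r ^ ((ν / 2 - 1 : ℝ) : ℂ) *
      rodKernel (ray β R r ^ ((ν / 2 : ℝ) : ℂ)) x * Complex.exp (β * Complex.I)) *
      (Real.cos (ξ * x) : ℝ) = ∫ r in Ioi 0, Complex.exp (ray β R r) *
        (ray β R r ^ ((2 * ν - 1 : ℝ) : ℂ) / (ray β R r ^ ((2 * ν : ℝ) : ℂ) + l)) *
        Complex.exp (β * Complex.I) := by
    rw [integral_integral_swap hFub2]
    refine setIntegral_congr_fun measurableSet_Ioi fun r hr => ?_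
    have hr : 0 < r := hr
    have h0 : ray β R r ≠ 0 := Complex.slitPlane_ne_zero (ray_mem_slitPlane hs hR hr.le)
    obtain ⟨d1, d2⟩ := hδ r hr.le
    have h5 := integral_rodKernel_mul_cos (hδ0.trans_le d1) (hδ0.trans_le d2) ξ
    have h6 : ∀ x : ℝ, (Complex.exp (ray β R r) * ray β R r ^ ((ν / 2 - 1 : ℝ) : ℂ) *
      rodKernel (ray β R r ^ ((ν / 2 : ℝ) : ℂ)) x * Complex.exp (β * Complex.I)) *
      (Real.cos (ξ * x) : ℝ) = (Complex.exp (ray β R r) * ray β R r ^ ((ν / 2 - 1 : ℝ) : ℂ) *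
        Complex.exp (β * Complex.I)) * (rodKernel (ray β R r ^ ((ν / 2 : ℝ) : ℂ)) x *
        (Real.cos (ξ * x) : ℝ)) := fun x => by ring
    simp only [h6]
    rw [integral_const_mul, h5, ← Complex.cpow_nat_mul, ← Complex.cpow_nat_mul]
    have h7 : ray β R r ^ ((2 * ν - 1 : ℝ) : ℂ) = ray β R r ^ ((ν / 2 - 1 : ℝ) : ℂ) *
        ray β R r ^ (((3 : ℕ) : ℂ) * ((ν / 2 : ℝ) : ℂ)) := by
      rw [← Complex.cpow_add _ _ h0]; congr 1; push_cast; ring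
    have h8 : (((4 : ℕ) : ℂ) * ((ν / 2 : ℝ) : ℂ)) = ((2 * ν : ℝ) : ℂ) := by push_cast; ring
    rw [h7, h8]
    ring
  set q := l / (l + 1) with hq
  have hq0 : 0 ≤ q := by positivity
  have hq1 : q < 1 := by rw [hq, div_lt_one (by positivity)]; linarith
  set g : ℝ → ℂ := fun r => Complex.exp (ray β R r) * ray β R r ^ ((-1 : ℝ) : ℂ) with hg
  have hgi : IntegrableOn g (Ioi 0) := integrableOn_cexp_ray_mul_cpow hs hc hR (-1)
  have key : HasSum (fun n : ℕ => ∫ r in Ioi 0, g r *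
      (-(l : ℂ) * ray β R r ^ ((-(2 * ν) : ℝ) : ℂ)) ^ n * Complex.exp (β * Complex.I))
      (∫ r in Ioi 0, Complex.exp (ray β R r) *
        (ray β R r ^ ((2 * ν - 1 : ℝ) : ℂ) / (ray β R r ^ ((2 * ν : ℝ) : ℂ) + l)) *
        Complex.exp (β * Complex.I)) := by
    have hbd : ∀ r : ℝ, ‖-(l : ℂ) * ray β R r ^ ((-(2 * ν) : ℝ) : ℂ)‖ ≤ q := by
      intro r
      rw [norm_mul, norm_neg, Complex.norm_real, Real.norm_of_nonneg hl0, Complex.norm_cpow_real, hq,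
        div_eq_mul_inv, ← hρl, ← Real.rpow_neg hρ0.le]
      refine mul_le_mul_of_nonneg_left ?_ hl0
      refine Real.rpow_le_rpow_of_nonpos hρ0 ?_ (by linarith)
      rw [← hRs]
      exact le_norm_ray hs hR.le
    refine hasSum_integral_of_dominated_convergence (fun n r => ‖g r‖ * q ^ n) ?_ ?_ ?_ ?_ ?_
    · intro n
      refine Measurable.aestronglyMeasurable ?_
      simp only [hg, ray]
      fun_prop
    · refine fun n => .of_forall fun r => ?_
      rw [norm_mul, norm_mul (g r), norm_pow, Complex.norm_exp_ofReal_mul_I, mul_one]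
      have := hbd r
      gcongr
    · exact .of_forall fun r => (summable_geometric_of_lt_one hq0 hq1).mul_left _
    · refine Integrable.congr ?_ (.of_forall fun r => tsum_mul_left.symm)
      exact hgi.norm.mul_const _
    · refine ae_restrict_of_forall_mem measurableSet_Ioi fun r hr => ?_
      have hr : 0 < r := hr
      have h0 : ray β R r ≠ 0 := Complex.slitPlane_ne_zero (ray_mem_slitPlane hs hR hr.le)
      have hgeo := hasSum_geometric_of_norm_lt_one ((hbd r).trans_lt hq1)
      have hz : ray β R r ^ ((2 * ν : ℝ) : ℂ) ≠ 0 := by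
        rw [Ne, Complex.cpow_eq_zero_iff]; tauto
      have hinv : ray β R r ^ ((-(2 * ν) : ℝ) : ℂ) = (ray β R r ^ ((2 * ν : ℝ) : ℂ))⁻¹ := by
        rw [← Complex.cpow_neg]; push_cast; rfl
      have hsum0 : ray β R r ^ ((2 * ν : ℝ) : ℂ) + l ≠ 0 := by
        intro h
        have h2 : -(l : ℂ) * ray β R r ^ ((-(2 * ν) : ℝ) : ℂ) = 1 := by
          rw [hinv, ← eq_neg_of_add_eq_zero_left h, mul_inv_cancel₀ hz]
        have h3 := hbd r
        rw [h2, norm_one] at h3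
        linarith
      have hE : Complex.exp (ray β R r) *
        (ray β R r ^ ((2 * ν - 1 : ℝ) : ℂ) / (ray β R r ^ ((2 * ν : ℝ) : ℂ) + l)) *
        Complex.exp (β * Complex.I) = g r * (1 - -(l : ℂ) * ray β R r ^ ((-(2 * ν) : ℝ) : ℂ))⁻¹ *
          Complex.exp (β * Complex.I) := by
        have h5 : ray β R r ^ ((2 * ν - 1 : ℝ) : ℂ) = ray β R r ^ ((-1 : ℝ) : ℂ) *
            ray β R r ^ ((2 * ν : ℝ) : ℂ) := by
          rw [← Complex.cpow_add _ _ h0]; congr 1; push_cast; ring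
        have h6 : 1 - -(l : ℂ) * (ray β R r ^ ((2 * ν : ℝ) : ℂ))⁻¹ =
            (ray β R r ^ ((2 * ν : ℝ) : ℂ) + l) / ray β R r ^ ((2 * ν : ℝ) : ℂ) := by
          field_simp
          ring
        rw [hinv, h6, h5, inv_div, hg]
        ring
      rw [hE]
      exact (hgeo.mul_left _).mul_right _
  rw [h1, h4]
  have him := (Complex.hasSum_im key).mul_left Real.pi⁻¹
  refine him.unique ((summable_mittagLeffler (by positivity : 0 < 2 * ν) (-l)).hasSum.congr_fun
    fun n => ?_)
  have h5 : ∫ r in Ioi 0, g r * (-(l : ℂ) * ray β R r ^ ((-(2 * ν) : ℝ) : ℂ)) ^ n *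
      Complex.exp (β * Complex.I) = (((-l) ^ n : ℝ) : ℂ) * ∫ r in Ioi 0, Complex.exp (ray β R r) *
        ray β R r ^ ((-1 - 2 * ν * n : ℝ) : ℂ) * Complex.exp (β * Complex.I) := by
    rw [← integral_const_mul]
    refine setIntegral_congr_fun measurableSet_Ioi fun r hr => ?_
    have hr : 0 < r := hr
    have h0 : ray β R r ≠ 0 := Complex.slitPlane_ne_zero (ray_mem_slitPlane hs hR hr.le)
    have h6 : ray β R r ^ ((-1 - 2 * ν * n : ℝ) : ℂ) = ray β R r ^ ((-1 : ℝ) : ℂ) *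
        (ray β R r ^ ((-(2 * ν) : ℝ) : ℂ)) ^ n := by
      rw [← Complex.cpow_nat_mul, ← Complex.cpow_add _ _ h0]; congr 1; push_cast; ring
    simp only [hg]
    rw [h6, mul_pow]
    push_cast
    ring
  have h7 := hankelIm_eq hβ1 hβ2 hR (-1 - 2 * ν * n)
  rw [hankelIm] at h7
  rw [h5, Complex.im_ofReal_mul, h7, show -(-1 - 2 * ν * (n : ℝ)) = 2 * ν * n + 1 by ring]
  field_simp

/-- E_{2ν}(-l) is a value of the cosine transform of an integrable function, hence at most its L¹
norm; ξ is the frequency with ξ⁴/4 = l. -/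
lemma abs_mittagLeffler_le {ν : ℝ} (hν0 : 0 < ν) (hν1 : ν < 1) {l : ℝ} (hl : 0 ≤ l) :
    |mittagLeffler (2 * ν) (-l)| ≤ ∫ x, |rodSolution ν x 1| := by
  set ξ := √(√(4 * l)) with hξ
  have h4 : ξ ^ 4 / 4 = l := by
    rw [show ξ ^ 4 = (ξ ^ 2) ^ 2 by ring, hξ, Real.sq_sqrt (by positivity),
      Real.sq_sqrt (by positivity)]
    ring
  have h := integral_rodSolution_one_mul_cos hν0 hν1 ξ
  rw [h4] at h
  rw [← h, ← Real.norm_eq_abs]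
  refine (norm_integral_le_integral_norm _).trans ?_
  refine integral_mono_of_nonneg (.of_forall fun x => norm_nonneg _)
    (integrable_rodSolution_one hν0 hν1).abs (.of_forall fun x => ?_)
  simp only
  rw [norm_mul, Real.norm_eq_abs]
  exact mul_le_of_le_one_right (abs_nonneg _) (Real.abs_cos_le_one _)

/-! ### Pairing the solution with Schwartz functions -/

lemma rodSolution_neg (ν x t : ℝ) : rodSolution ν (-x) t = rodSolution ν x t := by
  unfold rodSolution rodTermSin
  simp only [abs_neg]

/-- Self-similarity: it carries everything proved at time 1 to all positive times. -/
lemma rodSolution_scale (ν x : ℝ) {t : ℝ} (ht : 0 < t) :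
    rodSolution ν x t = (√(t ^ ν))⁻¹ * rodSolution ν (x / √(t ^ ν)) 1 := by
  have ha : 0 < √(t ^ ν) := Real.sqrt_pos.2 (Real.rpow_pos_of_pos ht ν)
  have h : rodTermSin ν x t = rodTermSin ν (x / √(t ^ ν)) 1 := by
    ext m
    unfold rodTermSin
    rw [abs_div, abs_of_pos ha, Real.one_rpow, Real.sqrt_one, div_one]
  unfold rodSolution
  rw [h, Real.one_rpow, mul_one, Real.sqrt_mul zero_le_two]
  field_simp

lemma sqrt_rpow_pow_four (ν : ℝ) {t : ℝ} (ht : 0 < t) : √(t ^ ν) ^ 4 = t ^ (2 * ν) := by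
  rw [show √(t ^ ν) ^ 4 = (√(t ^ ν) ^ 2) ^ 2 by ring, Real.sq_sqrt (Real.rpow_nonneg ht.le _),
    ← Real.rpow_mul_natCast ht.le]
  congr 1
  push_cast
  ring

lemma integral_fourier_mul_eq_of_integrable {f : ℝ → ℂ} (hf : Integrable f) (ψ : 𝓢(ℝ, ℂ)) :
    ∫ k, 𝓕 f k * ψ k = ∫ x, f x * (𝓕 ψ) x := by
  have := VectorFourier.integral_fourierIntegral_smul_eq_flip (L := innerₗ ℝ)
    Real.continuous_fourierChar continuous_inner hf (ψ.integrable (μ := volume))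
  rw [flip_innerₗ] at this
  exact this

lemma fourier_eq_integral_cos {f : ℝ → ℝ} (hf : Integrable f) (heven : ∀ x, f (-x) = f x) (k : ℝ) :
    𝓕 (fun x => (f x : ℂ)) k = ((∫ x, f x * Real.cos (2 * Real.pi * k * x) : ℝ) : ℂ) := by
  have hc : Integrable fun x => f x * Real.cos (2 * Real.pi * k * x) :=
    hf.mul_bdd (c := 1) (Continuous.aestronglyMeasurable (by fun_prop))
      (.of_forall fun x => Real.abs_cos_le_one _)
  have hs : Integrable fun x => f x * Real.sin (2 * Real.pi * k * x) :=
    hf.mul_bdd (c := 1) (Continuous.aestronglyMeasurable (by fun_prop))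
      (.of_forall fun x => Real.abs_sin_le_one _)
  have hs0 : ∫ x, f x * Real.sin (2 * Real.pi * k * x) = 0 := by
    have h := integral_neg_eq_self (fun x => f x * Real.sin (2 * Real.pi * k * x)) volume
    simp only [heven, mul_neg, Real.sin_neg, integral_neg] at h
    linarith
  rw [Real.fourier_real_eq_integral_exp_smul]
  have h : ∀ x : ℝ, Complex.exp (((-2 * Real.pi * x * k : ℝ) : ℂ) * Complex.I) • (f x : ℂ) =
      ((f x * Real.cos (2 * Real.pi * k * x) : ℝ) : ℂ) -
        Complex.I * ((f x * Real.sin (2 * Real.pi * k * x) : ℝ) : ℂ) := by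
    intro x
    rw [Complex.exp_mul_I, ← Complex.ofReal_cos, ← Complex.ofReal_sin,
      show -2 * Real.pi * x * k = -(2 * Real.pi * k * x) by ring, Real.cos_neg, Real.sin_neg,
      smul_eq_mul]
    push_cast
    ring
  simp only [h]
  rw [integral_sub hc.ofReal (hs.ofReal.const_mul _), integral_const_mul, integral_complex_ofReal,
    integral_complex_ofReal, hs0]
  simp

lemma integrable_rodSolution {ν : ℝ} (hν0 : 0 < ν) (hν1 : ν < 1) {t : ℝ} (ht : 0 < t) :
    Integrable fun x => rodSolution ν x t := by
  have ha : 0 < √(t ^ ν) := Real.sqrt_pos.2 (Real.rpow_pos_of_pos ht ν)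
  simp only [fun x => rodSolution_scale ν x ht]
  exact ((integrable_rodSolution_one hν0 hν1).comp_div ha.ne').const_mul _

lemma fourier_rodSolution {ν : ℝ} (hν0 : 0 < ν) (hν1 : ν < 1) {t : ℝ} (ht : 0 < t) (k : ℝ) :
    𝓕 (fun x => (rodSolution ν x t : ℂ)) k =
      ((mittagLeffler (2 * ν) (-(4 * Real.pi ^ 4 * k ^ 4 * t ^ (2 * ν))) : ℝ) : ℂ) := by
  rw [fourier_eq_integral_cos (integrable_rodSolution hν0 hν1 ht) fun x => rodSolution_neg ν x t]
  congr 1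
  set a := √(t ^ ν) with ha'
  have ha : 0 < a := Real.sqrt_pos.2 (Real.rpow_pos_of_pos ht ν)
  have h1 : ∀ x, rodSolution ν x t * Real.cos (2 * Real.pi * k * x) =
      a⁻¹ * (fun y => rodSolution ν y 1 * Real.cos ((2 * Real.pi * k * a) * y)) (x / a) := by
    intro x
    simp only
    rw [rodSolution_scale ν x ht, ← ha']
    rw [show 2 * Real.pi * k * a * (x / a) = 2 * Real.pi * k * x by field_simp]
    ring
  simp only [h1]
  rw [integral_const_mul, Measure.integral_comp_div (fun y => rodSolution ν y 1 *
    Real.cos ((2 * Real.pi * k * a) * y)) a, integral_rodSolution_one_mul_cos hν0 hν1, abs_of_pos ha,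
    smul_eq_mul, inv_mul_cancel_left₀ ha.ne', mul_pow, ha', sqrt_rpow_pow_four ν ht]
  congr 1
  ring

lemma rodSolution_pairing_of_lt_one {ν : ℝ} (hν0 : 0 < ν) (hν1 : ν < 1) {t : ℝ} (ht : 0 < t)
    (φ : 𝓢(ℝ, ℂ)) :
    Integrable (fun x : ℝ => (rodSolution ν x t : ℂ) * φ x) ∧
    ∫ x : ℝ, (rodSolution ν x t : ℂ) * φ x = ∫ k : ℝ,
      ((mittagLeffler (2 * ν) (-(4 * Real.pi ^ 4 * k ^ 4 * t ^ (2 * ν))) : ℝ) : ℂ) * (𝓕⁻ φ) k := by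
  have hu : Integrable (fun x => (rodSolution ν x t : ℂ)) :=
    (integrable_rodSolution hν0 hν1 ht).ofReal (𝕜 := ℂ)
  constructor
  · exact hu.mul_bdd φ.continuous.aestronglyMeasurable
      (.of_forall fun x => SchwartzMap.norm_le_seminorm ℂ φ x)
  · have h := integral_fourier_mul_eq_of_integrable hu (𝓕⁻ φ)
    rw [FourierTransform.fourier_fourierInv_eq] at h
    refine h.symm.trans ?_
    refine integral_congr_ae (.of_forall fun k => ?_)
    simp only
    rw [← fourier_rodSolution hν0 hν1 ht k]

/-! ### The case `ν = 1` -/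

lemma mittagLeffler_two (y : ℝ) : mittagLeffler 2 (-y ^ 2) = Real.cos y := by
  rw [mittagLeffler, ← (Real.hasSum_cos y).tsum_eq]
  refine tsum_congr fun n => ?_
  have : (2 : ℝ) * n + 1 = ((2 * n : ℕ) : ℝ) + 1 := by push_cast; ring
  rw [this, Real.Gamma_nat_eq_factorial, neg_pow, ← pow_mul]

/-- The reflection formula and Γ(j + 1/2) = (2j-1)!! √π / 2^j, together with (2j)! = 2^j j!
(2j-1)!!, reduce the coefficient to the j-th term of a cosine-type series in x²/2. -/
lemma rodCoeff_mul_inv_Gamma_even (x : ℝ) (j : ℕ) :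
    rodCoeff x (2 * j) * (Real.Gamma (1 - (((2 * j : ℕ) : ℝ) + 1) / 2 * 1))⁻¹ =
      1 / √(2 * Real.pi) * ((x ^ 2 / 2) ^ j / (j.factorial : ℝ) *
        Real.cos (Real.pi / 4 - j * (Real.pi / 2))) := by
  have hz : (((2 * j : ℕ) : ℝ) + 1) / 2 * 1 = j + 1 / 2 := by push_cast; ring
  rw [hz, inv_Gamma_one_sub (by positivity), Real.Gamma_nat_add_half, rodCoeff]
  have h1 : Real.sin (Real.pi * (j + 1 / 2)) = (-1) ^ j := by
    rw [show Real.pi * ((j : ℝ) + 1 / 2) = Real.pi / 2 + j * Real.pi by ring,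
      Real.sin_add_nat_mul_pi, Real.sin_pi_div_two, mul_one]
  have h2 : Real.cos (Real.pi / 4 - j * (Real.pi / 2)) =
      (-1) ^ j * Real.cos ((((2 * j : ℕ) : ℝ) + 1) / 4 * Real.pi) := by
    rw [← Real.cos_sub_nat_mul_pi]
    congr 1
    push_cast
    ring
  have h3 : ((2 * j).factorial : ℝ) = 2 ^ j * (j.factorial : ℝ) * ((2 * j - 1).doubleFactorial : ℝ) := by
    rcases j with _ | j
    · simp
    · have := Nat.factorial_eq_mul_doubleFactorial (2 * j + 1)
      rw [show 2 * j + 1 + 1 = 2 * (j + 1) by ring, Nat.doubleFactorial_two_mul] at this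
      rw [this, show 2 * (j + 1) - 1 = 2 * j + 1 by omega]
      push_cast
      ring
  have h4 : (-√2 * |x|) ^ (2 * j) = 2 ^ j * (x ^ 2) ^ j := by
    rw [pow_mul, mul_pow, sq_abs, neg_sq, Real.sq_sqrt zero_le_two, mul_pow]
  have h5 : ((2 * j - 1).doubleFactorial : ℝ) ≠ 0 := by
    exact_mod_cast (Nat.doubleFactorial_pos _).ne'
  have h6 : √Real.pi * √Real.pi = Real.pi := Real.mul_self_sqrt Real.pi_pos.le
  have h7 : √Real.pi ≠ 0 := (Real.sqrt_pos.2 Real.pi_pos).ne'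
  have h8 : ((-1 : ℝ) ^ j) * (-1) ^ j = 1 := by rw [← mul_pow]; simp
  rw [h1, h2, h3, h4, Real.sqrt_mul zero_le_two]
  rw [div_pow]
  field_simp
  rw [pow_two (√Real.pi), h6]
  ring

/-- Odd terms vanish because 1 - (m+1)/2 is then a pole of Γ. The even ones are the real parts of
the terms of e^{iπ/4} exp(-ix²/2). -/
lemma rodSolution_one_one (x : ℝ) :
    rodSolution 1 x 1 = 1 / √(2 * Real.pi) * Real.cos (x ^ 2 / 2 - Real.pi / 4) := by
  have h := rodSolution_one one_pos le_rfl x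
  have hinj : Function.Injective fun j : ℕ => 2 * j := fun a b hab => by simpa using hab
  have hodd : ∀ m ∉ range (fun j : ℕ => 2 * j),
      rodCoeff x m * (Real.Gamma (1 - ((m : ℝ) + 1) / 2 * 1))⁻¹ = 0 := by
    intro m hm
    rcases Nat.even_or_odd' m with ⟨j, rfl | rfl⟩
    · exact absurd ⟨j, rfl⟩ hm
    · have : 1 - (((2 * j + 1 : ℕ) : ℝ) + 1) / 2 * 1 = -(j : ℝ) := by push_cast; ring
      rw [this, Real.Gamma_neg_nat_eq_zero, inv_zero, mul_zero]
  rw [← hinj.hasSum_iff hodd] at h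
  refine h.unique ?_
  have hexp : HasSum (fun j : ℕ => Complex.exp (Real.pi / 4 * Complex.I) *
      ((-(Complex.I * (x ^ 2 / 2 : ℝ))) ^ j / (j.factorial : ℂ)))
      (Complex.exp (Real.pi / 4 * Complex.I) * Complex.exp (-(Complex.I * (x ^ 2 / 2 : ℝ)))) := by
    have := NormedSpace.expSeries_div_hasSum_exp (-(Complex.I * ((x ^ 2 / 2 : ℝ) : ℂ)))
    rw [← Complex.exp_eq_exp_ℂ] at this
    exact this.mul_left _
  have hre := (Complex.hasSum_re hexp).mul_left (1 / √(2 * Real.pi))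
  have e1 : (Complex.exp (Real.pi / 4 * Complex.I) * Complex.exp (-(Complex.I * (x ^ 2 / 2 : ℝ)))).re
      = Real.cos (x ^ 2 / 2 - Real.pi / 4) := by
    rw [← Complex.exp_add, show (Real.pi / 4 * Complex.I + -(Complex.I * (x ^ 2 / 2 : ℝ)) : ℂ) =
      ((-(x ^ 2 / 2 - Real.pi / 4) : ℝ) : ℂ) * Complex.I by push_cast; ring,
      Complex.exp_ofReal_mul_I_re, Real.cos_neg]
  rw [e1] at hre
  refine hre.congr_fun fun j => ?_
  simp only [Function.comp_apply]
  rw [rodCoeff_mul_inv_Gamma_even]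
  congr 1
  have hI : -Complex.I = Complex.exp (-(Real.pi / 2 * Complex.I)) := by
    rw [Complex.exp_neg, Complex.exp_pi_div_two_mul_I, Complex.inv_I]
  rw [← neg_mul, mul_pow, hI, ← Complex.exp_nat_mul]
  have e2 : Complex.exp (Real.pi / 4 * Complex.I) * (Complex.exp (j * -(Real.pi / 2 * Complex.I)) *
      ((x ^ 2 / 2 : ℝ) : ℂ) ^ j / (j.factorial : ℂ)) =
      (((x ^ 2 / 2) ^ j / (j.factorial : ℝ) : ℝ) : ℂ) *
        Complex.exp (((Real.pi / 4 - j * (Real.pi / 2) : ℝ) : ℂ) * Complex.I) := by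
    rw [show (((Real.pi / 4 - j * (Real.pi / 2) : ℝ) : ℂ) * Complex.I) = Real.pi / 4 * Complex.I +
      j * -(Real.pi / 2 * Complex.I) by push_cast; ring, Complex.exp_add]
    push_cast
    ring
  rw [e2, Complex.re_ofReal_mul, Complex.exp_ofReal_mul_I_re]

/-- The Fourier transform of a Fresnel function, in the sense of distributions. -/
lemma integral_fresnel {τ : ℝ} (hτ : τ ≠ 0) (φ : 𝓢(ℝ, ℂ)) :
    (τ * Complex.I) ^ (1 / 2 : ℂ) * ∫ x : ℝ, Complex.exp (-Real.pi * (τ * Complex.I) * x ^ 2) * φ x =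
      ∫ k : ℝ, Complex.exp (-Real.pi / (τ * Complex.I) * k ^ 2) * (𝓕⁻ φ) k := by
  set b : ℝ → ℂ := fun ε => ε + τ * Complex.I with hb
  have hbre : ∀ ε, (b ε).re = ε := fun ε => by simp [hb]
  have hbne : ∀ ε, b ε ≠ 0 := fun ε h => by
    have := congrArg Complex.im h
    simp [hb] at this
    exact hτ this
  have hb0 : b 0 = τ * Complex.I := by simp [hb]
  have hbc : Continuous b := by simp only [hb]; fun_prop
  have hslit : b 0 ∈ Complex.slitPlane := by
    rw [hb0]; exact Complex.mem_slitPlane_iff.2 (Or.inr (by simpa using hτ))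
  have heq : ∀ ε : ℝ, 0 < ε → b ε ^ (1 / 2 : ℂ) *
      ∫ x : ℝ, Complex.exp (-Real.pi * b ε * x ^ 2) * φ x =
      ∫ k : ℝ, Complex.exp (-Real.pi / b ε * k ^ 2) * (𝓕⁻ φ) k := by
    intro ε hε
    have hre : 0 < (b ε).re := by rw [hbre]; exact hε
    have hpow : b ε ^ (1 / 2 : ℂ) ≠ 0 := by
      rw [Ne, Complex.cpow_eq_zero_iff]; exact fun h => hbne ε h.1
    have hgi : Integrable fun x : ℝ => Complex.exp (-Real.pi * b ε * x ^ 2) := by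
      have : 0 < (Real.pi * b ε).re := by
        rw [Complex.re_ofReal_mul]; exact mul_pos Real.pi_pos hre
      simpa only [neg_mul] using integrable_cexp_neg_mul_sq this
    have h := integral_fourier_mul_eq_of_integrable hgi (𝓕⁻ φ)
    rw [FourierTransform.fourier_fourierInv_eq, fourier_gaussian_pi hre] at h
    rw [← h, ← integral_const_mul]
    refine integral_congr_ae (.of_forall fun k => ?_)
    simp only
    field_simp
  have hae : ∀ᶠ ε : ℝ in 𝓝[>] 0, 0 < ε := self_mem_nhdsWithin
  have t1 : Tendsto (fun ε : ℝ => b ε ^ (1 / 2 : ℂ)) (𝓝[>] 0) (𝓝 (b 0 ^ (1 / 2 : ℂ))) := by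
    have : ContinuousAt (fun ε : ℝ => b ε ^ (1 / 2 : ℂ)) 0 :=
      ContinuousAt.comp (f := b) (continuousAt_cpow_const hslit) hbc.continuousAt
    exact this.tendsto.mono_left nhdsWithin_le_nhds
  have t2 : Tendsto (fun ε : ℝ => ∫ x : ℝ, Complex.exp (-Real.pi * b ε * x ^ 2) * φ x) (𝓝[>] 0)
      (𝓝 (∫ x : ℝ, Complex.exp (-Real.pi * b 0 * x ^ 2) * φ x)) := by
    refine tendsto_integral_filter_of_dominated_convergence (fun x => ‖φ x‖) ?_ ?_
      φ.integrable.norm ?_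
    · exact .of_forall fun ε => Continuous.aestronglyMeasurable (by fun_prop)
    · filter_upwards [hae] with ε hε
      refine .of_forall fun x => ?_
      rw [norm_mul]
      refine mul_le_of_le_one_left (norm_nonneg _) ?_
      rw [Complex.norm_exp, Real.exp_le_one_iff]
      have : (-Real.pi * b ε * x ^ 2).re = -(Real.pi * ε * x ^ 2) := by
        rw [show (-Real.pi * b ε * x ^ 2 : ℂ) = ((-Real.pi * x ^ 2 : ℝ) : ℂ) * b ε by push_cast; ring,
          Complex.re_ofReal_mul, hbre]
        ring
      rw [this]
      have := Real.pi_pos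
      have : 0 ≤ Real.pi * ε * x ^ 2 := by positivity
      linarith
    · refine .of_forall fun x => ?_
      refine Tendsto.mono_left ?_ nhdsWithin_le_nhds
      exact Continuous.tendsto (by fun_prop) 0
  have t3 : Tendsto (fun ε : ℝ => ∫ k : ℝ, Complex.exp (-Real.pi / b ε * k ^ 2) * (𝓕⁻ φ) k) (𝓝[>] 0)
      (𝓝 (∫ k : ℝ, Complex.exp (-Real.pi / b 0 * k ^ 2) * (𝓕⁻ φ) k)) := by
    refine tendsto_integral_filter_of_dominated_convergence (fun x => ‖(𝓕⁻ φ) x‖) ?_ ?_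
      (𝓕⁻ φ).integrable.norm ?_
    · exact .of_forall fun ε => Continuous.aestronglyMeasurable (by fun_prop)
    · filter_upwards [hae] with ε hε
      refine .of_forall fun x => ?_
      rw [norm_mul]
      refine mul_le_of_le_one_left (norm_nonneg _) ?_
      rw [Complex.norm_exp, Real.exp_le_one_iff]
      have : (-Real.pi / b ε * x ^ 2).re = -(Real.pi * x ^ 2 * ((b ε)⁻¹).re) := by
        rw [show (-Real.pi / b ε * x ^ 2 : ℂ) = ((-(Real.pi * x ^ 2) : ℝ) : ℂ) * (b ε)⁻¹ by
          push_cast; ring, Complex.re_ofReal_mul]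
        ring
      rw [this, Complex.inv_re, hbre]
      have := Real.pi_pos
      have := Complex.normSq_nonneg (b ε)
      have : 0 ≤ Real.pi * x ^ 2 * (ε / Complex.normSq (b ε)) := by positivity
      linarith
    · refine .of_forall fun x => ?_
      refine Tendsto.mono_left ?_ nhdsWithin_le_nhds
      have h1 : Continuous fun ε => -(Real.pi : ℂ) / b ε := continuous_const.div hbc hbne
      exact Continuous.tendsto (by fun_prop) 0
  have := tendsto_nhds_unique ((t1.mul t2).congr' (by filter_upwards [hae] with ε hε using heq ε hε)) t3
  rwa [hb0] at this

/-- Both cosines, in x²/(2t) - π/4 and in 2π²k²t, are split into conjugate exponentials, and each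
half is a Fresnel identity with parameter ±1/(2πt). The phases e^{±iπ/4} come from the square root
(±τi)^{1/2}. -/
lemma rodSolution_pairing_one {t : ℝ} (ht : 0 < t) (φ : 𝓢(ℝ, ℂ)) :
    Integrable (fun x : ℝ => (rodSolution 1 x t : ℂ) * φ x) ∧
    ∫ x : ℝ, (rodSolution 1 x t : ℂ) * φ x = ∫ k : ℝ,
      ((mittagLeffler (2 * 1) (-(4 * Real.pi ^ 4 * k ^ 4 * t ^ (2 * 1 : ℝ))) : ℝ) : ℂ) *
        (𝓕⁻ φ) k := by
  have hu : ∀ x, rodSolution 1 x t = 1 / √(2 * Real.pi * t) *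
      Real.cos (x ^ 2 / (2 * t) - Real.pi / 4) := by
    intro x
    rw [rodSolution_scale 1 x ht, rodSolution_one_one, Real.rpow_one, div_pow, Real.sq_sqrt ht.le,
      Real.sqrt_mul (by positivity) t, div_div, mul_comm t 2]
    field_simp
  have hml : ∀ k : ℝ, mittagLeffler (2 * 1) (-(4 * Real.pi ^ 4 * k ^ 4 * t ^ (2 * 1 : ℝ))) =
      Real.cos (2 * Real.pi ^ 2 * k ^ 2 * t) := by
    intro k
    rw [← mittagLeffler_two, mul_one, Real.rpow_two]
    congr 1
    ring
  simp only [hu, hml]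
  constructor
  · refine φ.integrable.bdd_mul (c := 1 / √(2 * Real.pi * t)) ?_ (.of_forall fun x => ?_)
    · exact Continuous.aestronglyMeasurable (by fun_prop)
    · rw [Complex.norm_real, norm_mul, Real.norm_of_nonneg (by positivity)]
      exact mul_le_of_le_one_right (by positivity) (Real.abs_cos_le_one _)
  set τ := 1 / (2 * Real.pi * t) with hτ
  have hpi := Real.pi_pos
  have hτ0 : 0 < τ := by positivity
  have hsq : √τ = 1 / √(2 * Real.pi * t) := by rw [hτ, Real.sqrt_div zero_le_one, Real.sqrt_one]
  have hpow : ∀ s : ℝ, s = 1 ∨ s = -1 → (((s * τ : ℝ) : ℂ) * Complex.I) ^ (1 / 2 : ℂ) =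
      √τ * Complex.exp (s * (Real.pi / 4) * Complex.I) := by
    intro s hs
    have e1 : ((s * τ : ℝ) : ℂ) * Complex.I = (τ : ℂ) * Complex.exp (((s * (Real.pi / 2) : ℝ) : ℂ) * Complex.I) := by
      rw [Complex.exp_mul_I, ← Complex.ofReal_cos, ← Complex.ofReal_sin]
      rcases hs with rfl | rfl <;> simp
    rw [e1, ofReal_mul_cpow hτ0 (Complex.exp_ne_zero _), Complex.cpow_def_of_ne_zero (Complex.exp_ne_zero _),
      Complex.log_exp]
    · have e2 : (τ : ℂ) ^ (1 / 2 : ℂ) = √τ := by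
        rw [Real.sqrt_eq_rpow, Complex.ofReal_cpow hτ0.le]
        norm_num
      rw [e2]
      congr 2
      push_cast
      ring
    · rcases hs with rfl | rfl <;> simp <;> linarith
    · rcases hs with rfl | rfl <;> simp <;> linarith
  have i1 : ∀ (s : ℝ) (χ : 𝓢(ℝ, ℂ)),
      Integrable fun x : ℝ => Complex.exp (((s * x ^ 2 : ℝ) : ℂ) * Complex.I) * χ x := by
    intro s χ
    refine χ.integrable.bdd_mul (c := 1) (Continuous.aestronglyMeasurable (by fun_prop))
      (.of_forall fun x => ?_)
    rw [Complex.norm_exp_ofReal_mul_I]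
  have hF : ∀ s : ℝ, s = 1 ∨ s = -1 → (√τ : ℂ) * Complex.exp (s * (Real.pi / 4) * Complex.I) *
      ∫ x : ℝ, Complex.exp (((-s / (2 * t) * x ^ 2 : ℝ) : ℂ) * Complex.I) * φ x =
      ∫ k : ℝ, Complex.exp (((s * (2 * Real.pi ^ 2 * t) * k ^ 2 : ℝ) : ℂ) * Complex.I) * (𝓕⁻ φ) k := by
    intro s hs
    have hs2 : s * s = 1 := by rcases hs with rfl | rfl <;> norm_num
    have hs0 : s ≠ 0 := fun h => by simp [h] at hs2
    have h := integral_fresnel (τ := s * τ) (mul_ne_zero hs0 hτ0.ne') φ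
    rw [hpow s hs] at h
    have a1 : ∀ x : ℝ, -(Real.pi : ℂ) * (((s * τ : ℝ) : ℂ) * Complex.I) * x ^ 2 =
        ((-s / (2 * t) * x ^ 2 : ℝ) : ℂ) * Complex.I := by
      intro x
      have : -s / (2 * t) = -Real.pi * (s * τ) := by rw [hτ]; field_simp
      rw [this]; push_cast; ring
    have a2 : ∀ x : ℝ, -(Real.pi : ℂ) / (((s * τ : ℝ) : ℂ) * Complex.I) * x ^ 2 =
        ((s * (2 * Real.pi ^ 2 * t) * x ^ 2 : ℝ) : ℂ) * Complex.I := by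
      intro x
      have e : s * (2 * Real.pi ^ 2 * t) = Real.pi / (s * τ) := by
        rw [hτ, eq_div_iff (by rw [← hτ]; exact mul_ne_zero hs0 hτ0.ne')]
        field_simp
        linear_combination hs2
      have hne : ((s * τ : ℝ) : ℂ) ≠ 0 := by exact_mod_cast mul_ne_zero hs0 hτ0.ne'
      rw [e, ← div_div, Complex.div_I]
      clear_value τ
      push_cast
      ring
    simp only [a1, a2] at h
    exact h
  have hF1 := hF 1 (Or.inl rfl)
  have hF2 := hF (-1) (Or.inr rfl)
  have lhs : ∀ x : ℝ, ((1 / √(2 * Real.pi * t) * Real.cos (x ^ 2 / (2 * t) - Real.pi / 4) : ℝ) : ℂ) * φ x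
      = (√τ : ℂ) * Complex.exp ((1 : ℝ) * (Real.pi / 4) * Complex.I) / 2 *
        (Complex.exp (((-1 / (2 * t) * x ^ 2 : ℝ) : ℂ) * Complex.I) * φ x) +
        (√τ : ℂ) * Complex.exp ((-1 : ℝ) * (Real.pi / 4) * Complex.I) / 2 *
        (Complex.exp (((- -1 / (2 * t) * x ^ 2 : ℝ) : ℂ) * Complex.I) * φ x) := by
    intro x
    rw [← hsq, Complex.ofReal_mul, Complex.ofReal_cos, Complex.cos]
    have b1 : Complex.exp (((x ^ 2 / (2 * t) - Real.pi / 4 : ℝ) : ℂ) * Complex.I) =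
        Complex.exp ((-1 : ℝ) * (Real.pi / 4) * Complex.I) *
        Complex.exp (((- -1 / (2 * t) * x ^ 2 : ℝ) : ℂ) * Complex.I) := by
      rw [← Complex.exp_add]; congr 1; push_cast; ring
    have b2 : Complex.exp (-((x ^ 2 / (2 * t) - Real.pi / 4 : ℝ) : ℂ) * Complex.I) =
        Complex.exp ((1 : ℝ) * (Real.pi / 4) * Complex.I) *
        Complex.exp (((-1 / (2 * t) * x ^ 2 : ℝ) : ℂ) * Complex.I) := by
      rw [← Complex.exp_add]; congr 1; push_cast; ring
    rw [b1, b2]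
    ring
  have rhs : ∀ k : ℝ, ((Real.cos (2 * Real.pi ^ 2 * k ^ 2 * t) : ℝ) : ℂ) * (𝓕⁻ φ) k =
      1 / 2 * (Complex.exp (((1 * (2 * Real.pi ^ 2 * t) * k ^ 2 : ℝ) : ℂ) * Complex.I) * (𝓕⁻ φ) k) +
      1 / 2 * (Complex.exp (((-1 * (2 * Real.pi ^ 2 * t) * k ^ 2 : ℝ) : ℂ) * Complex.I) * (𝓕⁻ φ) k) := by
    intro k
    rw [Complex.ofReal_cos, Complex.cos, show ((2 * Real.pi ^ 2 * k ^ 2 * t : ℝ) : ℂ) =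
      ((1 * (2 * Real.pi ^ 2 * t) * k ^ 2 : ℝ) : ℂ) by push_cast; ring,
      show -((1 * (2 * Real.pi ^ 2 * t) * k ^ 2 : ℝ) : ℂ) =
      ((-1 * (2 * Real.pi ^ 2 * t) * k ^ 2 : ℝ) : ℂ) by push_cast; ring]
    ring
  simp only [lhs, rhs]
  rw [integral_add ((i1 _ φ).const_mul _) ((i1 _ φ).const_mul _),
    integral_add ((i1 _ _).const_mul _) ((i1 _ _).const_mul _), integral_const_mul, integral_const_mul,
    integral_const_mul, integral_const_mul, ← hF1, ← hF2]
  ring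

/-! ### Both cases together -/

lemma rodSolution_pairing {ν : ℝ} (hν0 : 0 < ν) (hν1 : ν ≤ 1) {t : ℝ} (ht : 0 < t) (φ : 𝓢(ℝ, ℂ)) :
    Integrable (fun x : ℝ => (rodSolution ν x t : ℂ) * φ x) ∧
    ∫ x : ℝ, (rodSolution ν x t : ℂ) * φ x = ∫ k : ℝ,
      ((mittagLeffler (2 * ν) (-(4 * Real.pi ^ 4 * k ^ 4 * t ^ (2 * ν))) : ℝ) : ℂ) * (𝓕⁻ φ) k := by
  rcases hν1.lt_or_eq with h | rfl
  · exact rodSolution_pairing_of_lt_one hν0 h ht φ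
  · exact rodSolution_pairing_one ht φ

lemma exists_abs_mittagLeffler_le {ν : ℝ} (hν0 : 0 < ν) (hν1 : ν ≤ 1) :
    ∃ C : ℝ, ∀ l : ℝ, 0 ≤ l → |mittagLeffler (2 * ν) (-l)| ≤ C := by
  rcases hν1.lt_or_eq with h | rfl
  · exact ⟨_, fun l hl => abs_mittagLeffler_le hν0 h hl⟩
  · refine ⟨1, fun l hl => ?_⟩
    rw [← Real.sq_sqrt hl, mul_one, mittagLeffler_two]
    exact Real.abs_cos_le_one _

/-! ### Hierarchies of Volterra equations and Caputo derivatives -/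

/-- The power `t ^ b / Γ(b + 1)`, which is `0` when `b` is a negative integer. -/
noncomputable def powGamma (b t : ℝ) : ℂ := ((t ^ b / Real.Gamma (b + 1) : ℝ) : ℂ)

lemma powGamma_zero (t : ℝ) : powGamma 0 t = 1 := by simp [powGamma]

lemma powGamma_neg_nat (m : ℕ) (t : ℝ) : powGamma (-((m : ℝ) + 1)) t = 0 := by
  have : -((m : ℝ) + 1) + 1 = -(m : ℝ) := by ring
  rw [powGamma, this, Real.Gamma_neg_nat_eq_zero]
  simp

/-- The value 0 assigned to Γ at its poles makes the rule hold for every b: for b = 0 it says that a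
constant has derivative 0. -/
lemma hasDerivAt_powGamma (b : ℝ) {t : ℝ} (ht : 0 < t) :
    HasDerivAt (powGamma b) (powGamma (b - 1) t) t := by
  have h : HasDerivAt (fun s : ℝ => s ^ b / Real.Gamma (b + 1))
      (t ^ (b - 1) / Real.Gamma (b - 1 + 1)) t := by
    have h1 := (Real.hasDerivAt_rpow_const (p := b) (Or.inl ht.ne')).div_const (Real.Gamma (b + 1))
    refine h1.congr_deriv ?_
    rw [sub_add_cancel]
    rcases eq_or_ne b 0 with rfl | hb
    · simp [Real.Gamma_zero]
    · rw [Real.Gamma_add_one hb, mul_div_mul_left _ _ hb]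
  exact h.ofReal_comp

lemma continuousOn_powGamma (b : ℝ) : ContinuousOn (powGamma b) (Ioi 0) :=
  fun _ ht => (hasDerivAt_powGamma b ht).continuousAt.continuousWithinAt

lemma tendsto_powGamma {b : ℝ} (hb : 0 < b) : Tendsto (powGamma b) (𝓝[>] 0) (𝓝 0) := by
  have h : Tendsto (fun t : ℝ => t ^ b / Real.Gamma (b + 1)) (𝓝[>] 0) (𝓝 0) := by
    have : ContinuousAt (fun t : ℝ => t ^ b / Real.Gamma (b + 1)) 0 :=
      (Real.continuousAt_rpow_const 0 b (Or.inr hb.le)).div_const _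
    have := this.tendsto.mono_left (nhdsWithin_le_nhds (s := Ioi 0))
    simpa [Real.zero_rpow hb.ne'] using this
  exact (Complex.continuous_ofReal.tendsto' 0 0 Complex.ofReal_zero).comp h

lemma rlInt_powGamma {a b : ℝ} (ha : 0 < a) (hb : -1 < b) {t : ℝ} (ht : 0 < t) :
    rlInt a (powGamma b) t = powGamma (a + b) t := rlInt_rpow ha hb ht

lemma rlInt_const {a : ℝ} (ha : 0 < a) {t : ℝ} (ht : 0 < t) (c : ℂ) :
    rlInt a (fun _ => c) t = c * powGamma a t := by
  have h := rlInt_powGamma ha (b := 0) (by norm_num) ht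
  rw [add_zero] at h
  rw [← h, ← rlInt_const_mul]
  exact rlInt_congr fun s _ => by rw [powGamma_zero, mul_one]

lemma integrableOn_kernel_mul_powGamma {a b : ℝ} (ha : 0 < a) (hb : -1 < b) {t : ℝ} (ht : 0 < t) :
    IntegrableOn (fun s => (((t - s) ^ (a - 1) : ℝ) : ℂ) * powGamma b s) (Ioo 0 t) := by
  have h := (integrableOn_Ioo_rpow_mul_rpow ha (b := b + 1) (by linarith) ht).ofReal (𝕜 := ℂ)
  have h2 := h.mul_const (((Real.Gamma (b + 1) : ℝ) : ℂ)⁻¹)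
  refine h2.congr (.of_forall fun s => ?_)
  simp only [powGamma, sub_zero, add_sub_cancel_right]
  change (((t - s) ^ (a - 1) * s ^ b : ℝ) : ℂ) * _ = _
  push_cast
  ring

section boundedNearZero

variable {g : ℝ → ℂ}

lemma aestronglyMeasurable_Ioo (hc : ContinuousOn g (Ioi 0)) (t : ℝ) :
    AEStronglyMeasurable g (volume.restrict (Ioo 0 t)) :=
  (hc.mono fun _ h => h.1).aestronglyMeasurable measurableSet_Ioo

lemma integrableOn_Ioo_of_bounded (hc : ContinuousOn g (Ioi 0))
    (hb : ∀ t, ∃ C, ∀ s ∈ Ioo 0 t, ‖g s‖ ≤ C) (t : ℝ) : IntegrableOn g (Ioo 0 t) := by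
  obtain ⟨C, hC⟩ := hb t
  refine Integrable.of_bound (aestronglyMeasurable_Ioo hc t) C ?_
  exact (ae_restrict_iff' measurableSet_Ioo).2 (.of_forall hC)

/-- Splitting off one ordinary integration reduces continuity and differentiability of fractional
integrals to the fundamental theorem of calculus. -/
lemma rlInt_eq_rlInt_one {β : ℝ} (hβ : 1 < β) (hc : ContinuousOn g (Ioi 0))
    (hb : ∀ t, ∃ C, ∀ s ∈ Ioo 0 t, ‖g s‖ ≤ C) (t : ℝ) :
    rlInt β g t = rlInt 1 (rlInt (β - 1) g) t := by
  rcases le_or_gt t 0 with h | h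
  · simp [rlInt, Ioo_eq_empty (not_lt.2 h)]
  obtain ⟨C, hC⟩ := hb t
  rw [rlInt_rlInt one_pos (by linarith) (aestronglyMeasurable_Ioo hc t)
    (integrableOn_kernel_mul_of_bounded (by linarith) (aestronglyMeasurable_Ioo hc t) hC)]
  congr 1
  ring

lemma rlInt_bounded {β : ℝ} (hβ : 0 < β) (hb : ∀ t, ∃ C, ∀ s ∈ Ioo 0 t, ‖g s‖ ≤ C) (t : ℝ) :
    ∃ C, ∀ s ∈ Ioo 0 t, ‖rlInt β g s‖ ≤ C := by
  obtain ⟨C, hC⟩ := hb t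
  refine ⟨|C| * (t ^ β / Real.Gamma (β + 1)), fun s hs => ?_⟩
  have h := norm_rlInt_le hβ hs.1 (C := |C|) (g := g)
    fun r hr => (hC r ⟨hr.1, hr.2.trans hs.2⟩).trans (le_abs_self C)
  refine h.trans ?_
  have := Real.Gamma_pos_of_pos (by linarith : 0 < β + 1)
  have := Real.rpow_le_rpow hs.1.le hs.2.le hβ.le
  gcongr

lemma tendsto_rlInt {β : ℝ} (hβ : 0 < β) (hb : ∀ t, ∃ C, ∀ s ∈ Ioo 0 t, ‖g s‖ ≤ C) :
    Tendsto (rlInt β g) (𝓝[>] 0) (𝓝 0) := by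
  obtain ⟨C, hC⟩ := hb 1
  have h1 := (tendsto_powGamma hβ).norm.const_mul C
  rw [norm_zero, mul_zero] at h1
  refine squeeze_zero_norm' ?_ h1
  filter_upwards [Ioo_mem_nhdsGT one_pos] with s hs
  have h := norm_rlInt_le hβ hs.1 (C := C) (g := g) fun r hr => hC r ⟨hr.1, hr.2.trans hs.2⟩
  refine h.trans_eq ?_
  have := Real.Gamma_pos_of_pos (by linarith : 0 < β + 1)
  have := hs.1
  rw [powGamma, Complex.norm_real, Real.norm_of_nonneg (by positivity)]

/-- Needed for the inner integral of order β - 1, which may lie in (0, 1), where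
`continuousOn_rlInt` says nothing. -/
lemma stronglyMeasurable_rlInt {β : ℝ} (hc : ContinuousOn g (Ioi 0)) :
    StronglyMeasurable (rlInt β g) := by
  classical
  have hg : Measurable ((Ioi (0 : ℝ)).indicator g) := by
    rw [← piecewise_eq_indicator]
    exact hc.measurable_piecewise continuousOn_const measurableSet_Ioi
  have hk : Measurable (Function.uncurry fun t s : ℝ =>
      {p : ℝ × ℝ | p.2 < p.1}.indicator
      (fun p => (((p.1 - p.2) ^ (β - 1) : ℝ) : ℂ) * (Ioi (0 : ℝ)).indicator g p.2) (t, s)) := by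
    change Measurable fun p : ℝ × ℝ => {p : ℝ × ℝ | p.2 < p.1}.indicator
      (fun p => (((p.1 - p.2) ^ (β - 1) : ℝ) : ℂ) * (Ioi (0 : ℝ)).indicator g p.2) p
    refine Measurable.indicator ?_ (measurableSet_lt measurable_snd measurable_fst)
    exact (Complex.measurable_ofReal.comp
      ((measurable_fst.sub measurable_snd).pow_const _)).mul (hg.comp measurable_snd)
  have h := (hk.stronglyMeasurable.integral_prod_right (ν := volume)).const_mul
    (((Real.Gamma β : ℝ) : ℂ)⁻¹)
  convert h using 1
  ext t
  rw [rlInt, ← integral_indicator measurableSet_Ioo]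
  congr 2
  ext s
  simp only [indicator_apply, mem_Ioo, mem_Ioi, Set.mem_ofPred_eq]
  by_cases h1 : 0 < s <;> by_cases h2 : s < t <;> simp [h1, h2]

lemma continuousOn_rlInt {β : ℝ} (hβ : 1 ≤ β) (hc : ContinuousOn g (Ioi 0))
    (hb : ∀ t, ∃ C, ∀ s ∈ Ioo 0 t, ‖g s‖ ≤ C) : ContinuousOn (rlInt β g) (Ioi 0) := by
  rcases hβ.eq_or_lt with rfl | hβ
  · exact rlInt_continuousOn_of_one fun t _ => integrableOn_Ioo_of_bounded hc hb t
  rw [funext (rlInt_eq_rlInt_one hβ hc hb)]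
  refine rlInt_continuousOn_of_one fun t _ => ?_
  obtain ⟨C, hC⟩ := rlInt_bounded (β := β - 1) (by linarith) hb t
  refine Integrable.of_bound (stronglyMeasurable_rlInt hc).aestronglyMeasurable C ?_
  exact (ae_restrict_iff' measurableSet_Ioo).2 (.of_forall hC)

lemma hasDerivAt_rlInt {β : ℝ} (hβ : 2 ≤ β) (hc : ContinuousOn g (Ioi 0))
    (hb : ∀ t, ∃ C, ∀ s ∈ Ioo 0 t, ‖g s‖ ≤ C) {t : ℝ} (ht : 0 < t) :
    HasDerivAt (rlInt β g) (rlInt (β - 1) g t) t := by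
  rw [funext (rlInt_eq_rlInt_one (by linarith) hc hb)]
  have hc' := continuousOn_rlInt (β := β - 1) (by linarith) hc hb
  exact hasDerivAt_rlInt_one ht
    (integrableOn_Ioo_of_bounded hc' (rlInt_bounded (by linarith) hb) t) hc'

end boundedNearZero

/-- A hierarchy of Volterra equations `Gₙ = cₙ - I^α Gₙ₊₁` for continuous functions on `(0, ∞)`
that are bounded near zero. -/
structure VolterraSeq (α : ℝ) (c : ℕ → ℂ) (G : ℕ → ℝ → ℂ) : Prop where
  continuousOn : ∀ n, ContinuousOn (G n) (Ioi 0)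
  bounded : ∀ n t, ∃ C, ∀ s ∈ Ioo 0 t, ‖G n s‖ ≤ C
  eq : ∀ n t, 0 < t → G n t = c n - rlInt α (G (n + 1)) t

namespace VolterraSeq

variable {α : ℝ} {c : ℕ → ℂ} {G : ℕ → ℝ → ℂ}

lemma shift (h : VolterraSeq α c G) (k : ℕ) :
    VolterraSeq α (fun n => c (n + k)) (fun n => G (n + k)) where
  continuousOn n := h.continuousOn _
  bounded n := h.bounded _
  eq n t ht := by
    have := h.eq (n + k) t ht
    rw [this, Nat.add_right_comm]

/-- The `N`-fold iterate of a hierarchy of Volterra equations. -/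
lemma iterate (h : VolterraSeq α c G) (hα : 0 < α) (N : ℕ) {t : ℝ} (ht : 0 < t) :
    G 0 t = ∑ j ∈ Finset.range (N + 1), (-1) ^ j * c j * powGamma (α * j) t +
      (-1) ^ (N + 1) * rlInt (α * (N + 1)) (G (N + 1)) t := by
  induction N with
  | zero =>
    rw [h.eq 0 t ht]
    simp [powGamma_zero, sub_eq_add_neg]
  | succ N ih =>
    have hβ : 0 < α * (N + 1) := by positivity
    rw [ih, Finset.sum_range_succ _ (N + 1)]
    have hm := aestronglyMeasurable_Ioo (h.continuousOn (N + 1 + 1)) t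
    obtain ⟨C, hC⟩ := h.bounded (N + 1 + 1) t
    have e1 : rlInt (α * (N + 1)) (G (N + 1)) t = rlInt (α * (N + 1)) (fun _ => c (N + 1)) t -
        rlInt (α * (N + 1)) (rlInt α (G (N + 1 + 1))) t := by
      rw [← rlInt_sub]
      · exact rlInt_congr fun s hs => h.eq (N + 1) s hs.1
      · exact integrableOn_kernel_mul_of_bounded hβ aestronglyMeasurable_const (C := ‖c (N + 1)‖)
          fun _ _ => le_rfl
      · obtain ⟨C', hC'⟩ := rlInt_bounded hα (h.bounded (N + 1 + 1)) t
        refine integrableOn_kernel_mul_of_bounded hβ ?_ hC'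
        have : ContinuousOn (rlInt α (G (N + 1 + 1))) (Ioi 0) := by
          refine ((continuousOn_const (c := c (N + 1))).sub (h.continuousOn (N + 1))).congr
            fun s hs => ?_
          simp only [Pi.sub_apply]
          rw [h.eq (N + 1) s hs]
          ring
        exact aestronglyMeasurable_Ioo this t
    rw [e1, rlInt_const hβ ht, rlInt_rlInt hβ hα hm
      (integrableOn_kernel_mul_of_bounded (by positivity) hm hC)]
    have e2 : α * ((N : ℝ) + 1) + α = α * (((N + 1 : ℕ) : ℝ) + 1) := by push_cast; ring
    rw [e2]
    push_cast
    ring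

lemma tendsto (h : VolterraSeq α c G) (hα : 0 < α) : Tendsto (G 0) (𝓝[>] 0) (𝓝 (c 0)) := by
  have := (tendsto_const_nhds (x := c 0)).sub (tendsto_rlInt hα (h.bounded 1))
  rw [sub_zero] at this
  refine this.congr' ?_
  filter_upwards [self_mem_nhdsWithin] with t ht
  exact (h.eq 0 t ht).symm

end VolterraSeq

/-- Differentiating on `(0, ∞)` along a chain of derivatives. -/
lemma contDiffOn_of_hasDerivAt_chain {F : ℕ → ℝ → ℂ} (M : ℕ)
    (hF : ∀ m < M, ∀ t, 0 < t → HasDerivAt (F m) (F (m + 1) t) t)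
    (hc : ContinuousOn (F M) (Ioi 0)) :
    ContDiffOn ℝ M (F 0) (Ioi 0) ∧ EqOn (iteratedDeriv M (F 0)) (F M) (Ioi 0) := by
  induction M generalizing F with
  | zero => exact ⟨contDiffOn_zero.2 hc, fun t _ => by simp⟩
  | succ M ih =>
    obtain ⟨h1, h2⟩ := ih (F := fun m => F (m + 1)) (fun m hm => hF (m + 1) (by omega)) hc
    have hd : EqOn (deriv (F 0)) (F 1) (Ioi 0) := fun t ht => (hF 0 (by omega) t ht).deriv
    constructor
    · push_cast
      rw [contDiffOn_succ_iff_deriv_of_isOpen isOpen_Ioi]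
      refine ⟨fun t ht => (hF 0 (by omega) t ht).differentiableAt.differentiableWithinAt, by simp,
        h1.congr hd⟩
    · intro t ht
      rw [iteratedDeriv_succ', ← h2 ht]
      exact (hd.eventuallyEq_of_mem (Ioi_mem_nhds ht)).iteratedDeriv_eq M

namespace VolterraSeq

variable {α : ℝ} {c : ℕ → ℂ} {G : ℕ → ℝ → ℂ}

/-- The expansion of the `m`-th derivative of the first function of the hierarchy. -/
noncomputable def expansion (α : ℝ) (c : ℕ → ℂ) (G : ℕ → ℝ → ℂ) (N m : ℕ) (t : ℝ) : ℂ :=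
  ∑ j ∈ Finset.range (N + 1), (-1) ^ j * c j * powGamma (α * j - m) t +
      (-1) ^ (N + 1) * rlInt (α * (N + 1) - m) (G (N + 1)) t

/-- The powers t^{αj} are smooth away from 0, and N is so large that the remainder still has order
at least 1 after m differentiations, each lowering the order by one. -/
lemma contDiffOn_expansion (h : VolterraSeq α c G) {N m : ℕ} (hN : (m : ℝ) + 1 ≤ α * (N + 1)) :
    ContDiffOn ℝ m (G 0) (Ioi 0) ∧
      EqOn (iteratedDeriv m (G 0)) (expansion α c G N m) (Ioi 0) := by
  have hα : 0 < α := by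
    by_contra hα
    have : α * ((N : ℝ) + 1) ≤ 0 := mul_nonpos_of_nonpos_of_nonneg (by linarith) (by positivity)
    have : (0 : ℝ) ≤ m := by positivity
    linarith
  have h0 : EqOn (G 0) (expansion α c G N 0) (Ioi 0) := fun t ht => by
    rw [h.iterate hα N ht, expansion]
    simp
  suffices h12 : ContDiffOn ℝ m (expansion α c G N 0) (Ioi 0) ∧
      EqOn (iteratedDeriv m (expansion α c G N 0)) (expansion α c G N m) (Ioi 0) by
    refine ⟨h12.1.congr h0, fun t ht => ?_⟩
    rw [← h12.2 ht]
    exact (h0.eventuallyEq_of_mem (Ioi_mem_nhds ht)).iteratedDeriv_eq m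
  refine contDiffOn_of_hasDerivAt_chain (F := expansion α c G N) m ?_ ?_
  · intro k hk t ht
    have hk' : (k : ℝ) + 1 ≤ m := by exact_mod_cast hk
    unfold expansion
    refine HasDerivAt.add (HasDerivAt.fun_sum fun j _ => ?_) ?_
    · have := (hasDerivAt_powGamma (α * j - k) ht).const_mul ((-1) ^ j * c j)
      rw [sub_sub] at this
      push_cast
      exact this
    · have := (hasDerivAt_rlInt (β := α * (N + 1) - k) (by linarith) (h.continuousOn (N + 1))
        (h.bounded (N + 1)) ht).const_mul ((-1) ^ (N + 1))
      rw [sub_sub] at this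
      push_cast
      exact this
  · unfold expansion
    refine ContinuousOn.add (continuousOn_finsetSum _ fun j _ =>
      continuousOn_const.mul (continuousOn_powGamma _)) (continuousOn_const.mul ?_)
    exact continuousOn_rlInt (by linarith) (h.continuousOn _) (h.bounded _)

/-- The only possibly non-integrable power is t^{-m} from j = 0, and it is absent because m
derivatives kill a constant: `powGamma` (-m) = 0. For j ≥ 1 the exponent αj - m exceeds -1, as m < α
+ 1. -/
lemma integrableOn_kernel_mul_expansion (h : VolterraSeq α c G) {N m : ℕ} (hm0 : 0 < m)
    (hmα : (m : ℝ) < α + 1) (hN : (m : ℝ) + 1 ≤ α * (N + 1)) {γ : ℝ} (hγ : 0 < γ) {t : ℝ} (ht : 0 < t) :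
    IntegrableOn (fun s => (((t - s) ^ (γ - 1) : ℝ) : ℂ) * expansion α c G N m s) (Ioo 0 t) ∧
    rlInt γ (expansion α c G N m) t =
      ∑ j ∈ Finset.range (N + 1), (-1) ^ j * c j * (if j = 0 then 0 else powGamma (γ + (α * j - m)) t) +
      (-1) ^ (N + 1) * rlInt (γ + (α * (N + 1) - m)) (G (N + 1)) t := by
  have hα : 0 < α := by
    have : (1 : ℝ) ≤ m := by exact_mod_cast hm0
    linarith
  have hz : ∀ s, powGamma (α * (0 : ℕ) - m) s = 0 := fun s => by
    obtain ⟨k, rfl⟩ := Nat.exists_eq_succ_of_ne_zero hm0.ne'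
    rw [Nat.cast_zero, mul_zero, zero_sub, Nat.cast_succ, powGamma_neg_nat]
  have hj : ∀ j : ℕ, j ≠ 0 → -1 < α * j - m := fun j hj => by
    have : (1 : ℝ) ≤ j := by exact_mod_cast Nat.one_le_iff_ne_zero.2 hj
    nlinarith
  have hi : ∀ j ∈ Finset.range (N + 1), IntegrableOn (fun s => (((t - s) ^ (γ - 1) : ℝ) : ℂ) *
      ((-1) ^ j * c j * powGamma (α * j - m) s)) (Ioo 0 t) := by
    intro j _
    rcases eq_or_ne j 0 with rfl | h0
    · simp only [hz, mul_zero]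
      exact integrableOn_zero
    · refine ((integrableOn_kernel_mul_powGamma hγ (hj j h0) ht).const_mul ((-1) ^ j * c j)).congr
        (.of_forall fun s => ?_)
      simp only
      ring
  have hs : IntegrableOn (fun s => (((t - s) ^ (γ - 1) : ℝ) : ℂ) *
      ∑ j ∈ Finset.range (N + 1), (-1) ^ j * c j * powGamma (α * j - m) s) (Ioo 0 t) := by
    simp only [Finset.mul_sum]
    exact integrable_finsetSum _ hi
  have hcb := aestronglyMeasurable_Ioo (continuousOn_rlInt (β := α * (N + 1) - m) (by linarith)
    (h.continuousOn (N + 1)) (h.bounded (N + 1))) t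
  obtain ⟨C, hC⟩ := rlInt_bounded (β := α * (N + 1) - m) (by linarith) (h.bounded (N + 1)) t
  have hr0 := integrableOn_kernel_mul_of_bounded hγ hcb hC
  have hr : IntegrableOn (fun s => (((t - s) ^ (γ - 1) : ℝ) : ℂ) *
      ((-1) ^ (N + 1) * rlInt (α * (N + 1) - m) (G (N + 1)) s)) (Ioo 0 t) := by
    refine (hr0.const_mul ((-1) ^ (N + 1))).congr (.of_forall fun s => ?_)
    simp only
    ring
  constructor
  · refine (hs.add hr).congr (.of_forall fun s => ?_)
    simp only [Pi.add_apply, expansion]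
    rw [← mul_add]
  · have e : rlInt γ (expansion α c G N m) t = _ := rlInt_add hs hr
    rw [e, rlInt_sum _ hi, rlInt_const_mul]
    obtain ⟨C', hC'⟩ := h.bounded (N + 1) t
    rw [rlInt_rlInt hγ (by linarith) (aestronglyMeasurable_Ioo (h.continuousOn _) t)
      (integrableOn_kernel_mul_of_bounded (by linarith)
        (aestronglyMeasurable_Ioo (h.continuousOn _) t) hC')]
    congr 1
    refine Finset.sum_congr rfl fun j _ => ?_
    rw [rlInt_const_mul]
    split_ifs with h0
    · subst h0
      have : rlInt γ (powGamma (α * (0 : ℕ) - m)) t = 0 := by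
        rw [funext hz]; simp [rlInt]
      rw [this]
    · rw [rlInt_powGamma hγ (hj j h0) ht]

lemma exists_large (hα : 0 < α) (x : ℝ) : ∃ N : ℕ, x ≤ α * (((N + 1 : ℕ) : ℝ) + 1) := by
  obtain ⟨N, hN⟩ := exists_nat_ge (x / α)
  refine ⟨N, ?_⟩
  rw [div_le_iff₀ hα] at hN
  push_cast
  nlinarith

/-- Lowering every order by α and dropping the constant term turns the expansion of G₀ into minus
the expansion of G₁, by shifting the index j by one. -/
lemma neg_expansion_eq (h : VolterraSeq α c G) (hα : 0 < α) (N : ℕ) {t : ℝ} (ht : 0 < t) :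
    ∑ j ∈ Finset.range (N + 1 + 1), (-1) ^ j * c j *
        (if j = 0 then 0 else powGamma (α * j - α) t) +
      (-1) ^ (N + 1 + 1) * rlInt (α * (((N + 1 : ℕ) : ℝ) + 1) - α) (G (N + 1 + 1)) t = -G 1 t := by
  have h1 := (h.shift 1).iterate hα N ht
  simp only [zero_add] at h1
  rw [h1, Finset.sum_range_succ', neg_add, ← Finset.sum_neg_distrib]
  simp only [if_true, mul_zero, add_zero, Nat.add_eq_zero_iff, one_ne_zero, and_false, if_false]
  congr 1
  · refine Finset.sum_congr rfl fun j _ => ?_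
    rw [show α * ((j + 1 : ℕ) : ℝ) - α = α * j by push_cast; ring, pow_succ]
    ring
  · rw [show α * (((N + 1 : ℕ) : ℝ) + 1) - α = α * (N + 1) by push_cast; ring, pow_succ]
    ring

/-- Solutions of the hierarchy of Volterra equations solve the Caputo equation. -/
lemma caputo (h : VolterraSeq α c G) (hα : 0 < α) :
    CaputoDifferentiable α (G 0) ∧ ∀ t, 0 < t → caputoDeriv α (G 0) t = -G 1 t := by
  set m := ⌈α⌉₊ with hm
  have hm0 : 0 < m := Nat.ceil_pos.2 hα
  have hm1 : (m : ℝ) < α + 1 := Nat.ceil_lt_add_one hα.le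
  have hm2 : α ≤ m := Nat.le_ceil α
  -- Expansions are used with N + 1 in place of N, so that after the shift one step remains for
  -- iterating from G₁.
  obtain ⟨N, hN⟩ := exists_large hα ((m : ℝ) + 1)
  obtain ⟨h1, h2⟩ := h.contDiffOn_expansion hN
  have hK := fun (hne : α ≠ m) (t : ℝ) (ht : 0 < t) => h.integrableOn_kernel_mul_expansion hm0 hm1 hN
    (γ := m - α) (sub_pos.2 (lt_of_le_of_ne hm2 hne)) ht
  have hke : ∀ t s : ℝ, (t - s) ^ ((m : ℝ) - 1 - α) = (t - s) ^ ((m : ℝ) - α - 1) := fun t s => by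
    rw [sub_right_comm]
  have hint : ∀ t, EqOn (caputoIntegrand α (G 0) t) (fun s => (((t - s) ^ ((m : ℝ) - α - 1) : ℝ) : ℂ) *
      expansion α c G (N + 1) m s) (Ioo 0 t) := fun t s hs => by
    simp only [caputoIntegrand]
    rw [← hm, hke, h2 hs.1]
  refine ⟨⟨h1, fun hne t ht => (hK hne t ht).1.congr_fun (hint t).symm measurableSet_Ioo⟩,
    fun t ht => ?_⟩
  unfold caputoDeriv
  rw [← hm]
  split_ifs with hi
  · rw [h2 ht, expansion, ← hi, ← h.neg_expansion_eq hα N ht]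
    congr 1
    refine Finset.sum_congr rfl fun j _ => ?_
    split_ifs with h0
    · subst h0
      obtain ⟨k, hk⟩ := Nat.exists_eq_succ_of_ne_zero hm0.ne'
      rw [hi, hk, Nat.cast_zero, mul_zero, zero_sub, Nat.cast_succ, powGamma_neg_nat]
    · rfl
  · have e1 := (hK hi t ht).2
    rw [rlInt] at e1
    rw [setIntegral_congr_fun measurableSet_Ioo (hint t), e1, ← h.neg_expansion_eq hα N ht]
    congr 1
    · refine Finset.sum_congr rfl fun j _ => ?_
      rw [show (m : ℝ) - α + (α * j - m) = α * j - α by ring]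
    · rw [show (m : ℝ) - α + (α * (((N + 1 : ℕ) : ℝ) + 1) - m) =
        α * (((N + 1 : ℕ) : ℝ) + 1) - α by ring]

/-- In the differentiated expansion the constant has gone, and every remaining power αj - 1, j ≥ 1,
is positive because α > 1. -/
lemma tendsto_deriv (h : VolterraSeq α c G) (hα : 1 < α) :
    Tendsto (deriv (G 0)) (𝓝[>] 0) (𝓝 0) := by
  obtain ⟨N, hN⟩ := exists_large (by linarith : 0 < α) (((1 : ℕ) : ℝ) + 1)
  have h2 := (h.contDiffOn_expansion hN).2
  rw [iteratedDeriv_one] at h2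
  have h3 : Tendsto (expansion α c G (N + 1) 1) (𝓝[>] 0) (𝓝 0) := by
    have h4 : Tendsto (fun t => ∑ j ∈ Finset.range (N + 1 + 1),
        (-1) ^ j * c j * powGamma (α * j - (1 : ℕ)) t) (𝓝[>] 0) (𝓝 0) := by
      rw [show (0 : ℂ) = ∑ j ∈ Finset.range (N + 1 + 1), 0 by simp]
      refine tendsto_finsetSum _ fun j _ => ?_
      rcases eq_or_ne j 0 with rfl | h0
      · have := fun t => powGamma_neg_nat 0 t
        simp only [Nat.cast_zero, zero_add] at this
        simp [this]
      · have : (1 : ℝ) ≤ j := by exact_mod_cast Nat.one_le_iff_ne_zero.2 h0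
        have := (tendsto_powGamma (b := α * j - (1 : ℕ)) (by push_cast; nlinarith)).const_mul
          ((-1) ^ j * c j)
        rwa [mul_zero] at this
    have h5 := (tendsto_rlInt (β := α * (((N + 1 : ℕ) : ℝ) + 1) - (1 : ℕ)) (by linarith)
      (h.bounded (N + 1 + 1))).const_mul ((-1) ^ (N + 1 + 1))
    have := h4.add h5
    rw [mul_zero, add_zero] at this
    exact this
  refine h3.congr' ?_
  filter_upwards [self_mem_nhdsWithin] with t ht
  exact (h2 ht).symm

end VolterraSeq

/-! ### From the Caputo equation to the Volterra equation -/

lemma bounded_Ioo_of_tendsto {g : ℝ → ℂ} {c : ℂ} (hc : ContinuousOn g (Ioi 0))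
    (h : Tendsto g (𝓝[>] 0) (𝓝 c)) (t : ℝ) : ∃ C, ∀ s ∈ Ioo 0 t, ‖g s‖ ≤ C := by
  have h1 : ∀ᶠ s in 𝓝[>] (0 : ℝ), ‖g s‖ < ‖c‖ + 1 := h.norm.eventually_lt_const (lt_add_one _)
  obtain ⟨δ, hδ, hs⟩ := mem_nhdsGT_iff_exists_Ioo_subset.1 h1
  obtain ⟨C, hC⟩ := isCompact_Icc.exists_bound_of_continuousOn (s := Icc δ t)
    (hc.mono fun s h => lt_of_lt_of_le hδ h.1)
  refine ⟨max (‖c‖ + 1) C, fun s h => ?_⟩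
  rcases lt_or_ge s δ with h2 | h2
  · exact le_max_of_le_left (hs ⟨h.1, h2⟩).le
  · exact le_max_of_le_right (hC s ⟨h2, h.2.le⟩)

lemma ContDiffOn.continuousOn_iteratedDeriv_Ioi {m : ℕ} {f : ℝ → ℂ}
    (hf : ContDiffOn ℝ m f (Ioi 0)) : ContinuousOn (iteratedDeriv m f) (Ioi 0) :=
  (hf.continuousOn_iteratedDerivWithin le_rfl isOpen_Ioi.uniqueDiffOn).congr
    fun _ ht => (iteratedDerivWithin_of_isOpen isOpen_Ioi ht).symm

lemma rlInt_one_deriv {f : ℝ → ℂ} {c : ℂ} (hf : ContDiffOn ℝ 1 f (Ioi 0))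
    (h0 : Tendsto f (𝓝[>] 0) (𝓝 c)) {t : ℝ} (ht : 0 < t) (hi : IntegrableOn (deriv f) (Ioo 0 t)) :
    rlInt 1 (deriv f) t = f t - c := by
  have hd : ∀ s, 0 < s → HasDerivAt f (deriv f s) s := fun s hs =>
    ((hf.differentiableOn one_ne_zero).differentiableAt (Ioi_mem_nhds hs)).hasDerivAt
  rw [rlInt_one, ← integral_Ioc_eq_integral_Ioo, ← intervalIntegral.integral_of_le ht.le]
  refine intervalIntegral.integral_eq_sub_of_hasDerivAt_of_tendsto ht (fun s hs => hd s hs.1) ?_ h0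
    ((hd t ht).continuousAt.tendsto.mono_left nhdsWithin_le_nhds)
  rw [intervalIntegrable_iff_integrableOn_Ioo_of_le ht.le]
  exact hi

lemma rlInt_two_deriv {f : ℝ → ℂ} {c : ℂ} (hf : ContDiffOn ℝ 2 f (Ioi 0))
    (h0 : Tendsto f (𝓝[>] 0) (𝓝 c)) (h1 : Tendsto (deriv f) (𝓝[>] 0) (𝓝 0)) {t : ℝ} (ht : 0 < t)
    (hi : ∀ s, 0 < s → IntegrableOn (deriv (deriv f)) (Ioo 0 s))
    (hm : AEStronglyMeasurable (deriv (deriv f)) (volume.restrict (Ioo 0 t))) :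
    rlInt 2 (deriv (deriv f)) t = f t - c := by
  have hf' : ContDiffOn ℝ 1 (deriv f) (Ioi 0) := by
    have : ContDiffOn ℝ (1 + 1) f (Ioi 0) := by rwa [one_add_one_eq_two]
    exact ((contDiffOn_succ_iff_deriv_of_isOpen isOpen_Ioi).1 this).2.2
  have e := rlInt_rlInt one_pos one_pos hm (integrableOn_kernel_mul_of_one_le (by norm_num) (hi t ht))
  rw [one_add_one_eq_two] at e
  rw [← e, ← rlInt_one_deriv (hf.of_le one_le_two) h0 ht
    (integrableOn_Ioo_of_bounded hf'.continuousOn (bounded_Ioo_of_tendsto hf'.continuousOn h1) t)]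
  refine rlInt_congr fun s hs => ?_
  rw [rlInt_one_deriv hf' h1 hs.1 (hi s hs.1), sub_zero]

/-- With m = ⌈α⌉, I^m f^{(m)} = I^α (I^{m-α} f^{(m)}) = -I^α g by the semigroup property, while the
initial values make I^m f^{(m)} equal to f - c. Only m = 1 and m = 2 occur. -/
lemma volterra_of_caputo {α : ℝ} (hα0 : 0 < α) (hα2 : α ≤ 2) {f g : ℝ → ℂ} {c : ℂ}
    (hf : CaputoDifferentiable α f) (heq : ∀ t, 0 < t → caputoDeriv α f t = -g t)
    (hgc : ContinuousOn g (Ioi 0)) (hgb : ∀ t, ∃ C, ∀ s ∈ Ioo 0 t, ‖g s‖ ≤ C)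
    (h0 : Tendsto f (𝓝[>] 0) (𝓝 c)) (h1 : 1 < α → Tendsto (deriv f) (𝓝[>] 0) (𝓝 0))
    {t : ℝ} (ht : 0 < t) : f t = c - rlInt α g t := by
  obtain ⟨hd, hint⟩ := hf
  unfold caputoDeriv at heq
  unfold caputoIntegrand at hint heq
  set m := ⌈α⌉₊ with hm
  have hm0 : 0 < m := Nat.ceil_pos.2 hα0
  have hm1 : (m : ℝ) < α + 1 := Nat.ceil_lt_add_one hα0.le
  have hm2 : α ≤ m := Nat.le_ceil α
  have hc := hd.continuousOn_iteratedDeriv_Ioi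
  have hmeas := fun t => aestronglyMeasurable_Ioo hc t
  have hke : ∀ t s : ℝ, (t - s) ^ ((m : ℝ) - 1 - α) = (t - s) ^ ((m : ℝ) - α - 1) := fun t s => by
    rw [sub_right_comm]
  simp only [hke] at hint heq
  -- Integrability up to 0 is not assumed. For α = m it follows from f^{(m)} = -g with g bounded;
  -- otherwise the Caputo kernel is at least t^{m-α-1} > 0 on (0, t) and can be divided out.
  have hi : ∀ t, 0 < t → IntegrableOn (iteratedDeriv m f) (Ioo 0 t) := by
    intro t ht
    by_cases hαm : α = m
    · refine (integrableOn_Ioo_of_bounded hgc hgb t).neg.congr_fun (fun s hs => ?_) measurableSet_Ioo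
      have := heq s hs.1
      rw [if_pos hαm] at this
      rw [this]
      rfl
    · have hlt : α < m := lt_of_le_of_ne hm2 hαm
      refine ((hint hαm t ht).norm.const_mul ((t ^ ((m : ℝ) - α - 1))⁻¹)).mono' (hmeas t) ?_
      refine (ae_restrict_iff' measurableSet_Ioo).2 (.of_forall fun s hs => ?_)
      have h3 : 0 < t - s := sub_pos.2 hs.2
      have h2 : t ^ ((m : ℝ) - α - 1) ≤ (t - s) ^ ((m : ℝ) - α - 1) :=
        Real.rpow_le_rpow_of_nonpos h3 (by linarith [hs.1]) (by linarith)
      have h4 : 0 < t ^ ((m : ℝ) - α - 1) := Real.rpow_pos_of_pos ht _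
      rw [norm_mul, Complex.norm_real, Real.norm_of_nonneg (by positivity), ← mul_assoc]
      refine le_mul_of_one_le_left (norm_nonneg _) ?_
      rw [inv_mul_eq_div, one_le_div h4]
      exact h2
  have key : rlInt m (iteratedDeriv m f) t = -rlInt α g t := by
    have hneg : -rlInt α g t = rlInt α (fun s => -1 * g s) t := by
      rw [rlInt_const_mul]
      ring
    rw [hneg]
    by_cases hαm : α = m
    · rw [← hαm]
      refine rlInt_congr fun s hs => ?_
      have := heq s hs.1
      rw [if_pos hαm] at this
      rw [this]
      ring
    · have hlt : 0 < m - α := sub_pos.2 (lt_of_le_of_ne hm2 hαm)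
      have e := rlInt_rlInt hα0 hlt (hmeas t) (by
        rw [add_sub_cancel]
        exact integrableOn_kernel_mul_of_one_le (by exact_mod_cast hm0) (hi t ht))
      rw [add_sub_cancel] at e
      rw [← e]
      refine rlInt_congr fun s hs => ?_
      have := heq s hs.1
      rw [if_neg hαm] at this
      rw [rlInt, this]
      ring
  have hmle : m ≤ 2 := Nat.ceil_le.2 (by exact_mod_cast hα2)
  clear_value m
  suffices h : rlInt m (iteratedDeriv m f) t = f t - c by
    rw [h] at key
    linear_combination key
  interval_cases m
  · rw [iteratedDeriv_one] at hi ⊢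
    rw [Nat.cast_one]
    exact rlInt_one_deriv (by exact_mod_cast hd) h0 ht (hi t ht)
  · rw [iteratedDeriv_succ, iteratedDeriv_one] at hi hmeas ⊢
    rw [Nat.cast_ofNat]
    refine rlInt_two_deriv (by exact_mod_cast hd) h0 (h1 ?_) ht hi (hmeas t)
    push_cast at hm1
    linarith

/-! ### The action of the spatial operator on the Fourier side -/

lemma hasTemperateGrowth_const_mul_pow (c : ℂ) (n : ℕ) :
    Function.HasTemperateGrowth fun k : ℝ => c * (k : ℂ) ^ n := by
  have : Function.HasTemperateGrowth fun k : ℝ => (k : ℂ) :=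
    Complex.ofRealCLM.hasTemperateGrowth
  fun_prop

/-- Multiplication by `4 π⁴ k⁴`, the symbol of `∂⁴ / 4`. -/
noncomputable def symbolCLM : 𝓢(ℝ, ℂ) →L[ℂ] 𝓢(ℝ, ℂ) :=
  SchwartzMap.smulLeftCLM ℂ fun k : ℝ => 4 * (Real.pi : ℂ) ^ 4 * (k : ℂ) ^ 4

lemma symbolCLM_apply (ψ : 𝓢(ℝ, ℂ)) (k : ℝ) :
    symbolCLM ψ k = ((4 * Real.pi ^ 4 * k ^ 4 : ℝ) : ℂ) * ψ k := by
  rw [symbolCLM, SchwartzMap.smulLeftCLM_apply_apply (hasTemperateGrowth_const_mul_pow _ _),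
    smul_eq_mul]
  push_cast
  ring

lemma iterate_symbolCLM_apply (n : ℕ) (ψ : 𝓢(ℝ, ℂ)) (k : ℝ) :
    symbolCLM^[n] ψ k = ((4 * Real.pi ^ 4 * k ^ 4 : ℝ) : ℂ) ^ n * ψ k := by
  induction n generalizing ψ with
  | zero => simp
  | succ n ih =>
    rw [Function.iterate_succ_apply, ih, symbolCLM_apply, pow_succ]
    ring

lemma derivCLM_fourier (ψ : 𝓢(ℝ, ℂ)) :
    SchwartzMap.derivCLM ℂ ℂ (𝓕 ψ) =
      𝓕 (SchwartzMap.smulLeftCLM ℂ (fun k : ℝ => (-2 * Real.pi * Complex.I : ℂ) * (k : ℂ) ^ 1) ψ) := by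
  ext x
  rw [SchwartzMap.derivCLM_apply, SchwartzMap.fourier_coe, SchwartzMap.fourier_coe,
    Real.deriv_fourier ψ.integrable]
  · refine congrArg (fun f : ℝ → ℂ => 𝓕 f x) (funext fun k => ?_)
    rw [SchwartzMap.smulLeftCLM_apply_apply (hasTemperateGrowth_const_mul_pow _ _), pow_one]
  · have := (SchwartzMap.smulLeftCLM ℂ (fun k : ℝ => (1 : ℂ) * (k : ℂ) ^ 1) ψ).integrable
      (μ := volume)
    refine this.congr (.of_forall fun k => ?_)
    simp only
    rw [SchwartzMap.smulLeftCLM_apply_apply (hasTemperateGrowth_const_mul_pow _ _), pow_one, one_mul]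
    simp

/-- Every pairing is written as T(𝓕 ψ), so that ∂ acts on ψ as multiplication by 2πik, and (2πik)⁴ =
16π⁴k⁴ is four times the symbol. -/
lemma iterate_derivCLM_fourier (T : 𝓢'(ℝ, ℂ)) (ψ : 𝓢(ℝ, ℂ)) :
    ((TemperedDistribution.derivCLM ℂ)^[4] T) (𝓕 ψ) = 4 * T (𝓕 (symbolCLM ψ)) := by
  have h : ∀ (S : 𝓢'(ℝ, ℂ)) (χ : 𝓢(ℝ, ℂ)), TemperedDistribution.derivCLM ℂ S (𝓕 χ) =
      S (𝓕 (SchwartzMap.smulLeftCLM ℂ (fun k : ℝ => (2 * Real.pi * Complex.I : ℂ) * (k : ℂ) ^ 1) χ)) := by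
    intro S χ
    rw [TemperedDistribution.derivCLM_apply_apply, derivCLM_fourier,
      ← FourierTransform.fourier_neg]
    congr 2
    ext k
    rw [neg_apply, SchwartzMap.smulLeftCLM_apply_apply (hasTemperateGrowth_const_mul_pow _ _),
      SchwartzMap.smulLeftCLM_apply_apply (hasTemperateGrowth_const_mul_pow _ _)]
    simp
  rw [Function.iterate_succ_apply', Function.iterate_succ_apply', Function.iterate_succ_apply',
    Function.iterate_one, h, h, h, h]
  have : (4 : ℂ) * T (𝓕 (symbolCLM ψ)) = T (𝓕 ((4 : ℂ) • symbolCLM ψ)) := by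
    rw [FourierTransform.fourier_smul, map_smul, smul_eq_mul]
  rw [this]
  congr 2
  ext k
  rw [smul_apply, symbolCLM_apply]
  iterate 4 rw [SchwartzMap.smulLeftCLM_apply_apply (hasTemperateGrowth_const_mul_pow _ _)]
  simp only [smul_eq_mul, pow_one]
  push_cast
  linear_combination (16 * (Real.pi : ℂ) ^ 4 * k ^ 4 * ψ k) * Complex.I_pow_four

/-! ### Existence of the fundamental solution -/

/-- The Fourier multiplier of the fundamental solution, extended evenly to negative times. -/
noncomputable def rodMultiplier (ν t k : ℝ) : ℂ :=
  ((mittagLeffler (2 * ν) (-(4 * Real.pi ^ 4 * k ^ 4 * |t| ^ (2 * ν))) : ℝ) : ℂ)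

lemma continuous_rodMultiplier {ν : ℝ} (hν : 0 < ν) :
    Continuous fun p : ℝ × ℝ => rodMultiplier ν p.1 p.2 := by
  have h : Continuous fun p : ℝ × ℝ => |p.1| ^ (2 * ν) :=
    continuous_fst.abs.rpow_const fun _ => Or.inr (by positivity)
  exact Complex.continuous_ofReal.comp ((continuous_mittagLeffler (by positivity)).comp (by fun_prop))

lemma continuous_rodMultiplier_right {ν : ℝ} (hν : 0 < ν) (t : ℝ) :
    Continuous (rodMultiplier ν t) := by
  unfold rodMultiplier
  exact Complex.continuous_ofReal.comp ((continuous_mittagLeffler (by positivity)).comp (by fun_prop))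

lemma exists_norm_rodMultiplier_le {ν : ℝ} (hν0 : 0 < ν) (hν1 : ν ≤ 1) :
    ∃ C : ℝ, ∀ t k : ℝ, ‖rodMultiplier ν t k‖ ≤ C := by
  obtain ⟨C, hC⟩ := exists_abs_mittagLeffler_le hν0 hν1
  refine ⟨C, fun t k => ?_⟩
  rw [rodMultiplier, Complex.norm_real]
  exact hC _ (by positivity)

/-- A bounded continuous multiplier is an L^∞ function, hence a tempered distribution; T t is its
inverse Fourier transform. -/
lemma exists_rodDistribution {ν : ℝ} (hν0 : 0 < ν) (hν1 : ν ≤ 1) :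
    ∃ T : ℝ → 𝓢'(ℝ, ℂ), ∀ t, ∀ ψ : 𝓢(ℝ, ℂ), T t (𝓕 ψ) = ∫ k, rodMultiplier ν t k * ψ k := by
  obtain ⟨C, hC⟩ := exists_norm_rodMultiplier_le hν0 hν1
  have hmem : ∀ t, MemLp (rodMultiplier ν t) ⊤ := fun t =>
    memLp_top_of_bound (continuous_rodMultiplier_right hν0 t).aestronglyMeasurable C
      (.of_forall (hC t))
  refine ⟨fun t => 𝓕⁻ (Lp.toTemperedDistribution (hmem t).toLp), fun t ψ => ?_⟩
  rw [TemperedDistribution.fourierInv_apply, FourierTransform.fourierInv_fourier_eq,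
    Lp.toTemperedDistribution_apply]
  refine integral_congr_ae ?_
  filter_upwards [(hmem t).coeFn_toLp] with k hk
  rw [hk, smul_eq_mul, mul_comm]

/-- The scalar Volterra equation at each frequency is integrated against ψ; Fubini moves the
k-integral inside the fractional integral, where λψ appears. -/
lemma integral_rodMultiplier_mul_eq {ν : ℝ} (hν0 : 0 < ν) (hν1 : ν ≤ 1) (ψ : 𝓢(ℝ, ℂ)) {t : ℝ}
    (ht : 0 < t) : ∫ k, rodMultiplier ν t k * ψ k =
      (∫ k, ψ k) - rlInt (2 * ν) (fun s => ∫ k, rodMultiplier ν s k * symbolCLM ψ k) t := by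
  have hα : 0 < 2 * ν := by positivity
  obtain ⟨C, hC⟩ := exists_norm_rodMultiplier_le hν0 hν1
  have hcont := continuous_rodMultiplier hν0
  set χ := symbolCLM ψ with hχ
  set κ : ℝ → ℂ := fun s => (((t - s) ^ (2 * ν - 1) : ℝ) : ℂ) with hκ
  have hint : Integrable (Function.uncurry fun s k => κ s * (rodMultiplier ν s k * χ k))
      ((volume.restrict (Ioo 0 t)).prod volume) := by
    have h1 : Integrable κ (volume.restrict (Ioo 0 t)) := (integrableOn_kernel hα ht).ofReal
    have h2 := h1.mul_prod (χ.integrable (μ := volume))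
    refine (h2.bdd_mul (c := C) hcont.aestronglyMeasurable (.of_forall fun p => hC _ _)).congr
      (.of_forall fun p => ?_)
    simp only [Function.uncurry]
    ring
  have hswap := integral_integral_swap hint
  have hvol : ∀ k, rodMultiplier ν t k = 1 - ((4 * Real.pi ^ 4 * k ^ 4 : ℝ) : ℂ) *
      rlInt (2 * ν) (fun s => rodMultiplier ν s k) t := by
    intro k
    have h := mittagLeffler_volterra hα (4 * Real.pi ^ 4 * k ^ 4) ht
    rw [rodMultiplier, abs_of_pos ht, h]
    congr 2
    refine rlInt_congr fun s hs => ?_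
    rw [rodMultiplier, abs_of_pos hs.1]
  have hk : ∀ k, rodMultiplier ν t k * ψ k = ψ k - ((Real.Gamma (2 * ν) : ℝ) : ℂ)⁻¹ *
      ∫ s in Ioo 0 t, κ s * (rodMultiplier ν s k * χ k) := by
    intro k
    have : ∫ s in Ioo 0 t, κ s * (rodMultiplier ν s k * χ k) =
        (∫ s in Ioo 0 t, κ s * rodMultiplier ν s k) * χ k := by
      rw [← integral_mul_const]
      simp only [mul_assoc]
    rw [hvol, this, rlInt, hχ, symbolCLM_apply]
    ring
  have hi2 : Integrable (fun k => ∫ s in Ioo 0 t, κ s * (rodMultiplier ν s k * χ k)) :=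
    hint.integral_prod_right
  simp only [hk]
  rw [integral_sub ψ.integrable (hi2.const_mul _), integral_const_mul, ← hswap, rlInt]
  simp only [integral_const_mul, hκ]

lemma volterraSeq_rodMultiplier {ν : ℝ} (hν0 : 0 < ν) (hν1 : ν ≤ 1) (ψ : 𝓢(ℝ, ℂ)) :
    VolterraSeq (2 * ν) (fun n => ∫ k, (symbolCLM^[n] ψ) k)
      (fun n t => ∫ k, rodMultiplier ν t k * (symbolCLM^[n] ψ) k) := by
  obtain ⟨C, hC⟩ := exists_norm_rodMultiplier_le hν0 hν1
  have hcont := continuous_rodMultiplier hν0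
  have hle : ∀ n t k, ‖rodMultiplier ν t k * (symbolCLM^[n] ψ) k‖ ≤ C * ‖(symbolCLM^[n] ψ) k‖ :=
    fun n t k => by
      rw [norm_mul]
      exact mul_le_mul_of_nonneg_right (hC t k) (norm_nonneg _)
  have hi : ∀ n, Integrable fun k => C * ‖(symbolCLM^[n] ψ) k‖ := fun n =>
    (symbolCLM^[n] ψ).integrable.norm.const_mul C
  refine ⟨fun n => (continuous_of_dominated (fun t => ?_) (fun t => .of_forall (hle n t)) (hi n)
    (.of_forall fun k => ?_)).continuousOn, fun n t => ⟨_, fun s _ =>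
    norm_integral_le_of_norm_le (hi n) (.of_forall (hle n s))⟩, fun n t ht => ?_⟩
  · exact ((hcont.comp (by fun_prop : Continuous fun k : ℝ => (t, k))).mul
      (symbolCLM^[n] ψ).continuous).aestronglyMeasurable
  · exact (hcont.comp (by fun_prop : Continuous fun t : ℝ => (t, k))).mul continuous_const
  · simp only [Function.iterate_succ_apply']
    exact integral_rodMultiplier_mul_eq hν0 hν1 _ ht

lemma fourier_apply_zero (ψ : 𝓢(ℝ, ℂ)) : (𝓕 ψ) 0 = ∫ k, ψ k := by
  rw [SchwartzMap.fourier_coe, Real.fourier_eq]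
  simp

lemma isRodFundamentalSolution_of_multiplier {ν : ℝ} (hν0 : 0 < ν) (hν1 : ν ≤ 1) {T : ℝ → 𝓢'(ℝ, ℂ)}
    (hT : ∀ t, ∀ ψ : 𝓢(ℝ, ℂ), T t (𝓕 ψ) = ∫ k, rodMultiplier ν t k * ψ k) :
    IsRodFundamentalSolution ν T := by
  have hα : 0 < 2 * ν := by positivity
  have hsurj : ∀ φ : 𝓢(ℝ, ℂ), ∃ ψ : 𝓢(ℝ, ℂ), 𝓕 ψ = φ := fun φ =>
    ⟨𝓕⁻ φ, FourierTransform.fourier_fourierInv_eq φ⟩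
  have hV := fun ψ => volterraSeq_rodMultiplier hν0 hν1 ψ
  refine ⟨fun φ => ?_, fun φ t ht => ?_, ?_, fun hν φ => ?_⟩
  · obtain ⟨ψ, rfl⟩ := hsurj φ
    simp only [hT]
    exact ((hV ψ).caputo hα).1
  · obtain ⟨ψ, rfl⟩ := hsurj φ
    rw [iterate_derivCLM_fourier]
    simp only [hT]
    have := ((hV ψ).caputo hα).2 t ht
    simp only [Function.iterate_zero_apply, Function.iterate_one] at this
    rw [this]
    ring
  · rw [PointwiseConvergenceCLM.tendsto_iff_forall_tendsto]
    intro φ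
    obtain ⟨ψ, rfl⟩ := hsurj φ
    rw [TemperedDistribution.delta_apply, fourier_apply_zero]
    simp only [hT]
    exact (hV ψ).tendsto hα
  · obtain ⟨ψ, rfl⟩ := hsurj φ
    simp only [hT]
    exact (hV ψ).tendsto_deriv (by linarith)

/-! ### Seminorms of Schwartz functions on the line -/

namespace SchwartzMap

/-- This drives the seminorm estimates below by induction on k: one derivative is passed to the
function and the product rule is applied. -/
lemma seminorm_succ_le (j k : ℕ) (φ : 𝓢(ℝ, ℂ)) :
    SchwartzMap.seminorm ℂ j (k + 1) φ ≤ SchwartzMap.seminorm ℂ j k (derivCLM ℂ ℂ φ) := by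
  refine seminorm_le_bound' ℂ j (k + 1) φ (apply_nonneg _ _) fun x => ?_
  rw [iteratedDeriv_succ']
  exact le_seminorm' ℂ j k (derivCLM ℂ ℂ φ) x

lemma seminorm_zero_le_of_forall {j : ℕ} {φ : 𝓢(ℝ, ℂ)} {M : ℝ} (hM : 0 ≤ M)
    (h : ∀ x, |x| ^ j * ‖φ x‖ ≤ M) : SchwartzMap.seminorm ℂ j 0 φ ≤ M :=
  seminorm_le_bound' ℂ j 0 φ hM fun x => by rw [iteratedDeriv_zero]; exact h x

lemma abs_pow_mul_norm_le (j : ℕ) (φ : 𝓢(ℝ, ℂ)) (x : ℝ) :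
    |x| ^ j * ‖φ x‖ ≤ SchwartzMap.seminorm ℂ j 0 φ := by
  have := le_seminorm' ℂ j 0 φ x
  rwa [iteratedDeriv_zero] at this

/-- The product of `φ` with the dilation `h (ε x)`. -/
noncomputable def mulDilation (h : 𝓢(ℝ, ℂ)) (ε : ℝ) (φ : 𝓢(ℝ, ℂ)) : 𝓢(ℝ, ℂ) :=
  smulLeftCLM ℂ (fun x : ℝ => h (ε * x)) φ

lemma mulDilation_apply (h : 𝓢(ℝ, ℂ)) (ε : ℝ) (φ : 𝓢(ℝ, ℂ)) (x : ℝ) :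
    mulDilation h ε φ x = h (ε * x) * φ x := by
  have : Function.HasTemperateGrowth fun x : ℝ => h (ε * x) :=
    h.hasTemperateGrowth.comp (f := fun x : ℝ => ε * x) (by fun_prop)
  rw [mulDilation, smulLeftCLM_apply_apply this, smul_eq_mul]

lemma derivCLM_mulDilation (h : 𝓢(ℝ, ℂ)) (ε : ℝ) (φ : 𝓢(ℝ, ℂ)) :
    derivCLM ℂ ℂ (mulDilation h ε φ) =
      mulDilation h ε (derivCLM ℂ ℂ φ) + (ε : ℂ) • mulDilation (derivCLM ℂ ℂ h) ε φ := by
  ext x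
  rw [derivCLM_apply, add_apply, smul_apply, mulDilation_apply, mulDilation_apply, derivCLM_apply,
    derivCLM_apply, funext (mulDilation_apply h ε φ)]
  have h1 : HasDerivAt (fun y : ℝ => h (ε * y)) (ε • deriv h (ε * x)) x := by
    have := (h.hasDerivAt (ε * x)).scomp x ((hasDerivAt_id x).const_mul ε)
    simpa [Function.comp_def] using this
  rw [(h1.fun_mul (φ.hasDerivAt x)).deriv]
  simp only [Complex.real_smul, smul_eq_mul]
  ring

lemma exists_seminorm_mulDilation_le (k : ℕ) : ∀ (h φ : 𝓢(ℝ, ℂ)) (j : ℕ), ∃ M : ℝ, ∀ ε : ℝ, |ε| ≤ 1 →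
    SchwartzMap.seminorm ℂ j k (mulDilation h ε φ) ≤ M := by
  induction k with
  | zero =>
    intro h φ j
    refine ⟨SchwartzMap.seminorm ℂ 0 0 h * SchwartzMap.seminorm ℂ j 0 φ, fun ε _ =>
      seminorm_zero_le_of_forall (by positivity) fun x => ?_⟩
    rw [mulDilation_apply, norm_mul, mul_left_comm]
    exact mul_le_mul (norm_le_seminorm ℂ h _) (abs_pow_mul_norm_le j φ x) (by positivity)
      (apply_nonneg _ _)
  | succ k ih =>
    intro h φ j
    obtain ⟨M₁, h₁⟩ := ih h (derivCLM ℂ ℂ φ) j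
    obtain ⟨M₂, h₂⟩ := ih (derivCLM ℂ ℂ h) φ j
    refine ⟨M₁ + M₂, fun ε hε => (seminorm_succ_le j k _).trans ?_⟩
    rw [derivCLM_mulDilation]
    refine (map_add_le_add _ _ _).trans (add_le_add (h₁ ε hε) ?_)
    rw [map_smul_eq_mul, Complex.norm_real]
    exact (mul_le_of_le_one_left (apply_nonneg _ _) hε).trans (h₂ ε hε)

lemma exists_norm_sub_le (h : 𝓢(ℝ, ℂ)) : ∃ L : ℝ, 0 ≤ L ∧ ∀ y, ‖h 0 - h y‖ ≤ L * |y| := by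
  refine ⟨SchwartzMap.seminorm ℂ 0 0 (derivCLM ℂ ℂ h), apply_nonneg _ _, fun y => ?_⟩
  have := Convex.norm_image_sub_le_of_norm_deriv_le (𝕜 := ℝ) (f := h) (s := univ) (x := y) (y := 0)
    (fun x _ => h.differentiableAt) (fun x _ => norm_le_seminorm ℂ (derivCLM ℂ ℂ h) x)
    convex_univ (mem_univ _) (mem_univ _)
  simpa using this

/-- At order 0, |1 - h(εx)| ≤ L|ε||x|, the extra |x| being absorbed by the next weight. A derivative
falling on the cutoff produces another factor ε. -/
lemma exists_seminorm_sub_mulDilation_le (k : ℕ) : ∀ (h φ : 𝓢(ℝ, ℂ)) (j : ℕ), h 0 = 1 →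
    ∃ M : ℝ, ∀ ε : ℝ, |ε| ≤ 1 →
      SchwartzMap.seminorm ℂ j k (φ - mulDilation h ε φ) ≤ M * |ε| := by
  induction k with
  | zero =>
    intro h φ j h0
    obtain ⟨L, hL0, hL⟩ := exists_norm_sub_le h
    refine ⟨L * SchwartzMap.seminorm ℂ (j + 1) 0 φ, fun ε _ =>
      seminorm_zero_le_of_forall (by positivity) fun x => ?_⟩
    have e : (φ - mulDilation h ε φ) x = (h 0 - h (ε * x)) * φ x := by
      rw [sub_apply, mulDilation_apply, h0]
      ring
    rw [e, norm_mul]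
    have h1 := hL (ε * x)
    have h2 := abs_pow_mul_norm_le (j + 1) φ x
    rw [abs_mul] at h1
    calc |x| ^ j * (‖h 0 - h (ε * x)‖ * ‖φ x‖) ≤ |x| ^ j * (L * (|ε| * |x|) * ‖φ x‖) := by gcongr
      _ = L * (|x| ^ (j + 1) * ‖φ x‖) * |ε| := by ring
      _ ≤ _ := by gcongr
  | succ k ih =>
    intro h φ j h0
    obtain ⟨M₁, h₁⟩ := ih h (derivCLM ℂ ℂ φ) j h0
    obtain ⟨M₂, h₂⟩ := exists_seminorm_mulDilation_le k (derivCLM ℂ ℂ h) φ j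
    refine ⟨M₁ + M₂, fun ε hε => (seminorm_succ_le j k _).trans ?_⟩
    rw [map_sub, derivCLM_mulDilation, ← sub_sub, add_mul]
    refine (map_sub_le_add _ _ _).trans (add_le_add (h₁ ε hε) ?_)
    rw [map_smul_eq_mul, Complex.norm_real, mul_comm]
    exact mul_le_mul_of_nonneg_right (h₂ ε hε) (abs_nonneg _)

lemma tendsto_mulDilation {h : 𝓢(ℝ, ℂ)} (h0 : h 0 = 1) (φ : 𝓢(ℝ, ℂ)) :
    Tendsto (fun n : ℕ => mulDilation h (1 / ((n : ℝ) + 1)) φ) atTop (𝓝 φ) := by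
  rw [(schwartz_withSeminorms ℂ ℝ ℂ).tendsto_nhds]
  rintro ⟨j, k⟩ δ hδ
  obtain ⟨M, hM⟩ := exists_seminorm_sub_mulDilation_le k h φ j h0
  have ht : Tendsto (fun n : ℕ => M * |1 / ((n : ℝ) + 1)|) atTop (𝓝 0) := by
    have := (tendsto_one_div_add_atTop_nhds_zero_nat (𝕜 := ℝ)).abs.const_mul M
    rwa [abs_zero, mul_zero] at this
  filter_upwards [ht.eventually_lt_const hδ] with n hn
  rw [schwartzSeminormFamily_apply, map_sub_rev]
  refine (hM _ ?_).trans_lt hn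
  have : (0 : ℝ) ≤ n := by positivity
  rw [abs_of_nonneg (by positivity)]
  exact div_le_one_of_le₀ (by linarith) (by positivity)

/-- A continuous functional that vanishes on compactly supported functions is zero. -/
lemma eq_zero_of_forall_compactSupport (D : 𝓢(ℝ, ℂ) →L[ℂ] ℂ)
    (hD : ∀ ψ : 𝓢(ℝ, ℂ), (∃ R, ∀ x, R < |x| → ψ x = 0) → D ψ = 0) (φ : 𝓢(ℝ, ℂ)) : D φ = 0 := by
  let b : ContDiffBump (0 : ℝ) := ⟨1, 2, one_pos, one_lt_two⟩
  have hs : HasCompactSupport fun x : ℝ => (b x : ℂ) :=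
    b.hasCompactSupport.comp_left (g := fun y : ℝ => (y : ℂ)) Complex.ofReal_zero
  let h : 𝓢(ℝ, ℂ) := hs.toSchwartzMap (Complex.ofRealCLM.contDiff.comp b.contDiff)
  have hb : ∀ x, h x = (b x : ℂ) := fun x => rfl
  have h0 : h 0 = 1 := by
    rw [hb, b.one_of_mem_closedBall (by simp [b])]
    simp
  have h1 := (D.continuous.tendsto φ).comp (tendsto_mulDilation h0 φ)
  refine tendsto_nhds_unique h1 ?_
  refine tendsto_const_nhds.congr fun n => ?_
  refine (hD _ ⟨2 * ((n : ℝ) + 1), fun x hx => ?_⟩).symm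
  have hn : (0 : ℝ) < n + 1 := by positivity
  rw [mulDilation_apply, hb, b.zero_of_le_dist, Complex.ofReal_zero, zero_mul]
  rw [dist_zero_right, Real.norm_eq_abs, abs_mul, abs_of_pos (by positivity), one_div_mul_eq_div,
    le_div_iff₀ hn]
  exact hx.le

/-! ### Uniform boundedness on bounded sequences of Schwartz functions -/

/-- The map a ↦ Σ aₙφₙ is continuous on ℓ¹ because the seminorms of the φₙ are bounded. It brings
questions on a bounded sequence of Schwartz functions into a Banach space, where Banach–Steinhaus is
available. -/
lemma exists_synthesis {φ : ℕ → 𝓢(ℝ, ℂ)}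
    (hφ : ∀ j k : ℕ, ∃ C : ℝ, ∀ n, SchwartzMap.seminorm ℂ j k (φ n) ≤ C) :
    ∃ Φ : lp (fun _ : ℕ => ℂ) 1 →L[ℂ] 𝓢(ℝ, ℂ), ∀ n, Φ (lp.single 1 n 1) = φ n := by
  choose C hC using hφ
  have hC0 : ∀ j k, 0 ≤ C j k := fun j k => (apply_nonneg _ _).trans (hC j k 0)
  have hsum : ∀ a : lp (fun _ : ℕ => ℂ) 1, Summable fun n => ‖a n‖ := fun a => by
    have := (lp.hasSum_norm (by simp) a).summable
    simpa using this
  have hnorm : ∀ a : lp (fun _ : ℕ => ℂ) 1, ‖a‖ = ∑' n, ‖a n‖ := fun a => by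
    simpa using lp.norm_eq_tsum_rpow (by simp) a
  have hb : ∀ (a : lp (fun _ : ℕ => ℂ) 1) (j k n : ℕ) (x : ℝ),
      ‖x‖ ^ j * ‖iteratedFDeriv ℝ k (⇑(a n • φ n)) x‖ ≤ ‖a n‖ * C j k := by
    intro a j k n x
    refine (le_seminorm ℂ j k (a n • φ n) x).trans ?_
    rw [map_smul_eq_mul]
    exact mul_le_mul_of_nonneg_left (hC j k n) (norm_nonneg _)
  have hb0 : ∀ (a : lp (fun _ : ℕ => ℂ) 1) (k n : ℕ) (x : ℝ),
      ‖iteratedFDeriv ℝ k (⇑(a n • φ n)) x‖ ≤ ‖a n‖ * C 0 k := fun a k n x => by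
    simpa using hb a 0 k n x
  have hbx : ∀ (a : lp (fun _ : ℕ => ℂ) 1) (x : ℝ), Summable fun n => (a n • φ n) x := fun a x =>
    Summable.of_norm_bounded ((hsum a).mul_right (C 0 0)) fun n => by
      simpa using hb0 a 0 n x
  have hcd : ∀ a : lp (fun _ : ℕ => ℂ) 1, ContDiff ℝ (⊤ : ℕ∞) fun x => ∑' n, (a n • φ n) x := fun a =>
    contDiff_tsum (fun n => (a n • φ n).smooth ⊤) (fun k _ => (hsum a).mul_right (C 0 k))
      (fun k n x _ => hb0 a k n x)
  have hdec : ∀ (a : lp (fun _ : ℕ => ℂ) 1) (j k : ℕ) (x : ℝ),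
      ‖x‖ ^ j * ‖iteratedFDeriv ℝ k (fun x => ∑' n, (a n • φ n) x) x‖ ≤ C j k * ‖a‖ := by
    intro a j k x
    rw [iteratedFDeriv_tsum_apply (N := ⊤) (fun n => (a n • φ n).smooth ⊤)
      (fun k _ => (hsum a).mul_right (C 0 k)) (fun k n x _ => hb0 a k n x) le_top x]
    have hs : Summable fun n => ‖iteratedFDeriv ℝ k (⇑(a n • φ n)) x‖ :=
      Summable.of_nonneg_of_le (fun _ => norm_nonneg _) (fun n => hb0 a k n x)
        ((hsum a).mul_right (C 0 k))
    refine (mul_le_mul_of_nonneg_left (norm_tsum_le_tsum_norm hs) (by positivity)).trans ?_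
    rw [← tsum_mul_left, hnorm, mul_comm, ← tsum_mul_right]
    exact (hs.mul_left _).tsum_le_tsum (fun n => hb a j k n x) ((hsum a).mul_right _)
  let Φ : lp (fun _ : ℕ => ℂ) 1 →ₗ[ℂ] 𝓢(ℝ, ℂ) :=
    { toFun := fun a => ⟨fun x => ∑' n, (a n • φ n) x, hcd a, fun j k => ⟨_, hdec a j k⟩⟩
      map_add' := fun a b => by
        ext x
        change ∑' n, ((a n + b n) • φ n) x = ∑' n, (a n • φ n) x + ∑' n, (b n • φ n) x
        rw [← (hbx a x).tsum_add (hbx b x)]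
        simp only [smul_apply, smul_eq_mul, add_mul]
      map_smul' := fun c a => by
        ext x
        change ∑' n, ((c * a n) • φ n) x = c * ∑' n, (a n • φ n) x
        rw [← tsum_mul_left]
        simp only [smul_apply, smul_eq_mul, mul_assoc] }
  refine ⟨⟨Φ, ?_⟩, fun n => ?_⟩
  · refine WithSeminorms.continuous_normedSpace_dom _ (schwartz_withSeminorms ℂ ℝ ℂ) Φ ?_
    rintro ⟨j, k⟩
    refine ⟨⟨C j k, hC0 j k⟩, fun a => ?_⟩
    exact seminorm_le_bound ℂ j k (Φ a) (mul_nonneg (hC0 j k) (norm_nonneg a)) (hdec a j k)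
  · ext x
    change ∑' m, ((lp.single 1 n (1 : ℂ) : lp (fun _ : ℕ => ℂ) 1) m • φ m) x = φ n x
    rw [tsum_eq_single n]
    · simp
    · intro m hm
      rw [lp.single_apply_ne _ _ _ hm]
      simp

/-- A pointwise bounded family of tempered distributions is uniformly bounded on every bounded
sequence of Schwartz functions. -/
lemma exists_bound_of_pointwise_bounded {ι : Type*} {D : ι → 𝓢(ℝ, ℂ) →L[ℂ] ℂ}
    (hD : ∀ φ, ∃ C, ∀ i, ‖D i φ‖ ≤ C) {φ : ℕ → 𝓢(ℝ, ℂ)}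
    (hφ : ∀ j k : ℕ, ∃ C : ℝ, ∀ n, SchwartzMap.seminorm ℂ j k (φ n) ≤ C) :
    ∃ C, ∀ i n, ‖D i (φ n)‖ ≤ C := by
  obtain ⟨Φ, hΦ⟩ := exists_synthesis hφ
  obtain ⟨C, hC⟩ := banach_steinhaus (g := fun i => (D i).comp Φ) fun a => hD (Φ a)
  refine ⟨C, fun i n => ?_⟩
  have := ((D i).comp Φ).le_of_opNorm_le (hC i) (lp.single 1 n 1)
  rw [lp.norm_single (by simp), norm_one, mul_one] at this
  rw [← hΦ n]
  exact this

end SchwartzMap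

/-! ### Powers of the symbol on compactly supported functions -/

/-- Multiplication by `16 π⁴ k³`, the derivative of the symbol. -/
noncomputable def symbolDerivCLM : 𝓢(ℝ, ℂ) →L[ℂ] 𝓢(ℝ, ℂ) :=
  SchwartzMap.smulLeftCLM ℂ fun k : ℝ => 16 * (Real.pi : ℂ) ^ 4 * (k : ℂ) ^ 3

lemma symbolDerivCLM_apply (ψ : 𝓢(ℝ, ℂ)) (k : ℝ) :
    symbolDerivCLM ψ k = ((16 * Real.pi ^ 4 * k ^ 3 : ℝ) : ℂ) * ψ k := by
  rw [symbolDerivCLM, SchwartzMap.smulLeftCLM_apply_apply (hasTemperateGrowth_const_mul_pow _ _),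
    smul_eq_mul]
  push_cast
  ring

lemma derivCLM_iterate_symbolCLM (n : ℕ) (ψ : 𝓢(ℝ, ℂ)) :
    SchwartzMap.derivCLM ℂ ℂ (symbolCLM^[n + 1] ψ) =
      symbolCLM^[n + 1] (SchwartzMap.derivCLM ℂ ℂ ψ) +
        ((n : ℂ) + 1) • symbolCLM^[n] (symbolDerivCLM ψ) := by
  ext x
  rw [SchwartzMap.derivCLM_apply, add_apply, smul_apply,
    funext (iterate_symbolCLM_apply (n + 1) ψ), iterate_symbolCLM_apply, iterate_symbolCLM_apply,
    SchwartzMap.derivCLM_apply, symbolDerivCLM_apply]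
  have h0 : HasDerivAt (fun k : ℝ => 4 * Real.pi ^ 4 * k ^ 4) (16 * Real.pi ^ 4 * x ^ 3) x := by
    refine ((hasDerivAt_pow 4 x).const_mul (4 * Real.pi ^ 4)).congr_deriv ?_
    push_cast
    ring
  have h1 := (h0.ofReal_comp.fun_pow (n + 1)).fun_mul (ψ.hasDerivAt x)
  rw [h1.deriv]
  simp only [smul_eq_mul, Nat.add_sub_cancel]
  push_cast
  ring

lemma derivCLM_eq_zero_of_lt {ψ : 𝓢(ℝ, ℂ)} {R : ℝ} (hψ : ∀ x, R < |x| → ψ x = 0) (x : ℝ)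
    (hx : R < |x|) : SchwartzMap.derivCLM ℂ ℂ ψ x = 0 := by
  rw [SchwartzMap.derivCLM_apply]
  have h : ψ =ᶠ[𝓝 x] fun _ => (0 : ℂ) := by
    filter_upwards [continuous_abs.continuousAt.eventually_const_lt hx] with y hy using hψ y hy
  rw [h.deriv_eq, deriv_const]

/-- On the support of ψ the symbol is at most B, giving Bⁿ. Each derivative may fall on the n-th
power and costs one factor of order n, whence (n+1)^k. -/
lemma exists_seminorm_iterate_symbolCLM_le {R : ℝ} {B : ℝ} (hB : 1 ≤ B)
    (hR : 4 * Real.pi ^ 4 * R ^ 4 ≤ B) (k : ℕ) : ∀ (ψ : 𝓢(ℝ, ℂ)) (j : ℕ),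
    (∀ x, R < |x| → ψ x = 0) → ∃ M : ℝ, ∀ n : ℕ,
      SchwartzMap.seminorm ℂ j k (symbolCLM^[n] ψ) ≤ M * ((n : ℝ) + 1) ^ k * B ^ n := by
  have hB0 : 0 < B := by linarith
  induction k with
  | zero =>
    intro ψ j hψ
    refine ⟨SchwartzMap.seminorm ℂ j 0 ψ, fun n =>
      SchwartzMap.seminorm_zero_le_of_forall (by positivity) fun x => ?_⟩
    rw [pow_zero, mul_one, iterate_symbolCLM_apply, norm_mul, norm_pow, Complex.norm_real,
      Real.norm_of_nonneg (by positivity)]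
    have h1 := SchwartzMap.abs_pow_mul_norm_le j ψ x
    rcases lt_or_ge R |x| with hx | hx
    · rw [hψ x hx]
      simp only [norm_zero, mul_zero]
      positivity
    · have h2 : 4 * Real.pi ^ 4 * x ^ 4 ≤ B := by
        refine le_trans ?_ hR
        have : x ^ 4 ≤ R ^ 4 := by
          rw [← Even.pow_abs (by decide : Even 4) x]
          exact pow_le_pow_left₀ (abs_nonneg _) hx 4
        gcongr
      calc |x| ^ j * ((4 * Real.pi ^ 4 * x ^ 4) ^ n * ‖ψ x‖)
          = (|x| ^ j * ‖ψ x‖) * (4 * Real.pi ^ 4 * x ^ 4) ^ n := by ring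
        _ ≤ SchwartzMap.seminorm ℂ j 0 ψ * B ^ n := by gcongr
  | succ k ih =>
    intro ψ j hψ
    obtain ⟨M₁, h₁⟩ := ih (SchwartzMap.derivCLM ℂ ℂ ψ) j (derivCLM_eq_zero_of_lt hψ)
    obtain ⟨M₂, h₂⟩ := ih (symbolDerivCLM ψ) j fun x hx => by
      rw [symbolDerivCLM_apply, hψ x hx, mul_zero]
    have hM₁ : 0 ≤ M₁ := by simpa using (apply_nonneg _ _).trans (h₁ 0)
    have hM₂ : 0 ≤ M₂ := by simpa using (apply_nonneg _ _).trans (h₂ 0)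
    refine ⟨M₁ + M₂, fun n => (SchwartzMap.seminorm_succ_le j k _).trans ?_⟩
    rcases n with _ | n
    · have := h₁ 0
      simp only [Function.iterate_zero_apply, Nat.cast_zero, zero_add, one_pow, mul_one, pow_zero]
        at this ⊢
      linarith
    rw [derivCLM_iterate_symbolCLM]
    refine (map_add_le_add _ _ _).trans ?_
    rw [map_smul_eq_mul]
    have hn : ‖((n : ℂ) + 1)‖ = (n : ℝ) + 1 := by
      rw [← Nat.cast_succ, Complex.norm_natCast, Nat.cast_succ]
    rw [hn]
    have e1 := h₁ (n + 1)
    have e2 := h₂ n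
    have hn0 : (0 : ℝ) ≤ n := Nat.cast_nonneg n
    push_cast at e1 ⊢
    have f1 : M₁ * ((n : ℝ) + 1 + 1) ^ k * B ^ (n + 1) ≤
        M₁ * ((n : ℝ) + 1 + 1) ^ (k + 1) * B ^ (n + 1) := by
      gcongr
      · linarith
      · omega
    have f2 : ((n : ℝ) + 1) * (M₂ * ((n : ℝ) + 1) ^ k * B ^ n) ≤
        M₂ * ((n : ℝ) + 1 + 1) ^ (k + 1) * B ^ (n + 1) := by
      rw [show ((n : ℝ) + 1) * (M₂ * ((n : ℝ) + 1) ^ k * B ^ n) =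
        M₂ * ((n : ℝ) + 1) ^ (k + 1) * B ^ n by ring]
      gcongr
      · linarith
      · omega
    have f3 : ((n : ℝ) + 1) * SchwartzMap.seminorm ℂ j k (symbolCLM^[n] (symbolDerivCLM ψ)) ≤
        ((n : ℝ) + 1) * (M₂ * ((n : ℝ) + 1) ^ k * B ^ n) := by gcongr
    linarith

lemma exists_seminorm_iterate_symbolCLM_le_geometric {ψ : 𝓢(ℝ, ℂ)} {R : ℝ}
    (hψ : ∀ x, R < |x| → ψ x = 0) : ∃ B : ℝ, 0 < B ∧ ∀ j k : ℕ, ∃ C : ℝ, ∀ n,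
      SchwartzMap.seminorm ℂ j k (((B : ℂ) ^ n)⁻¹ • symbolCLM^[n] ψ) ≤ C := by
  set B := max 1 (4 * Real.pi ^ 4 * R ^ 4) with hBdef
  have hB : 1 ≤ B := le_max_left _ _
  have hB0 : 0 < B := by linarith
  -- Doubling the base absorbs the factor (n+1)^k for all k at once, so a single base serves every
  -- seminorm.
  refine ⟨2 * B, by positivity, fun j k => ?_⟩
  obtain ⟨M, hM⟩ := exists_seminorm_iterate_symbolCLM_le hB (le_max_right _ _) k ψ j hψ
  have hM0 : 0 ≤ M := by simpa using (apply_nonneg _ _).trans (hM 0)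
  have hlim : Tendsto (fun n : ℕ => (n : ℝ) ^ k * (1 / 2 : ℝ) ^ n) atTop (𝓝 0) :=
    tendsto_pow_const_mul_const_pow_of_abs_lt_one k (by norm_num)
  obtain ⟨K, hK⟩ := hlim.bddAbove_range
  refine ⟨M * (2 * K), fun n => ?_⟩
  rw [map_smul_eq_mul, norm_inv, norm_pow, Complex.norm_real, Real.norm_of_nonneg (by positivity),
    inv_mul_le_iff₀ (by positivity)]
  refine (hM n).trans ?_
  have h := hK (mem_range_self (n + 1))
  have h2 : ((n : ℝ) + 1) ^ k ≤ 2 * K * 2 ^ n := by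
    simp only [Nat.cast_succ, one_div, inv_pow] at h
    rw [← div_eq_mul_inv, div_le_iff₀ (by positivity)] at h
    refine h.trans_eq ?_
    ring
  calc M * ((n : ℝ) + 1) ^ k * B ^ n ≤ M * (2 * K * 2 ^ n) * B ^ n := by gcongr
    _ = (2 * B) ^ n * (M * (2 * K)) := by ring

/-! ### Uniqueness -/

/-- The action of a tempered distribution on Fourier transforms of Schwartz functions. -/
noncomputable def fourierSide (T : 𝓢'(ℝ, ℂ)) : 𝓢(ℝ, ℂ) →L[ℂ] ℂ :=
  (T : 𝓢(ℝ, ℂ) →L[ℂ] ℂ).comp (FourierTransform.fourierCLM ℂ 𝓢(ℝ, ℂ))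

namespace IsRodFundamentalSolution

variable {ν : ℝ} {T : ℝ → 𝓢'(ℝ, ℂ)}

lemma tendsto_apply (h : IsRodFundamentalSolution ν T) (φ : 𝓢(ℝ, ℂ)) :
    Tendsto (fun t => T t φ) (𝓝[>] 0) (𝓝 (φ 0)) :=
  PointwiseConvergenceCLM.tendsto_iff_forall_tendsto.1 h.initial_value φ

lemma continuousOn (h : IsRodFundamentalSolution ν T) (φ : 𝓢(ℝ, ℂ)) :
    ContinuousOn (fun t => T t φ) (Ioi 0) := (h.caputoDifferentiable φ).1.continuousOn

lemma bounded (h : IsRodFundamentalSolution ν T) (φ : 𝓢(ℝ, ℂ)) (t : ℝ) :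
    ∃ C, ∀ s ∈ Ioo 0 t, ‖T s φ‖ ≤ C :=
  bounded_Ioo_of_tendsto (h.continuousOn φ) (h.tendsto_apply φ) t

lemma volterraSeq (h : IsRodFundamentalSolution ν T) (hν0 : 0 < ν) (hν1 : ν ≤ 1) (ψ : 𝓢(ℝ, ℂ)) :
    VolterraSeq (2 * ν) (fun n => (𝓕 (symbolCLM^[n] ψ)) 0) (fun n t => T t (𝓕 (symbolCLM^[n] ψ))) where
  continuousOn n := h.continuousOn _
  bounded n t := h.bounded _ t
  eq n t ht := by
    refine volterra_of_caputo (by positivity) (by linarith) (h.caputoDifferentiable _) (fun s hs => ?_)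
      (h.continuousOn _) (h.bounded _) (h.tendsto_apply _) (fun hν => h.initial_velocity (by linarith) _) ht
    rw [h.equation _ s hs, iterate_derivCLM_fourier, Function.iterate_succ_apply']
    ring

end IsRodFundamentalSolution

lemma VolterraSeq.sub {α : ℝ} (hα : 0 < α) {c : ℕ → ℂ} {G H : ℕ → ℝ → ℂ} (hG : VolterraSeq α c G)
    (hH : VolterraSeq α c H) : VolterraSeq α 0 (fun n t => G n t - H n t) where
  continuousOn n := (hG.continuousOn n).sub (hH.continuousOn n)
  bounded n t := by
    obtain ⟨C, hC⟩ := hG.bounded n t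
    obtain ⟨C', hC'⟩ := hH.bounded n t
    exact ⟨C + C', fun s hs => (norm_sub_le _ _).trans (add_le_add (hC s hs) (hC' s hs))⟩
  eq n t ht := by
    obtain ⟨C, hC⟩ := hG.bounded (n + 1) t
    obtain ⟨C', hC'⟩ := hH.bounded (n + 1) t
    rw [rlInt_sub
      (integrableOn_kernel_mul_of_bounded hα (aestronglyMeasurable_Ioo (hG.continuousOn _) t) hC)
      (integrableOn_kernel_mul_of_bounded hα (aestronglyMeasurable_Ioo (hH.continuousOn _) t) hC'),
      hG.eq n t ht, hH.eq n t ht, Pi.zero_apply]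
    ring

/-- With vanishing constants, iteration leaves only the remainder, bounded by C (B
t^α)^{N+1}/Γ(α(N+1)+1). These are terms of a convergent Mittag-Leffler series, so they tend to 0. -/
lemma VolterraSeq.eq_zero {α : ℝ} (hα : 0 < α) {G : ℕ → ℝ → ℂ} (hG : VolterraSeq α 0 G) {t : ℝ}
    (ht : 0 < t) {C B : ℝ} (hb : ∀ n, ∀ s ∈ Ioo 0 t, ‖G n s‖ ≤ C * B ^ n) : G 0 t = 0 := by
  have h1 : ∀ N : ℕ, ‖G 0 t‖ ≤ C * ((B * t ^ α) ^ (N + 1) / Real.Gamma (α * ((N + 1 : ℕ) : ℝ) + 1)) := by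
    intro N
    have h := hG.iterate hα N ht
    simp only [Pi.zero_apply, mul_zero, zero_mul, Finset.sum_const_zero, zero_add] at h
    rw [h, norm_mul, norm_pow, norm_neg, norm_one, one_pow, one_mul]
    have hβ : 0 < α * ((N : ℝ) + 1) := by positivity
    refine (norm_rlInt_le hβ ht (hb (N + 1))).trans_eq ?_
    rw [mul_pow, ← Real.rpow_mul_natCast ht.le]
    push_cast
    ring
  have h2 := (summable_mittagLeffler hα (B * t ^ α)).tendsto_atTop_zero
  have h3 := ((tendsto_add_atTop_iff_nat 1).2 h2).const_mul C
  rw [mul_zero] at h3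
  exact norm_le_zero_iff.1 (ge_of_tendsto' h3 h1)

theorem IsRodFundamentalSolution.unique {ν : ℝ} (hν0 : 0 < ν) (hν1 : ν ≤ 1) {T T' : ℝ → 𝓢'(ℝ, ℂ)}
    (h : IsRodFundamentalSolution ν T) (h' : IsRodFundamentalSolution ν T') {t : ℝ} (ht : 0 < t) :
    T' t = T t := by
  have hα : 0 < 2 * ν := by positivity
  set D : ℝ → 𝓢(ℝ, ℂ) →L[ℂ] ℂ := fun s => fourierSide (T' s) - fourierSide (T s) with hD
  have hDa : ∀ s ψ, D s ψ = T' s (𝓕 ψ) - T s (𝓕 ψ) := fun s ψ => rfl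
  have key : ∀ ψ, D t ψ = 0 := by
    -- Compact support is required on the Fourier side, where the symbol acts: it bounds the
    -- otherwise unbounded multiplier.
    refine SchwartzMap.eq_zero_of_forall_compactSupport (D t) fun ψ ⟨R, hψ⟩ => ?_
    obtain ⟨B, hB, hC⟩ := exists_seminorm_iterate_symbolCLM_le_geometric hψ
    have hV := (h'.volterraSeq hν0 hν1 ψ).sub hα (h.volterraSeq hν0 hν1 ψ)
    -- For each test function the pairings are bounded on (0, t) by continuity and the initial
    -- condition. Uniform boundedness on the sequence B^{-n}λⁿψ gives one constant for all n and s.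
    obtain ⟨C, hC⟩ := SchwartzMap.exists_bound_of_pointwise_bounded (D := fun s : Ioo 0 t => D s)
      (fun φ => by
        obtain ⟨C₁, h₁⟩ := h'.bounded (𝓕 φ) t
        obtain ⟨C₂, h₂⟩ := h.bounded (𝓕 φ) t
        exact ⟨C₁ + C₂, fun s => (norm_sub_le _ _).trans (add_le_add (h₁ s s.2) (h₂ s s.2))⟩) hC
    refine hV.eq_zero hα ht (C := C) (B := B) fun n s hs => ?_
    have := hC ⟨s, hs⟩ n
    rw [map_smul, smul_eq_mul, norm_mul, norm_inv, norm_pow, Complex.norm_real,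
      Real.norm_of_nonneg hB.le, inv_mul_le_iff₀ (by positivity), mul_comm] at this
    exact this
  ext φ
  have := key (𝓕⁻ φ)
  rw [hDa, FourierTransform.fourier_fourierInv_eq] at this
  exact sub_eq_zero.1 this

/-! ### The main theorem -/

theorem theorem3p2 (ν : ℝ) (hν0 : 0 < ν) (hν1 : ν ≤ 1) :
    (∀ x t : ℝ, 0 < t →
      Summable (rodTermSin ν x t) ∧ Summable (rodTermInvGamma ν x t) ∧
      rodSolution ν x t = 1 / √(2 * t ^ ν) * ∑' m : ℕ, rodTermInvGamma ν x t m) ∧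
    ∃ T : ℝ → 𝓢'(ℝ, ℂ),
      IsRodFundamentalSolution ν T ∧
      (∀ T' : ℝ → 𝓢'(ℝ, ℂ), IsRodFundamentalSolution ν T' → ∀ t : ℝ, 0 < t → T' t = T t) ∧
      ∀ t : ℝ, 0 < t → ∀ φ : 𝓢(ℝ, ℂ),
        Integrable (fun x : ℝ => (rodSolution ν x t : ℂ) * φ x) ∧
        T t φ = ∫ x : ℝ, (rodSolution ν x t : ℂ) * φ x := by
  refine ⟨fun x t _ => ⟨summable_rodTermSin hν0 hν1 x t, summable_rodTermInvGamma hν0 hν1 x t,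
    rodSolution_eq hν0 x t⟩, ?_⟩
  obtain ⟨T, hT⟩ := exists_rodDistribution hν0 hν1
  have hsol := isRodFundamentalSolution_of_multiplier hν0 hν1 hT
  refine ⟨T, hsol, fun T' hT' t ht => hsol.unique hν0 hν1 hT' ht, fun t ht φ => ?_⟩
  obtain ⟨h1, h2⟩ := rodSolution_pairing hν0 hν1 ht φ
  refine ⟨h1, ?_⟩
  have h3 := hT t (𝓕⁻ φ)
  rw [FourierTransform.fourier_fourierInv_eq] at h3
  rw [h3, h2]
  simp only [rodMultiplier, abs_of_pos ht]
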